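/- Let $B_n$ be the braid group on $n$ strands, with Artin generators $\sigma_1,\dots,\sigma_{n-1}$, band generators $a_{ij}=(\sigma_{j-1}\cdots\sigma_{i+1})\,\sigma_i\,(\sigma_{j-1}\cdots\sigma_{i+1})^{-1}$ for $1\le i<j\le n$, and $\delta=\sigma_{n-1}\cdots\sigma_2\sigma_1$. A band word is a word in the letters $a_{ij}^{\pm1}$, and $\|\beta\|$ is the least length of a band word representing $\beta$. A braid is strongly quasipositive (SQP) if it is represented by a band word without negative letters, and almost strongly quasipositive (ASQP) if it is represented by a band word with at most one negative letter. Write $V\le W$ if $W=PVQ$ with $P,Q$ SQP, and put $\inf(\beta)=\max\{r\in\mathbb Z:\delta^r\le\beta\}$, $\sup(\beta)=\min\{s\in\mathbb Z:\beta\le\delta^s\}$, $\ell(\beta)=\sup(\beta)-\inf(\beta)$. A canonical factor is a braid $A$ with $e\le A\le\delta$. For canonical factors $A,B$, the word $AB$ is maximally left-weighted if $A'=A$ whenever $AB=A'B'$ with canonical factors $A',B'$ such that $A'=AQ$ for some canonical factor $Q$. The left-canonical form of $\beta$ is its unique factorization $\beta=\delta^rA_1\cdots A_k$ with $r\in\mathbb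 Z$, $k\ge 0$, canonical factors $A_i\ne e,\delta$, and every $A_iA_{i+1}$ maximally left-weighted; here $r=\inf(\beta)$. The super summit set $\mathrm{SSS}([\beta])$ is the set of the conjugates of $\beta$ with the least value of $\ell$ among all conjugates of $\beta$. **Theorem.** (a) For $\beta\in B_4$ the following are equivalent: 1. $\beta$ is conjugate to an ASQP braid but not to any SQP braid; 2. every $\beta'\in\mathrm{SSS}([\beta])$ has $\inf(\beta')=-1$, and its left-canonical form $\delta^{-1}A_1\cdots A_k$ contains a canonical factor $A_i$ with $\|A_i\|=2$; 3. there is a $\beta'\in\mathrm{SSS}([\beta])$ with $\inf(\beta')=-1$ whose left-canonical form $\delta^{-1}A_1\cdots A_k$ contains a canonical factor $A_i$ with $\|A_i\|=2$. (b) A braid $\beta\in B_3$ is conjugate to an ASQP braid but not to any SQP braid if and only if every $\beta'\in\mathrm{SSS}([\beta])$ has $\inf(\beta')=-1$ and $\beta$ is not conjugate to $\delta^{-1}$. (c) For $n=3$ and for $n=4$, the problem whether the $n$-braid represented by a given band word is conjugate to an ASQP braid but not to any SQP braid can be decided by a Turing machine in time polynomial in the length of the word. -/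

import Mathlib

namespace BKL

/-- Artin's relations among `n - 1` letters; the letter `i` stands for the Artin generator
which exchanges the strands `i` and `i + 1` (everything is numbered from `0`). -/
def artinRels (n : ℕ) : Set (FreeGroup (Fin (n - 1))) :=
  {r | ∃ i j : Fin (n - 1), i.val + 1 < j.val ∧
      r = (FreeGroup.of i * FreeGroup.of j) * (FreeGroup.of j * FreeGroup.of i)⁻¹} ∪
  {r | ∃ i j : Fin (n - 1), j.val = i.val + 1 ∧
      r = (FreeGroup.of i * FreeGroup.of j * FreeGroup.of i) *
        (FreeGroup.of j * FreeGroup.of i * FreeGroup.of j)⁻¹}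

/-- The Artin braid group on `n` strands. -/
abbrev Braid (n : ℕ) : Type := PresentedGroup (artinRels n)

/-- The Artin generator exchanging the strands `k` and `k + 1`, for `k < n - 1`
(and `1` outside this range, which is never used). -/
def sigma {n : ℕ} (k : ℕ) : Braid n :=
  if h : k < n - 1 then PresentedGroup.of ⟨k, h⟩ else 1

/-- The descending product `σ_{j-1} σ_{j-2} ⋯ σ_i` (equal to `1` if `j ≤ i`). -/
def descProd {n : ℕ} (i j : ℕ) : Braid n :=
  ((List.Ico i j).reverse.map sigma).prod

/-- The element `δ = σ_{n-2} ⋯ σ_1 σ_0`. -/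
def delta (n : ℕ) : Braid n := descProd 0 (n - 1)

/-- Names of band generators: pairs of strands `i < j`. -/
abbrev Band (n : ℕ) : Type := {p : Fin n × Fin n // p.1 < p.2}

/-- The band generator
`a_{ij} = (σ_{j-1} ⋯ σ_{i+1}) σ_i (σ_{j-1} ⋯ σ_{i+1})⁻¹`. -/
def Band.toBraid {n : ℕ} (a : Band n) : Braid n :=
  descProd (a.1.1.val + 1) a.1.2.val * sigma a.1.1.val *
    (descProd (a.1.1.val + 1) a.1.2.val)⁻¹

/-- A signed band: `(a, true)` is the positive band `a`, `(a, false)` the negative band `a⁻¹`. -/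
abbrev SignedBand (n : ℕ) : Type := Band n × Bool

/-- The braid of a signed band. -/
def SignedBand.toBraid {n : ℕ} (x : SignedBand n) : Braid n :=
  if x.2 then x.1.toBraid else x.1.toBraid⁻¹

/-- Words in the band generators and their inverses. -/
abbrev BandWord (n : ℕ) : Type := List (SignedBand n)

/-- The braid represented by a band word. -/
def BandWord.toBraid {n : ℕ} (W : BandWord n) : Braid n :=
  (W.map SignedBand.toBraid).prod

/-- The number of negative bands in a band word. -/
def BandWord.nb {n : ℕ} (W : BandWord n) : ℕ := W.countP (fun x => !x.2)

/-- The negative band number of a braid: the least number of negative bands in a band word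
representing it (every braid has such a word, see `exists_bandWord`). -/
noncomputable def nb {n : ℕ} (β : Braid n) : ℕ :=
  sInf {m | ∃ W : BandWord n, W.toBraid = β ∧ W.nb = m}

/-- The minimal length of a band word representing the braid. -/
noncomputable def bandLength {n : ℕ} (β : Braid n) : ℕ :=
  sInf {m | ∃ W : BandWord n, W.toBraid = β ∧ W.length = m}

/-- The filtration of the braid group by the negative band number. -/
def filtration (n i : ℕ) : Set (Braid n) := {β | nb β ≤ i}

/-- Strongly quasipositive braids. -/
def SQP (n : ℕ) : Set (Braid n) := filtration n 0

/-- Almost strongly quasipositive braids. -/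
def ASQP (n : ℕ) : Set (Braid n) := filtration n 1

/-- `β` is conjugate to an almost strongly quasipositive braid, but not to any
strongly quasipositive braid. -/
def ConjASQPNotSQP {n : ℕ} (β : Braid n) : Prop :=
  (∃ γ ∈ ASQP n, IsConj β γ) ∧ ¬ ∃ γ ∈ SQP n, IsConj β γ

/-- The partial order on braids: `V ≤ W` if `W = P V Q` with `P`, `Q` strongly quasipositive. -/
def Le {n : ℕ} (V W : Braid n) : Prop :=
  ∃ P ∈ SQP n, ∃ Q ∈ SQP n, W = P * V * Q

/-- `inf β` is the largest `r` with `δ ^ r ≤ β`. (For `n ≥ 2` the set is nonempty and bounded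
above, so that its supremum is a maximum.) -/
noncomputable def inf {n : ℕ} (β : Braid n) : ℤ := sSup {r : ℤ | Le (delta n ^ r) β}

/-- `sup β` is the least `s` with `β ≤ δ ^ s`. (For `n ≥ 2` the set is nonempty and bounded
below, so that its infimum is a minimum.) -/
noncomputable def sup {n : ℕ} (β : Braid n) : ℤ := sInf {s : ℤ | Le β (delta n ^ s)}

/-- The canonical length. -/
noncomputable def canonicalLength {n : ℕ} (β : Braid n) : ℤ := sup β - inf β

/-- Canonical factors: the braids between `1` and `δ`. -/
def CnFct (n : ℕ) : Set (Braid n) := {A | Le 1 A ∧ Le A (delta n)}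

/-- `A ≺ B`: the canonical factor `A` can be completed on the right by a canonical factor
to the canonical factor `B`. -/
def Prec {n : ℕ} (A B : Braid n) : Prop := ∃ Q ∈ CnFct n, A * Q = B

/-- The word `A B` is maximally left-weighted: it cannot be rewritten as `A' B'` with canonical
factors `A'`, `B'` such that `A ≺ A'`, unless `A' = A` (and so `B' = B`). -/
def MaxLeftWeighted {n : ℕ} (A B : Braid n) : Prop :=
  ∀ A' ∈ CnFct n, ∀ B' ∈ CnFct n, A * B = A' * B' → Prec A A' → A' = A

/-- `δ ^ r A₁ ⋯ A_k`, with `L = [A₁, …, A_k]`, is the left-canonical form of `β`. -/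
structure IsLCF {n : ℕ} (β : Braid n) (r : ℤ) (L : List (Braid n)) : Prop where
  eq_prod : β = delta n ^ r * L.prod
  factor : ∀ A ∈ L, A ∈ CnFct n ∧ A ≠ 1 ∧ A ≠ delta n
  weighted : L.IsChain MaxLeftWeighted

/-- The super summit set of the conjugacy class of `β`: the conjugates of `β` whose
canonical length is minimal among all conjugates. -/
def SSS {n : ℕ} (β : Braid n) : Set (Braid n) :=
  {γ | IsConj β γ ∧ ∀ γ', IsConj β γ' → canonicalLength γ ≤ canonicalLength γ'}

/-- A set of words over a finite alphabet is decidable in polynomial time: some (multi-stack)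
Turing machine with finite alphabets computes its characteristic function, within a number of
steps that is bounded by a polynomial in the length of the word. -/
def DecidableInPolyTime {Γ : Type} [Fintype Γ] (S : Set (List Γ)) : Prop :=
  ∃ f : List Γ → Bool, (∀ w, f w = true ↔ w ∈ S) ∧
    ∃ M : Turing.TM2ComputableInPolyTime (id : List Γ → List Γ) Computability.encodeBool f,
      ∀ k, Finite (M.tm.Γ k)

theorem sigma_eq_band {n : ℕ} (k : Fin (n - 1)) :
    ∃ a : Band n, a.toBraid = PresentedGroup.of k := by
  have hk := k.2
  refine ⟨⟨(⟨k.val, by omega⟩, ⟨k.val + 1, by omega⟩), by simp⟩, ?_⟩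
  simp [Band.toBraid, descProd, sigma]

/-- Every braid is represented by a band word. -/
theorem exists_bandWord {n : ℕ} (β : Braid n) : ∃ W : BandWord n, W.toBraid = β := by
  obtain ⟨x, rfl⟩ := PresentedGroup.mk_surjective (artinRels n) β
  induction x using FreeGroup.induction_on with
  | C1 => exact ⟨[], by simp [BandWord.toBraid]⟩
  | of k =>
    obtain ⟨a, ha⟩ := sigma_eq_band k
    exact ⟨[(a, true)], by simp [BandWord.toBraid, SignedBand.toBraid, ha, PresentedGroup.of]⟩
  | inv_of k _ =>
    obtain ⟨a, ha⟩ := sigma_eq_band k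
    exact ⟨[(a, false)], by simp [BandWord.toBraid, SignedBand.toBraid, ha, PresentedGroup.of]⟩
  | mul x y hx hy =>
    obtain ⟨V, hV⟩ := hx
    obtain ⟨W, hW⟩ := hy
    refine ⟨V ++ W, ?_⟩
    rw [map_mul, ← hV, ← hW]
    simp [BandWord.toBraid]

end BKL

/-!
The proof works with the dual Garside structure of the braid group, whose simple elements are the
canonical factors. For three and four strands these are 5 and 14 elements, and the whole structure
is encoded in a finite table, `BKL.Germ`, on which the axioms are checked by evaluation (`germThree`,
`germFour`). The braid group acts on the set of formal normal forms `δ ^ r A₁ ⋯ A_k`; the image of the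
trivial normal form defines `Germ.nf`, and the action shows at once that normal forms exist and are
unique. So `inf` and `sup` are read off from the normal form (`Germ.inf_eq`, `Germ.sup_eq`), and strongly
quasipositive means `inf ≥ 0`.

*Cycling raises `inf`.* Let a positive braid `d` conjugate `x` to a braid with larger `inf`, and let
`A` be the first factor of `x`, moved in front of the power of `δ`. Then `d A δ⁻¹` is positive as
well, is shorter than `d`, and conjugates the cycled braid (up to `δ`) to the same target
(`Germ.pos_descent`). Therefore the elements of the super summit set have maximal `inf`
(`Germ.lo_le_of_mem_SSS`). If `d` is shortest possible, the simple head of the conjugator shrinks in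
every step; as it has length at most two for `n ≤ 4`, two cyclings raise `inf` unless it is maximal
(`Germ.lo_lt_cyc_cyc`).

*Parts (a) and (b).* A braid `δ⁻¹ P A Q` with a factor `A` of length `n - 2` equals
`(δ⁻¹ P δ) b⁻¹ Q` with a band `b`, so that it is almost strongly quasipositive; it is not conjugate
to a strongly quasipositive one if `inf = -1` is maximal. Conversely a braid with one negative band
is conjugate to `δ⁻¹ B a₁ ⋯ a_p` with bands `a_i` and a simple `B` of length `n - 2`. If an element of
the super summit set had no factor of length `n - 2`, then all its factors were bands, and comparison
of exponent sums would give a conjugate of smaller canonical length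
(`Germ.conjASQPNotSQP_SSS`).

*Part (c).* A word with `m` negative letters is brought to the form `L δ ^ (-m)` and cycled `2 m`
times, which raises `inf` to its maximum in the class, or at least to `0`; the answer is whether `inf = -1`
and some factor has length `n - 2`. If `inf = -1` is stable under the last cycling and no factor has
length `n - 2`, then the braid is rigid, its inverse is only rotated by cycling, and so its `sup` is
minimal; but then the class has no almost strongly quasipositive element
(`Germ.not_conj_ASQP_of_terminal`). The algorithm works on a word in simple elements and two
counters, and a Turing machine with six stacks carries it out in quadratic time
(`Germ.reach_accepts`).
-/

namespace BKL

/-! ### The dual Garside structure and its normal form -/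

/-- A finite model of the dual Garside structure of `Braid n`: `S` is the set of simple elements
(the canonical factors), `one` and `top` stand for `1` and `δ`, and `ev` evaluates a simple element
as a braid. For simple elements `a`, `b` the pair `lw a b` is the left-weighted factorization of the
product `a b`: its first entry is the largest simple prefix (the head) of `a b`, the second entry is
what remains. Thus `(lw a b).2 = one` says that `a b` is simple, and `lw a b = (a, b)` says that
`a`, `b` is left-weighted. Moreover `tau` is conjugation by `δ` (`a δ = δ (tau a)`), `comp a` is the
right complement (`a (comp a) = δ`), `len` is the length in band generators, and `atom`, `band` are
the simple elements given by the Artin and by the band generators.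

Nothing about `ev` beyond its values on generators and compatibility with `lw` is assumed; that
normal forms are unique, and in particular that `ev` is injective, is a consequence. All other
fields are finite checks on the tables of `lw`, `tau`, `comp` and `len`. The field `generated` says
that `S` is reached from the atoms by products and by left and right quotients inside `S`. -/
structure Germ (n : ℕ) where
  S : Type
  [fintype : Fintype S]
  [decEq : DecidableEq S]
  one : S
  top : S
  top_ne_one : top ≠ one
  lw : S → S → S × S
  tau : Equiv.Perm S
  comp : S → S
  len : S → ℕ
  atom : Fin (n - 1) → S
  band : Band n → S
  ev : S → Braid n
  one_lw : ∀ a, lw one a = (a, one)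
  lw_one : ∀ a, lw a one = (a, one)
  lw_top : ∀ a, lw a top = (top, tau a)
  top_lw : ∀ a, lw top a = (top, a)
  lw_comp : ∀ a, lw a (comp a) = (top, one)
  comp_lw : ∀ a, lw (comp a) (tau a) = (top, one)
  lw_tau : ∀ a b, lw (tau a) (tau b) = (tau (lw a b).1, tau (lw a b).2)
  lw_idem : ∀ a b, lw (lw a b).1 (lw a b).2 = lw a b
  lw_mul : ∀ a b x, (lw a b).2 = one →
    (lw (lw a b).1 x).1 = (lw a (lw b x).1).1 ∧
    lw (lw a (lw b x).1).2 (lw b x).2 = ((lw (lw a b).1 x).2, one)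
  lw_chain_left : ∀ s a b, lw a b = (a, b) →
    lw (lw s a).1 (lw (lw s a).2 b).1 = ((lw s a).1, (lw (lw s a).2 b).1)
  lw_chain_right : ∀ a b s, lw a b = (a, b) →
    lw (lw a (lw b s).1).2 (lw b s).2 = ((lw a (lw b s).1).2, (lw b s).2)
  lw_fst_ne_one : ∀ a b, (lw a b).1 = one → a = one ∧ b = one
  exists_lw_fst : ∀ a b, ∃ u, lw a u = ((lw a b).1, one)
  len_lw : ∀ a b, len (lw a b).1 + len (lw a b).2 = len a + len b
  len_eq_zero : ∀ a, len a = 0 → a = one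
  len_one : len one = 0
  len_top : len top = n - 1
  len_lt_top : ∀ a, a ≠ top → len a < n - 1
  atom_comm : ∀ i j : Fin (n - 1), i.val + 1 < j.val →
    (lw (atom i) (atom j)).2 = one ∧ lw (atom j) (atom i) = lw (atom i) (atom j)
  atom_braid : ∀ i j : Fin (n - 1), j.val = i.val + 1 → (lw (atom j) (atom i)).2 = one ∧
    ∃ b, lw (atom i) b = lw (atom j) (atom i) ∧ lw b (atom j) = lw (atom j) (atom i)
  generated : ∀ P : S → Prop, P one → (∀ i, P (atom i)) →
    (∀ a b, (lw a b).2 = one → P a → P b → P (lw a b).1) →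
    (∀ a b, (lw a b).2 = one → P b → P (lw a b).1 → P a) →
    (∀ a b, (lw a b).2 = one → P a → P (lw a b).1 → P b) → ∀ a, P a
  len_band : ∀ a, len (band a) = 1
  exists_band : ∀ s, len s = 1 → ∃ a, band a = s
  exists_len_one : ∀ s, s ≠ one → ∃ a b, len a = 1 ∧ lw a b = (s, one)
  ev_one : ev one = 1
  ev_top : ev top = delta n
  ev_atom : ∀ i, ev (atom i) = PresentedGroup.of i
  ev_band : ∀ a, ev (band a) = a.toBraid
  ev_lw : ∀ a b, ev (lw a b).1 * ev (lw a b).2 = ev a * ev b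

namespace Germ
variable {n : ℕ} (D : Germ n)

instance : Fintype D.S := D.fintype
instance : DecidableEq D.S := D.decEq

/-- A word in the simple elements other than `one` in which every two neighbours are
left-weighted; factors `δ` are allowed, and then stand at the front. -/
structure IsNF (L : List D.S) : Prop where
  chain : L.IsChain (fun a b => D.lw a b = (a, b))
  ne_one : ∀ a ∈ L, a ≠ D.one

/-- Left multiplication of a word in normal form by a simple element, in one pass from left to
right. -/
def mulL : D.S → List D.S → List D.S
  | s, [] => if s = D.one then [] else [s]
  | s, a :: L => (D.lw s a).1 :: mulL (D.lw s a).2 L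

theorem isNF_nil : D.IsNF [] := ⟨List.isChain_nil, by simp⟩

theorem IsNF.tail {D : Germ n} {a : D.S} {L : List D.S} (h : D.IsNF (a :: L)) : D.IsNF L :=
  ⟨h.chain.tail, fun b hb => h.ne_one b (by simp [hb])⟩

theorem mulL_one (L : List D.S) : D.mulL D.one L = L := by
  induction L with
  | nil => simp [mulL]
  | cons a L ih => simp [mulL, D.one_lw, ih]

theorem mulL_cons_of_isNF {a : D.S} {L : List D.S} (h : D.IsNF (a :: L)) :
    D.mulL a L = a :: L := by
  induction L generalizing a with
  | nil => simp [mulL, h.ne_one a (by simp)]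
  | cons b L ih =>
    have hab := (List.isChain_cons_cons.1 h.chain).1
    simp [mulL, hab, ih h.tail]

/-- Associativity of `Germ.lw` makes left multiplication compatible with products in the germ. -/
theorem mulL_mulL (a b : D.S) (hab : (D.lw a b).2 = D.one) (L : List D.S) :
    D.mulL a (D.mulL b L) = D.mulL (D.lw a b).1 L := by
  induction L generalizing a b with
  | nil =>
    by_cases hb : b = D.one
    · subst hb; simp [mulL, D.lw_one]
    · have : (D.lw a b).1 ≠ D.one := fun h => hb (D.lw_fst_ne_one a b h).2
      simp [mulL, hb, this, hab]
  | cons x L ih =>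
    obtain ⟨h1, h2⟩ := D.lw_mul a b x hab
    simp only [mulL, h1, List.cons.injEq, true_and]
    rw [ih _ _ (by rw [h2]), h2]

theorem isNF_mulL (s : D.S) {L : List D.S} (h : D.IsNF L) : D.IsNF (D.mulL s L) := by
  induction L generalizing s with
  | nil =>
    by_cases hs : s = D.one
    · simpa [mulL, hs] using D.isNF_nil
    · simp only [mulL, hs, if_false]; exact ⟨by simp, by simpa using hs⟩
  | cons a L ih =>
    have h2 := ih (D.lw s a).2 h.tail
    refine ⟨?_, ?_⟩
    · simp only [mulL]
      cases L with
      | nil =>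
        by_cases hq : (D.lw s a).2 = D.one
        · simp [mulL, hq]
        · simp [mulL, hq, D.lw_idem]
      | cons b L =>
        have hab := (List.isChain_cons_cons.1 h.chain).1
        refine List.isChain_cons_cons.2 ⟨D.lw_chain_left s a b hab, h2.chain⟩
    · intro b hb
      simp only [mulL, List.mem_cons] at hb
      rcases hb with rfl | hb
      · exact fun h1 => h.ne_one a (by simp) (D.lw_fst_ne_one s a h1).2
      · exact h2.ne_one b hb

/-- Moves the factors `δ` at the front of a word into the exponent of `δ`. -/
def strip : ℤ → List D.S → ℤ × List D.S
  | r, [] => (r, [])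
  | r, a :: L => if a = D.top then strip (r + 1) L else (r, a :: L)

/-- The normal forms `δ ^ r A₁ ⋯ A_k`, as pairs of the exponent and the list of the factors. -/
abbrev NForm : Type := {x : ℤ × List D.S // D.IsNF x.2 ∧ ∀ a ∈ x.2, a ≠ D.top}

theorem ne_top_of_head {a : D.S} {L : List D.S} (h : D.IsNF (a :: L)) (ha : a ≠ D.top) :
    ∀ b ∈ a :: L, b ≠ D.top := by
  induction L generalizing a with
  | nil => simpa using ha
  | cons b L ih =>
    have hab := (List.isChain_cons_cons.1 h.chain).1
    have hb : b ≠ D.top := by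
      rintro rfl
      rw [D.lw_top] at hab
      exact ha (Prod.ext_iff.1 hab).1.symm
    intro c hc
    rcases List.mem_cons.1 hc with rfl | hc
    · exact ha
    · exact ih h.tail hb c hc

theorem strip_spec (r : ℤ) {L : List D.S} (h : D.IsNF L) :
    D.IsNF (D.strip r L).2 ∧ ∀ a ∈ (D.strip r L).2, a ≠ D.top := by
  induction L generalizing r with
  | nil => exact ⟨h, by simp [strip]⟩
  | cons a L ih =>
    by_cases ha : a = D.top
    · simp only [strip, ha, if_true]; exact ih _ h.tail
    · simp only [strip, ha, if_false]; exact ⟨h, D.ne_top_of_head h ha⟩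

theorem strip_of_ne_top (r : ℤ) {L : List D.S} (h : ∀ a ∈ L, a ≠ D.top) :
    D.strip r L = (r, L) := by
  cases L with
  | nil => rfl
  | cons a L => simp [strip, h a (by simp)]

/-- Left multiplication of a normal form by a simple element; since `s δ ^ r = δ ^ r τ ^ r(s)`, the
element is twisted by `τ ^ r` on its way to the factors. -/
def act (s : D.S) (x : D.NForm) : D.NForm :=
  ⟨D.strip x.1.1 (D.mulL ((D.tau ^ x.1.1) s) x.1.2), D.strip_spec _ (D.isNF_mulL _ x.2.1)⟩

theorem tau_top : D.tau D.top = D.top := by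
  have h1 := D.lw_top D.top
  rw [D.top_lw] at h1
  exact (Prod.ext_iff.1 h1).2.symm

theorem tau_one : D.tau D.one = D.one := by
  have h1 := D.lw_top D.one
  rw [D.one_lw] at h1
  exact (Prod.ext_iff.1 h1).2.symm

theorem zpow_tau_top (r : ℤ) : (D.tau ^ r) D.top = D.top :=
  Equiv.Perm.zpow_apply_eq_self_of_apply_eq_self D.tau_top r

theorem zpow_tau_one (r : ℤ) : (D.tau ^ r) D.one = D.one :=
  Equiv.Perm.zpow_apply_eq_self_of_apply_eq_self D.tau_one r

theorem lw_zpow_tau (r : ℤ) (a b : D.S) :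
    D.lw ((D.tau ^ r) a) ((D.tau ^ r) b) = ((D.tau ^ r) (D.lw a b).1, (D.tau ^ r) (D.lw a b).2) := by
  have key : ∀ k : ℕ, ∀ a b, D.lw ((D.tau ^ k) a) ((D.tau ^ k) b) =
      ((D.tau ^ k) (D.lw a b).1, (D.tau ^ k) (D.lw a b).2) := by
    intro k
    induction k with
    | zero => simp
    | succ k ih => intro a b; simp only [pow_succ', Equiv.Perm.mul_apply]; rw [D.lw_tau, ih]
  obtain ⟨k, rfl | rfl⟩ := r.eq_nat_or_neg
  · simpa using key k a b
  · have := key k ((D.tau ^ (-(k : ℤ))) a) ((D.tau ^ (-(k : ℤ))) b)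
    rw [← zpow_natCast, ← Equiv.Perm.mul_apply, ← Equiv.Perm.mul_apply, ← zpow_add] at this
    simp only [add_neg_cancel, zpow_zero, Equiv.Perm.coe_one, id_eq] at this
    rw [this]
    simp only
    rw [← Equiv.Perm.mul_apply, ← Equiv.Perm.mul_apply, ← zpow_add]
    simp

theorem act_mul_aux (r : ℤ) (a : D.S) (L : List D.S) :
    D.strip (D.strip r L).1 (D.mulL ((D.tau ^ (D.strip r L).1) a) (D.strip r L).2) =
      D.strip r (D.mulL ((D.tau ^ r) a) L) := by
  induction L generalizing r with
  | nil => rfl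
  | cons b L ih =>
    by_cases hb : b = D.top
    · subst hb
      simp only [strip, if_true, mulL, D.lw_top]
      rw [ih, zpow_add_one, ← Equiv.Perm.mul_apply, ← zpow_one_add, ← zpow_add_one, add_comm]
    · simp [strip, hb]

theorem act_act (a b : D.S) (hab : (D.lw a b).2 = D.one) (x : D.NForm) :
    D.act a (D.act b x) = D.act (D.lw a b).1 x := by
  apply Subtype.ext
  simp only [act]
  rw [D.act_mul_aux, D.mulL_mulL, D.lw_zpow_tau]
  rw [D.lw_zpow_tau, hab, D.zpow_tau_one]

/-- Left multiplication of a normal form by `δ ^ k`. -/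
def shift (k : ℤ) (x : D.NForm) : D.NForm := ⟨(x.1.1 + k, x.1.2), x.2⟩

theorem act_top (x : D.NForm) : D.act D.top x = D.shift 1 x := by
  apply Subtype.ext
  simp only [act, shift, D.zpow_tau_top]
  obtain ⟨⟨r, L⟩, h1, h2⟩ := x
  have : D.mulL D.top L = D.top :: L := by
    cases L with
    | nil =>
      simp [mulL, D.top_ne_one]
    | cons a L => simp [mulL, D.top_lw, D.mulL_cons_of_isNF h1]
  simp only [this, strip, if_true]
  exact D.strip_of_ne_top _ h2

theorem act_shift (k : ℤ) (s : D.S) (x : D.NForm) :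
    D.act s (D.shift k x) = D.shift k (D.act ((D.tau ^ k) s) x) := by
  have key : ∀ (r : ℤ) (L : List D.S), D.strip (r + k) L = ((D.strip r L).1 + k, (D.strip r L).2) := by
    intro r L
    induction L generalizing r with
    | nil => rfl
    | cons a L ih =>
      by_cases ha : a = D.top
      · simp only [strip, ha, if_true]; rw [← ih]; congr 1; ring
      · simp [strip, ha]
  apply Subtype.ext
  simp only [act, shift]
  rw [key, ← Equiv.Perm.mul_apply, ← zpow_add]

theorem shift_shift (k l : ℤ) (x : D.NForm) : D.shift k (D.shift l x) = D.shift (l + k) x :=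
  Subtype.ext (by simp [shift, add_assoc])

theorem shift_zero (x : D.NForm) : D.shift 0 x = x :=
  Subtype.ext (by simp [shift])

/-- Left multiplication by `s` as a permutation of the normal forms; its inverse is left
multiplication by `δ⁻¹` and the left complement of `s`. -/
def actPerm (s : D.S) : Equiv.Perm D.NForm where
  toFun := D.act s
  invFun x := D.shift (-1) (D.act (D.comp (D.tau.symm s)) x)
  left_inv x := by
    have h := D.comp_lw (D.tau.symm s)
    rw [Equiv.apply_symm_apply] at h
    simp only
    rw [D.act_act _ _ (by rw [h]), h, D.act_top, D.shift_shift]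
    exact D.shift_zero x
  right_inv x := by
    have h := D.lw_comp (D.tau.symm s)
    have h2 : (D.tau ^ (-1 : ℤ)) s = D.tau.symm s := by simp
    simp only
    rw [D.act_shift, h2, D.act_act _ _ (by rw [h]), h, D.act_top, D.shift_shift]
    exact D.shift_zero x

theorem actPerm_mul (a b : D.S) (hab : (D.lw a b).2 = D.one) :
    D.actPerm a * D.actPerm b = D.actPerm (D.lw a b).1 :=
  Equiv.ext fun x => D.act_act a b hab x

theorem actPerm_rels : ∀ r ∈ artinRels n, FreeGroup.lift (fun i => D.actPerm (D.atom i)) r = 1 := by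
  rintro r (⟨i, j, hij, rfl⟩ | ⟨i, j, hij, rfl⟩)
  · obtain ⟨h1, h2⟩ := D.atom_comm i j hij
    simp only [map_mul, map_inv, FreeGroup.lift_apply_of]
    rw [mul_inv_eq_one, D.actPerm_mul _ _ h1, D.actPerm_mul _ _ (by rw [h2, h1]), h2]
  · obtain ⟨h1, b, h2, h3⟩ := D.atom_braid i j hij
    simp only [map_mul, map_inv, FreeGroup.lift_apply_of]
    have h4 := D.actPerm_mul (D.atom i) b (by rw [h2, h1])
    have h5 := D.actPerm_mul b (D.atom j) (by rw [h3, h1])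
    have h6 := D.actPerm_mul _ _ h1
    rw [h2] at h4
    rw [h3] at h5
    rw [mul_inv_eq_one, mul_assoc, h6]
    calc D.actPerm (D.atom i) * D.actPerm (D.lw (D.atom j) (D.atom i)).1
        = D.actPerm (D.atom i) * (D.actPerm b * D.actPerm (D.atom j)) := by rw [h5]
      _ = _ := by rw [← mul_assoc, h4]

/-- The action of the braid group on the normal forms. -/
def toPerm : Braid n →* Equiv.Perm D.NForm := PresentedGroup.toGroup D.actPerm_rels

theorem ev_mul {a b : D.S} (h : (D.lw a b).2 = D.one) : D.ev a * D.ev b = D.ev (D.lw a b).1 := by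
  rw [← D.ev_lw, h, D.ev_one, mul_one]

theorem act_one (x : D.NForm) : D.act D.one x = x := by
  apply Subtype.ext
  simp only [act, D.zpow_tau_one, D.mulL_one]
  exact D.strip_of_ne_top _ x.2.2

theorem actPerm_one : D.actPerm D.one = 1 := Equiv.ext fun x => D.act_one x

theorem toPerm_ev (s : D.S) : D.toPerm (D.ev s) = D.actPerm s := by
  refine D.generated (fun s => D.toPerm (D.ev s) = D.actPerm s) ?_ ?_ ?_ ?_ ?_ s
  · rw [D.ev_one, map_one, D.actPerm_one]
  · intro i; rw [D.ev_atom]; exact PresentedGroup.toGroup.of D.actPerm_rels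
  · intro a b h ha hb; rw [← D.ev_mul h, map_mul, ha, hb, D.actPerm_mul _ _ h]
  · intro a b h hb hc
    rw [← D.ev_mul h, map_mul, hb, ← D.actPerm_mul _ _ h] at hc
    exact mul_right_cancel hc
  · intro a b h ha hc
    rw [← D.ev_mul h, map_mul, ha, ← D.actPerm_mul _ _ h] at hc
    exact mul_left_cancel hc

/-- The braid represented by a word in the simple elements. -/
def prod (L : List D.S) : Braid n := (L.map D.ev).prod

@[simp] theorem prod_nil : D.prod [] = 1 := rfl
@[simp] theorem prod_cons (a : D.S) (L : List D.S) : D.prod (a :: L) = D.ev a * D.prod L := by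
  simp [prod]
@[simp] theorem prod_append (L L' : List D.S) : D.prod (L ++ L') = D.prod L * D.prod L' := by
  simp [prod]

theorem prod_mulL (s : D.S) (L : List D.S) : D.prod (D.mulL s L) = D.ev s * D.prod L := by
  induction L generalizing s with
  | nil => by_cases hs : s = D.one <;> simp [mulL, hs, D.ev_one]
  | cons a L ih => simp [mulL, ih, ← mul_assoc, D.ev_lw]

theorem ev_mul_delta (a : D.S) : D.ev a * delta n = delta n * D.ev (D.tau a) := by
  have := D.ev_lw a D.top
  rw [D.lw_top, D.ev_top] at this
  exact this.symm

theorem ev_mul_delta_zpow (a : D.S) (r : ℤ) :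
    D.ev a * delta n ^ r = delta n ^ r * D.ev ((D.tau ^ r) a) := by
  have key : ∀ k : ℕ, ∀ a, D.ev a * delta n ^ k = delta n ^ k * D.ev ((D.tau ^ k) a) := by
    intro k
    induction k with
    | zero => simp
    | succ k ih =>
      intro a
      rw [pow_succ, ← mul_assoc, ih, mul_assoc, D.ev_mul_delta, mul_assoc, pow_succ' D.tau]
      rfl
  obtain ⟨k, rfl | rfl⟩ := r.eq_nat_or_neg
  · exact_mod_cast key k a
  · have := key k ((D.tau ^ (-(k : ℤ))) a)
    rw [← zpow_natCast D.tau, ← Equiv.Perm.mul_apply, ← zpow_add] at this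
    simp only [add_neg_cancel, zpow_zero, Equiv.Perm.coe_one, id_eq] at this
    rw [zpow_neg, zpow_natCast, mul_inv_eq_iff_eq_mul, mul_assoc, this]
    simp

/-- The braid represented by an exponent of `δ` and a word in the simple elements. -/
def eval (x : ℤ × List D.S) : Braid n := delta n ^ x.1 * D.prod x.2

theorem eval_strip (r : ℤ) (L : List D.S) : D.eval (D.strip r L) = D.eval (r, L) := by
  induction L generalizing r with
  | nil => rfl
  | cons a L ih =>
    by_cases ha : a = D.top
    · simp only [strip, ha, if_true, ih]
      simp [eval, zpow_add, D.ev_top, mul_assoc]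
    · simp [strip, ha]

theorem eval_act (s : D.S) (x : D.NForm) : D.eval (D.act s x).1 = D.ev s * D.eval x.1 := by
  simp only [act, D.eval_strip]
  simp only [eval, D.prod_mulL]
  rw [← mul_assoc, ← mul_assoc, D.ev_mul_delta_zpow]

theorem eval_toPerm (β : Braid n) (x : D.NForm) : D.eval (D.toPerm β x).1 = β * D.eval x.1 := by
  induction β using PresentedGroup.induction_on with
  | _ z =>
  induction z using FreeGroup.induction_on generalizing x with
  | C1 => simp
  | of i =>
    have : D.toPerm (PresentedGroup.mk (artinRels n) (FreeGroup.of i)) = D.actPerm (D.atom i) :=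
      PresentedGroup.toGroup.of D.actPerm_rels
    rw [this]
    have h2 : PresentedGroup.mk (artinRels n) (FreeGroup.of i) = D.ev (D.atom i) :=
      (D.ev_atom i).symm
    rw [h2]; exact D.eval_act _ _
  | inv_of i h =>
    have h' := h (D.toPerm (PresentedGroup.mk (artinRels n) (FreeGroup.of i)⁻¹) x)
    rw [map_inv, map_inv, ← Equiv.Perm.mul_apply, mul_inv_cancel, Equiv.Perm.one_apply] at h'
    rw [map_inv, map_inv, h', inv_mul_cancel_left]
  | mul y z hy hz => rw [map_mul, map_mul, Equiv.Perm.mul_apply, hy, hz, mul_assoc]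

/-- The normal form of a braid: the image of the trivial normal form under the braid. -/
def nf (β : Braid n) : D.NForm := D.toPerm β ⟨(0, []), D.isNF_nil, by simp⟩

theorem eval_nf (β : Braid n) : D.eval (D.nf β).1 = β := by
  rw [nf, D.eval_toPerm]; simp [eval]

theorem nf_ev_mul (s : D.S) (β : Braid n) : D.nf (D.ev s * β) = D.act s (D.nf β) := by
  rw [nf, map_mul, D.toPerm_ev]; rfl

theorem nf_delta_mul (β : Braid n) : D.nf (delta n * β) = D.shift 1 (D.nf β) := by
  rw [← D.ev_top, D.nf_ev_mul, D.act_top]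

theorem nf_delta_zpow_mul (k : ℤ) (β : Braid n) :
    D.nf (delta n ^ k * β) = D.shift k (D.nf β) := by
  have key : ∀ k : ℕ, ∀ β, D.nf (delta n ^ k * β) = D.shift k (D.nf β) := by
    intro k
    induction k with
    | zero => intro β; simp [D.shift_zero]
    | succ k ih => intro β; rw [pow_succ', mul_assoc, D.nf_delta_mul, ih, D.shift_shift]; simp
  obtain ⟨k, rfl | rfl⟩ := k.eq_nat_or_neg
  · exact_mod_cast key k β
  · have := key k (delta n ^ (-(k : ℤ)) * β)
    rw [← mul_assoc, ← zpow_natCast, ← zpow_add] at this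
    simp only [add_neg_cancel, zpow_zero, one_mul] at this
    rw [this, D.shift_shift, add_neg_cancel, D.shift_zero]

/-- Uniqueness of normal forms: the braid which a normal form represents moves the trivial normal
form to it. -/
theorem nf_eval (x : D.NForm) : D.nf (D.eval x.1) = x := by
  obtain ⟨⟨r, L⟩, h1, h2⟩ := x
  simp only [eval, D.nf_delta_zpow_mul]
  have key : D.nf (D.prod L) = ⟨(0, L), h1, h2⟩ := by
    induction L with
    | nil => rw [D.prod_nil, nf, map_one]; rfl
    | cons a L ih =>
      rw [D.prod_cons, D.nf_ev_mul, ih h1.tail (fun b hb => h2 b (by simp [hb]))]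
      apply Subtype.ext
      simp only [act, zpow_zero, Equiv.Perm.coe_one, id_eq, D.mulL_cons_of_isNF h1]
      exact D.strip_of_ne_top _ h2
  rw [key]
  exact Subtype.ext (by simp [shift])

end Germ

/-! ### Exponent sum and words with few negative bands -/

/-- The exponent sum of a braid, which is invariant under conjugation. -/
def expo {n : ℕ} : Braid n →* Multiplicative ℤ :=
  PresentedGroup.toGroup (f := fun _ => Multiplicative.ofAdd 1) (by
    rintro r (⟨i, j, _, rfl⟩ | ⟨i, j, _, rfl⟩) <;>
      simp only [map_mul, map_inv, FreeGroup.lift_apply_of] <;> group)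

theorem expo_sigma {n : ℕ} (k : Fin (n - 1)) :
    expo (sigma k.val : Braid n) = Multiplicative.ofAdd 1 := by
  simp only [sigma, k.2, dif_pos]
  exact PresentedGroup.toGroup.of _

theorem expo_band {n : ℕ} (a : Band n) : expo a.toBraid = Multiplicative.ofAdd 1 := by
  have h : a.1.1.val < n - 1 := by
    have := a.2; have h2 := a.1.2.2; have : a.1.1.val < a.1.2.val := this; omega
  have := expo_sigma (n := n) ⟨a.1.1.val, h⟩
  simp only [Band.toBraid, map_mul, map_inv]
  rw [this, mul_right_comm, mul_inv_cancel, one_mul]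

theorem expo_eq_of_isConj {n : ℕ} {β γ : Braid n} (h : IsConj β γ) : expo β = expo γ := by
  obtain ⟨c, rfl⟩ := isConj_iff.1 h
  rw [map_mul, map_mul, map_inv, mul_right_comm, mul_inv_cancel, one_mul]

theorem nb_le_iff {n k : ℕ} (β : Braid n) :
    nb β ≤ k ↔ ∃ W : BandWord n, W.toBraid = β ∧ W.nb ≤ k := by
  constructor
  · intro h
    obtain ⟨W, h1, h2⟩ := Nat.sInf_mem (s := {m | ∃ W : BandWord n, W.toBraid = β ∧ W.nb = m})
      (let ⟨W, hW⟩ := exists_bandWord β; ⟨_, W, hW, rfl⟩)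
    exact ⟨W, h1, h2.le.trans h⟩
  · rintro ⟨W, h1, h2⟩
    have h3 : nb β ≤ W.nb := Nat.sInf_le ⟨W, h1, rfl⟩
    exact h3.trans h2

theorem toBraid_append {n : ℕ} (V W : BandWord n) :
    BandWord.toBraid (V ++ W) = V.toBraid * W.toBraid := by simp [BandWord.toBraid]

theorem nb_append {n : ℕ} (V W : BandWord n) :
    BandWord.nb (V ++ W) = V.nb + W.nb := by simp [BandWord.nb]

theorem nb_mul_le {n : ℕ} (β γ : Braid n) : nb (β * γ) ≤ nb β + nb γ := by
  obtain ⟨V, h1, h2⟩ := (nb_le_iff β).1 le_rfl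
  obtain ⟨W, h3, h4⟩ := (nb_le_iff γ).1 le_rfl
  exact (nb_le_iff _).2 ⟨V ++ W, by rw [toBraid_append, h1, h3], by rw [nb_append]; omega⟩

theorem mem_SQP_iff {n : ℕ} (β : Braid n) :
    β ∈ SQP n ↔ ∃ W : List (Band n), (W.map Band.toBraid).prod = β := by
  change nb β ≤ 0 ↔ _
  rw [nb_le_iff]
  constructor
  · rintro ⟨W, rfl, h⟩
    refine ⟨W.map Prod.fst, ?_⟩
    simp only [BandWord.toBraid, List.map_map]
    congr 1
    refine List.map_congr_left fun x hx => ?_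
    have := List.countP_eq_zero.1 (Nat.le_zero.1 h) x hx
    simp only [Bool.not_eq_eq_eq_not, Bool.not_true, Bool.not_eq_false] at this
    simp [SignedBand.toBraid, this]
  · rintro ⟨W, rfl⟩
    refine ⟨W.map fun a => (a, true), ?_, ?_⟩
    · simp only [BandWord.toBraid, List.map_map]; rfl
    · simp [BandWord.nb]

/-! ### Infimum, supremum and heads -/

namespace Germ
variable {n : ℕ} (D : Germ n)

theorem exists_bands (s : D.S) :
    ∃ W : List (Band n), (W.map Band.toBraid).prod = D.ev s ∧ W.length = D.len s := by
  induction h : D.len s generalizing s with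
  | zero => exact ⟨[], by simp [D.len_eq_zero s h, D.ev_one]⟩
  | succ k ih =>
    obtain ⟨a, b, h1, h2⟩ := D.exists_len_one s (by rintro rfl; rw [D.len_one] at h; omega)
    have h3 := D.len_lw a b
    rw [h2, D.len_one] at h3
    obtain ⟨W, h4, h5⟩ := ih b (by simp only at h3; omega)
    obtain ⟨a, rfl⟩ := D.exists_band a h1
    refine ⟨a :: W, ?_, by simp [h5]⟩
    rw [List.map_cons, List.prod_cons, h4, ← D.ev_band, D.ev_mul (by rw [h2]), h2]

theorem expo_ev (s : D.S) : expo (D.ev s) = Multiplicative.ofAdd (D.len s : ℤ) := by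
  obtain ⟨W, h1, h2⟩ := D.exists_bands s
  rw [← h1, ← h2]
  clear h1 h2
  induction W with
  | nil => simp
  | cons a W ih => rw [List.map_cons, List.prod_cons, map_mul, expo_band, ih, ← ofAdd_add]
                   simp [add_comm]

/-- The exponent of `δ` in the normal form; it agrees with `inf`, see `Germ.inf_eq`. -/
def lo (β : Braid n) : ℤ := (D.nf β).1.1
/-- The factors other than `δ` of the normal form. -/
def facs (β : Braid n) : List D.S := (D.nf β).1.2
/-- The exponent of `δ` plus the number of factors; it agrees with `sup`, see `Germ.sup_eq`. -/
def hi (β : Braid n) : ℤ := D.lo β + (D.facs β).length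

theorem eq_eval (β : Braid n) : β = delta n ^ D.lo β * D.prod (D.facs β) := (D.eval_nf β).symm

theorem isNF_facs (β : Braid n) : D.IsNF (D.facs β) := (D.nf β).2.1
theorem facs_ne_top (β : Braid n) : ∀ a ∈ D.facs β, a ≠ D.top := (D.nf β).2.2

theorem nf_unique {r : ℤ} {L : List D.S} (h1 : D.IsNF L) (h2 : ∀ a ∈ L, a ≠ D.top) :
    D.lo (delta n ^ r * D.prod L) = r ∧ D.facs (delta n ^ r * D.prod L) = L := by
  have := D.nf_eval ⟨(r, L), h1, h2⟩
  simp only [eval] at this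
  simp [lo, facs, this]

theorem lo_delta_mul (k : ℤ) (β : Braid n) : D.lo (delta n ^ k * β) = D.lo β + k := by
  simp [lo, D.nf_delta_zpow_mul, shift]

theorem facs_delta_mul (k : ℤ) (β : Braid n) : D.facs (delta n ^ k * β) = D.facs β := by
  simp [facs, D.nf_delta_zpow_mul, shift]

theorem le_strip_fst (r : ℤ) (L : List D.S) : r ≤ (D.strip r L).1 := by
  induction L generalizing r with
  | nil => simp [strip]
  | cons a L ih =>
    by_cases ha : a = D.top
    · simp only [strip, ha, if_true]; linarith [ih (r + 1)]
    · simp [strip, ha]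

theorem strip_fst_add_length (r : ℤ) (L : List D.S) :
    (D.strip r L).1 + (D.strip r L).2.length = r + L.length := by
  induction L generalizing r with
  | nil => simp [strip]
  | cons a L ih =>
    by_cases ha : a = D.top
    · simp only [strip, ha, if_true, ih]; push_cast [List.length_cons]; ring
    · simp [strip, ha]

theorem length_mulL (s : D.S) (L : List D.S) :
    L.length ≤ (D.mulL s L).length ∧ (D.mulL s L).length ≤ L.length + 1 := by
  induction L generalizing s with
  | nil => by_cases hs : s = D.one <;> simp [mulL, hs]
  | cons a L ih => simpa [mulL] using ih (D.lw s a).2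

theorem lo_le_ev_mul (s : D.S) (β : Braid n) : D.lo β ≤ D.lo (D.ev s * β) := by
  rw [lo, lo, D.nf_ev_mul]; exact D.le_strip_fst _ _

theorem hi_ev_mul (s : D.S) (β : Braid n) :
    D.hi β ≤ D.hi (D.ev s * β) ∧ D.hi (D.ev s * β) ≤ D.hi β + 1 := by
  simp only [hi, lo, facs, D.nf_ev_mul, act]
  rw [D.strip_fst_add_length]
  have := D.length_mulL ((D.tau ^ (D.nf β).1.1) s) (D.nf β).1.2
  omega

/-- Products of simple elements. These are the strongly quasipositive braids, see `Germ.mem_SQP`. -/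
def Pos (β : Braid n) : Prop := ∃ L, D.prod L = β

variable {D}
theorem Pos.mul {β γ : Braid n} (h1 : D.Pos β) (h2 : D.Pos γ) : D.Pos (β * γ) := by
  obtain ⟨L, rfl⟩ := h1
  obtain ⟨L', rfl⟩ := h2
  exact ⟨L ++ L', D.prod_append _ _⟩
variable (D)
theorem pos_ev (s : D.S) : D.Pos (D.ev s) := ⟨[s], by simp⟩
theorem pos_one : D.Pos 1 := ⟨[], rfl⟩

theorem nf_one : (D.nf 1).1 = (0, []) := by
  rw [nf, map_one]; rfl

theorem lo_one : D.lo 1 = 0 := by rw [lo, D.nf_one]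
theorem facs_one : D.facs 1 = [] := by rw [facs, D.nf_one]

variable {D}
theorem Pos.lo_le {x : Braid n} (h : D.Pos x) (β : Braid n) : D.lo β ≤ D.lo (x * β) := by
  obtain ⟨L, rfl⟩ := h
  induction L with
  | nil => simp
  | cons a L ih => rw [D.prod_cons, mul_assoc]; exact ih.trans (D.lo_le_ev_mul _ _)

theorem Pos.hi_le {x : Braid n} (h : D.Pos x) (β : Braid n) : D.hi β ≤ D.hi (x * β) := by
  obtain ⟨L, rfl⟩ := h
  induction L with
  | nil => simp
  | cons a L ih => rw [D.prod_cons, mul_assoc]; exact ih.trans (D.hi_ev_mul _ _).1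
variable (D)

theorem hi_prod_mul_le (L : List D.S) (β : Braid n) :
    D.hi (D.prod L * β) ≤ L.length + D.hi β := by
  induction L with
  | nil => simp
  | cons a L ih =>
    rw [D.prod_cons, mul_assoc]
    have := (D.hi_ev_mul a (D.prod L * β)).2
    push_cast [List.length_cons]
    linarith

theorem pos_delta_zpow {r : ℤ} (h : 0 ≤ r) : D.Pos (delta n ^ r) := by
  obtain ⟨k, rfl⟩ := Int.eq_ofNat_of_zero_le h
  exact ⟨List.replicate k D.top, by simp [prod, D.ev_top]⟩

theorem pos_iff (β : Braid n) : D.Pos β ↔ 0 ≤ D.lo β := by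
  constructor
  · intro h
    simpa [D.lo_one] using h.lo_le 1
  · intro h
    rw [D.eq_eval β]
    exact (D.pos_delta_zpow h).mul ⟨_, rfl⟩

theorem le_lo_iff (r : ℤ) (β : Braid n) : r ≤ D.lo β ↔ D.Pos (delta n ^ (-r) * β) := by
  rw [pos_iff, lo_delta_mul]; constructor <;> intro h <;> linarith

theorem prod_mul_delta (L : List D.S) (k : ℤ) :
    D.prod L * delta n ^ k = delta n ^ k * D.prod (L.map (D.tau ^ k)) := by
  induction L with
  | nil => simp
  | cons a L ih =>
    rw [D.prod_cons, mul_assoc, ih, ← mul_assoc, D.ev_mul_delta_zpow, mul_assoc, List.map_cons,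
      D.prod_cons]

theorem isNF_map (k : ℤ) {L : List D.S} (h : D.IsNF L) : D.IsNF (L.map (D.tau ^ k)) := by
  refine ⟨?_, ?_⟩
  · rw [List.isChain_map]
    exact h.chain.imp fun a b hab => by rw [D.lw_zpow_tau, hab]
  · intro a ha
    obtain ⟨b, hb, rfl⟩ := List.mem_map.1 ha
    intro h1
    rw [← D.zpow_tau_one k] at h1
    exact h.ne_one b hb ((D.tau ^ k).injective h1)

theorem map_ne_top (k : ℤ) {L : List D.S} (h : ∀ a ∈ L, a ≠ D.top) :
    ∀ a ∈ L.map (D.tau ^ k), a ≠ D.top := by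
  intro a ha
  obtain ⟨b, hb, rfl⟩ := List.mem_map.1 ha
  intro h1
  rw [← D.zpow_tau_top k] at h1
  exact h b hb ((D.tau ^ k).injective h1)

theorem nf_mul_delta (k : ℤ) (β : Braid n) :
    D.lo (β * delta n ^ k) = D.lo β + k ∧ D.facs (β * delta n ^ k) = (D.facs β).map (D.tau ^ k) := by
  have := D.nf_unique (r := D.lo β + k) (D.isNF_map k (D.isNF_facs β))
    (D.map_ne_top k (D.facs_ne_top β))
  have h2 : delta n ^ (D.lo β + k) * D.prod ((D.facs β).map (D.tau ^ k)) = β * delta n ^ k := by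
    conv_rhs => rw [D.eq_eval β, mul_assoc, D.prod_mul_delta, ← mul_assoc, ← zpow_add]
  rwa [h2] at this

theorem lo_mul_delta (k : ℤ) (β : Braid n) : D.lo (β * delta n ^ k) = D.lo β + k :=
  (D.nf_mul_delta k β).1

theorem lo_conj_delta (k : ℤ) (β : Braid n) :
    D.lo (delta n ^ k * β * delta n ^ (-k)) = D.lo β := by
  rw [lo_mul_delta, lo_delta_mul]; ring

theorem hi_conj_delta (k : ℤ) (β : Braid n) :
    D.hi (delta n ^ k * β * delta n ^ (-k)) = D.hi β := by
  rw [hi, lo_conj_delta, (D.nf_mul_delta _ _).2, facs_delta_mul]; simp [hi]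

theorem le_lo_iff' (r : ℤ) (β : Braid n) : r ≤ D.lo β ↔ D.Pos (β * delta n ^ (-r)) := by
  rw [pos_iff, lo_mul_delta]; constructor <;> intro h <;> linarith

variable {D} in
theorem Pos.conj_delta {β : Braid n} (h : D.Pos β) (k : ℤ) :
    D.Pos (delta n ^ k * β * delta n ^ (-k)) := by
  rw [pos_iff] at h ⊢; rwa [lo_conj_delta]

theorem mem_SQP (β : Braid n) : β ∈ SQP n ↔ D.Pos β := by
  rw [mem_SQP_iff]
  constructor
  · rintro ⟨W, rfl⟩
    exact ⟨W.map D.band, by simp [prod, Function.comp_def, D.ev_band]⟩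
  · rintro ⟨L, rfl⟩
    induction L with
    | nil => exact ⟨[], by simp⟩
    | cons a L ih =>
      obtain ⟨W, h⟩ := ih
      obtain ⟨V, h', _⟩ := D.exists_bands a
      exact ⟨V ++ W, by simp [h, h']⟩

theorem delta_le_iff (r : ℤ) (β : Braid n) : Le (delta n ^ r) β ↔ r ≤ D.lo β := by
  constructor
  · rintro ⟨P, hP, Q, hQ, rfl⟩
    rw [D.mem_SQP] at hP hQ
    rw [le_lo_iff']
    have := hP.mul (hQ.conj_delta r)
    simpa [mul_assoc] using this
  · intro h
    rw [le_lo_iff'] at h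
    exact ⟨_, (D.mem_SQP _).2 h, 1, (D.mem_SQP _).2 D.pos_one, by simp⟩

/-- A braid divides `δ ^ s` from the right if and only if its normal form ends by `s`. -/
theorem hi_le_iff (s : ℤ) (β : Braid n) :
    D.hi β ≤ s ↔ ∃ z, D.Pos z ∧ z * β = delta n ^ s := by
  constructor
  · intro h
    have key : ∀ L : List D.S, ∃ z, D.Pos z ∧ z * D.prod L = delta n ^ L.length := by
      intro L
      induction L with
      | nil => exact ⟨1, D.pos_one, by simp⟩
      | cons a L ih =>
        obtain ⟨z, hz, h1⟩ := ih
        refine ⟨delta n ^ (1 : ℤ) * z * delta n ^ (-1 : ℤ) * D.ev (D.comp (D.tau.symm a)),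
          (hz.conj_delta 1).mul (D.pos_ev _), ?_⟩
        have h2 := D.comp_lw (D.tau.symm a)
        rw [Equiv.apply_symm_apply] at h2
        have h3 := D.ev_mul (a := D.comp (D.tau.symm a)) (b := a) (by rw [h2])
        rw [h2] at h3
        rw [D.prod_cons, mul_assoc, ← mul_assoc (D.ev _), h3, D.ev_top]
        simp [mul_assoc, h1, pow_succ']
    obtain ⟨z, hz, h1⟩ := key (D.facs β)
    refine ⟨delta n ^ (s - D.hi β) * (delta n ^ D.lo β * z * delta n ^ (-D.lo β)),
      (D.pos_delta_zpow (by linarith)).mul (hz.conj_delta _), ?_⟩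
    have h2 : delta n ^ (-D.lo β) * β = D.prod (D.facs β) := by
      rw [zpow_neg, inv_mul_eq_iff_eq_mul]; exact D.eq_eval β
    rw [mul_assoc, mul_assoc, h2, mul_assoc, h1, ← zpow_natCast, ← zpow_add, ← zpow_add, hi]
    congr 1; ring
  · rintro ⟨z, hz, h⟩
    have := hz.hi_le β
    rw [h] at this
    have h2 := D.nf_unique (r := s) D.isNF_nil (by simp)
    simp only [prod_nil, mul_one] at h2
    rw [hi, hi, h2.1, h2.2] at this
    simpa [hi] using this

theorem le_delta_iff (s : ℤ) (β : Braid n) : Le β (delta n ^ s) ↔ D.hi β ≤ s := by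
  rw [hi_le_iff]
  constructor
  · rintro ⟨P, hP, Q, hQ, h⟩
    rw [D.mem_SQP] at hP hQ
    refine ⟨_, (hQ.conj_delta s).mul hP, ?_⟩
    have h' : P * β = delta n ^ s * Q⁻¹ := by rw [h]; group
    rw [mul_assoc, h']; group
  · rintro ⟨z, hz, h⟩
    exact ⟨z, (D.mem_SQP _).2 hz, 1, (D.mem_SQP _).2 D.pos_one, by rw [mul_one, h]⟩

theorem inf_eq (β : Braid n) : inf β = D.lo β := by
  simp only [inf, D.delta_le_iff]; exact csSup_Iic

theorem sup_eq (β : Braid n) : sup β = D.hi β := by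
  simp only [sup, D.le_delta_iff]; exact csInf_Ici

theorem canonicalLength_eq (β : Braid n) : canonicalLength β = (D.facs β).length := by
  rw [canonicalLength, D.inf_eq, D.sup_eq, hi]; ring

theorem hi_inv (β : Braid n) : D.hi β⁻¹ = - D.lo β := by
  have key : ∀ s, D.hi β⁻¹ ≤ s ↔ - D.lo β ≤ s := by
    intro s
    rw [hi_le_iff, neg_le, le_lo_iff, neg_neg]
    constructor
    · rintro ⟨z, hz, h⟩; rwa [mul_inv_eq_iff_eq_mul.1 h] at hz
    · intro h; exact ⟨_, h, by simp⟩
  exact le_antisymm ((key _).2 le_rfl) ((key _).1 le_rfl)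

theorem lo_inv (β : Braid n) : D.lo β⁻¹ = - D.hi β := by
  have := D.hi_inv β⁻¹
  rw [inv_inv] at this; omega

/-- Left divisibility of simple elements. -/
def Dvd (s t : D.S) : Prop := ∃ u, D.lw s u = (t, D.one)

/-- The head of a positive braid: its largest simple prefix. For a braid which is not positive the
value has no meaning. -/
def hd (β : Braid n) : D.S := if 1 ≤ D.lo β then D.top else (D.facs β).headD D.one

theorem hd_of_one_le {β : Braid n} (h : 1 ≤ D.lo β) : D.hd β = D.top := if_pos h

theorem hd_ev_mul (s : D.S) {z : Braid n} (hz : D.Pos z) :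
    D.hd (D.ev s * z) = (D.lw s (D.hd z)).1 := by
  rw [pos_iff] at hz
  by_cases h1 : 1 ≤ D.lo z
  · rw [D.hd_of_one_le h1, D.hd_of_one_le (h1.trans (D.lo_le_ev_mul s z)), D.lw_top]
  have h0 : D.lo z = 0 := by omega
  rw [hd, hd, if_neg h1]
  have hlo : (D.lo (D.ev s * z), D.facs (D.ev s * z)) = D.strip 0 (D.mulL s (D.facs z)) := by
    have : (D.nf z).1.1 = 0 := h0
    simp only [lo, facs, D.nf_ev_mul, act, this]
    simp
  have ha : D.lo (D.ev s * z) = (D.strip 0 (D.mulL s (D.facs z))).1 := by rw [← hlo]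
  have hb : D.facs (D.ev s * z) = (D.strip 0 (D.mulL s (D.facs z))).2 := by rw [← hlo]
  rw [ha, hb]
  have key : ∀ (p : D.S) (L : List D.S), (if 1 ≤ (D.strip 0 (p :: L)).1 then D.top
      else (D.strip 0 (p :: L)).2.headD D.one) = p := by
    intro p L
    by_cases hp : p = D.top
    · subst hp
      rw [if_pos]
      simp only [strip, if_true]
      exact D.le_strip_fst _ _
    · simp [strip, hp]
  cases hL : D.facs z with
  | nil =>
    by_cases hs : s = D.one
    · simp [mulL, hs, strip, D.one_lw]
    · simp only [mulL, hs, if_false, key]; simp [D.lw_one]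
  | cons a L => exact key _ _

theorem pos_hd_inv_mul {β : Braid n} (h : D.Pos β) : D.Pos ((D.ev (D.hd β))⁻¹ * β) := by
  rw [pos_iff] at h
  by_cases h1 : 1 ≤ D.lo β
  · rw [D.hd_of_one_le h1, D.ev_top]
    have := (D.le_lo_iff 1 β).1 h1
    simpa using this
  have h0 : D.lo β = 0 := by omega
  rw [hd, if_neg h1]
  have h2 := D.eq_eval β
  rw [h0, zpow_zero, one_mul] at h2
  cases hL : D.facs β with
  | nil => rw [hL] at h2; rw [h2]; simp [D.ev_one, D.pos_one]
  | cons a L => rw [hL] at h2; rw [h2]; simp; exact ⟨L, rfl⟩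

/-- The simple prefixes of a positive braid are the prefixes of its head. -/
theorem dvd_hd_iff (s : D.S) {β : Braid n} (h : D.Pos β) :
    D.Dvd s (D.hd β) ↔ D.Pos ((D.ev s)⁻¹ * β) := by
  constructor
  · rintro ⟨u, hu⟩
    have h1 := D.pos_hd_inv_mul h
    have h2 := D.ev_mul (a := s) (b := u) (by rw [hu])
    rw [hu] at h2
    simp only at h2
    rw [← h2] at h1
    have := (D.pos_ev u).mul h1
    simpa [mul_assoc] using this
  · intro h1
    have := D.hd_ev_mul s h1
    rw [mul_inv_cancel_left] at this
    rw [this]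
    exact D.exists_lw_fst _ _

theorem hd_one : D.hd 1 = D.one := by simp [hd, lo_one, facs_one]

theorem hd_ev (s : D.S) : D.hd (D.ev s) = s := by
  have := D.hd_ev_mul s D.pos_one
  rwa [mul_one, hd_one, D.lw_one] at this

/-- The head of a product depends on the second factor only through its head. -/
theorem hd_mul {x z : Braid n} (hx : D.Pos x) (hz : D.Pos z) :
    D.hd (x * z) = D.hd (x * D.ev (D.hd z)) := by
  obtain ⟨L, rfl⟩ := hx
  induction L with
  | nil => simp [hd_ev]
  | cons a L ih =>
    have hL : D.Pos (D.prod L) := ⟨L, rfl⟩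
    rw [D.prod_cons, mul_assoc, mul_assoc, D.hd_ev_mul _ (hL.mul hz), ih,
      D.hd_ev_mul _ (hL.mul (D.pos_ev _))]

theorem hd_eq_top_iff {β : Braid n} (h : D.Pos β) : D.hd β = D.top ↔ 1 ≤ D.lo β := by
  refine ⟨fun h1 => ?_, D.hd_of_one_le⟩
  have := D.pos_hd_inv_mul h
  rw [h1, D.ev_top] at this
  rw [le_lo_iff]; simpa using this

theorem eq_one_of_hd {β : Braid n} (h : D.Pos β) (h1 : D.hd β = D.one) : β = 1 := by
  have h2 : ¬ 1 ≤ D.lo β := fun h2 => D.top_ne_one ((D.hd_of_one_le h2).symm.trans h1)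
  have h0 : D.lo β = 0 := by have := (D.pos_iff β).1 h; omega
  rw [hd, if_neg h2] at h1
  have h3 := D.eq_eval β
  cases hL : D.facs β with
  | nil => rw [hL, h0] at h3; simpa using h3
  | cons a L =>
    rw [hL] at h1
    exact absurd h1 ((D.isNF_facs β).ne_one a (by simp [hL]))

theorem hd_conj_delta (k : ℤ) (β : Braid n) :
    D.hd (delta n ^ k * β * delta n ^ (-k)) = (D.tau ^ (-k)) (D.hd β) := by
  rw [hd, hd, lo_conj_delta, (D.nf_mul_delta _ _).2, facs_delta_mul]
  split_ifs
  · rw [zpow_tau_top]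
  · cases D.facs β with
    | nil => simp only [List.map_nil, List.headD_nil, zpow_tau_one]
    | cons a L => rfl

theorem dvd_refl (s : D.S) : D.Dvd s s := ⟨D.one, D.lw_one s⟩

variable {D}
theorem Dvd.len_le {s t : D.S} (h : D.Dvd s t) : D.len s ≤ D.len t := by
  obtain ⟨u, hu⟩ := h
  have := D.len_lw s u
  rw [hu, D.len_one] at this
  simp only at this; omega

theorem Dvd.eq_of_len {s t : D.S} (h : D.Dvd s t) (hl : D.len t ≤ D.len s) : s = t := by
  obtain ⟨u, hu⟩ := h
  have := D.len_lw s u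
  rw [hu, D.len_one] at this
  have hu1 := D.len_eq_zero u (by simp only at this; omega)
  rw [hu1, D.lw_one] at hu
  exact (Prod.ext_iff.1 hu).1

theorem Dvd.antisymm {s t : D.S} (h : D.Dvd s t) (h' : D.Dvd t s) : s = t :=
  h.eq_of_len h'.len_le

theorem Pos.expo_nonneg {β : Braid n} (h : D.Pos β) : 0 ≤ (expo β).toAdd := by
  obtain ⟨L, rfl⟩ := h
  induction L with
  | nil => simp
  | cons a L ih => simp only [D.prod_cons, map_mul, D.expo_ev, toAdd_mul, toAdd_ofAdd]; positivity

theorem Pos.eq_one {β : Braid n} (h : D.Pos β) (h0 : (expo β).toAdd ≤ 0) : β = 1 := by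
  refine D.eq_one_of_hd h (D.len_eq_zero _ ?_)
  have h1 := (D.pos_hd_inv_mul h).expo_nonneg
  simp only [map_mul, map_inv, D.expo_ev, toAdd_mul, toAdd_inv, toAdd_ofAdd] at h1
  omega
variable (D)

theorem expo_delta (D : Germ n) : expo (delta n) = Multiplicative.ofAdd ((n : ℤ) - 1) := by
  rw [← D.ev_top, D.expo_ev, D.len_top]
  have : n - 1 ≠ 0 := by
    intro h
    exact D.top_ne_one (D.len_eq_zero _ (by rw [D.len_top, h]))
  congr 1; omega

end Germ

/-! ### Cycling -/

namespace Germ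
variable {n : ℕ} (D : Germ n)

/-- The head of `x δ ^ (-r)` with `r = lo x`: the first factor of `x`, moved in front of `δ ^ r`. -/
def cycFac (x : Braid n) : D.S := D.hd (x * delta n ^ (-D.lo x))

/-- Cycling: conjugation which moves the first factor of the normal form to the end. -/
def cyc (x : Braid n) : Braid n := (D.ev (D.cycFac x))⁻¹ * x * D.ev (D.cycFac x)

theorem isConj_cyc (x : Braid n) : IsConj x (D.cyc x) :=
  isConj_iff.2 ⟨(D.ev (D.cycFac x))⁻¹, by simp [cyc]⟩

theorem pos_shift (x : Braid n) : D.Pos (x * delta n ^ (-D.lo x)) := (D.le_lo_iff' _ _).1 le_rfl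

theorem cycFac_ne_top (x : Braid n) : D.cycFac x ≠ D.top := by
  intro h
  have := (D.hd_eq_top_iff (D.pos_shift x)).1 h
  rw [lo_mul_delta] at this; omega

theorem lo_le_cyc (x : Braid n) : D.lo x ≤ D.lo (D.cyc x) := by
  have h := D.pos_hd_inv_mul (D.pos_shift x)
  rw [le_lo_iff']
  have h2 := h.mul ((D.pos_ev (D.cycFac x)).conj_delta (D.lo x))
  simpa [cyc, cycFac, mul_assoc] using h2

theorem cyc_of_facs_nil {x : Braid n} (h : D.facs x = []) : D.cyc x = x := by
  have hx := D.eq_eval x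
  rw [h, prod_nil, mul_one] at hx
  have : D.cycFac x = D.one := by
    rw [cycFac, show x * delta n ^ (-D.lo x) = 1 by rwa [zpow_neg, mul_inv_eq_one], hd_one]
  simp [cyc, this, D.ev_one]

theorem cycFac_of_facs_cons {x : Braid n} {a : D.S} {L : List D.S} (h : D.facs x = a :: L) :
    D.cycFac x = (D.tau ^ (-D.lo x)) a := by
  rw [cycFac, hd, (D.nf_mul_delta _ _).2, lo_mul_delta, h, if_neg (by omega)]
  rfl

theorem cyc_of_facs_cons {x : Braid n} {a : D.S} {L : List D.S} (h : D.facs x = a :: L) :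
    D.cyc x = delta n ^ D.lo x * D.prod (L ++ [(D.tau ^ (-D.lo x)) a]) := by
  rw [cyc, D.cycFac_of_facs_cons h]
  have h1 := D.ev_mul_delta_zpow ((D.tau ^ (-D.lo x)) a) (D.lo x)
  rw [← Equiv.Perm.mul_apply, ← zpow_add, add_neg_cancel, zpow_zero, Equiv.Perm.one_apply] at h1
  have hx := D.eq_eval x
  rw [h, D.prod_cons, ← mul_assoc, ← h1, mul_assoc] at hx
  rw [mul_assoc, inv_mul_eq_iff_eq_mul]
  rw [congrArg (· * D.ev ((D.tau ^ (-D.lo x)) a)) hx, prod_append, prod_cons, prod_nil, mul_one]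
  simp only [mul_assoc]

theorem hi_cyc_le (x : Braid n) : D.hi (D.cyc x) ≤ D.hi x := by
  cases h : D.facs x with
  | nil => rw [D.cyc_of_facs_nil h]
  | cons a L =>
    rw [D.cyc_of_facs_cons h]
    have := D.hi_prod_mul_le (L ++ [(D.tau ^ (-D.lo x)) a]) 1
    rw [mul_one] at this
    rw [hi] at this ⊢
    rw [lo_delta_mul, facs_delta_mul, hi, h]
    have h1 : D.hi 1 = 0 := by simp [hi, lo_one, facs_one]
    rw [h1] at this
    simp at this ⊢
    linarith

/-- The descent step. Suppose that the positive braid `d` conjugates `x` to a braid `y` of larger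
`lo`. Then `d x δ ^ (-r)`, with `r = lo x`, is divisible by `δ`, and only the head of `x δ ^ (-r)`
matters for this. So `d A δ⁻¹` with `A = cycFac x` is positive; it conjugates `δ (cyc x) δ⁻¹` to
`y`, and it is shorter than `d`. -/
theorem pos_descent {d x y : Braid n} (hd : D.Pos d) (h : d * x = y * d) (hy : D.lo x < D.lo y) :
    D.Pos (d * D.ev (D.cycFac x) * (delta n)⁻¹) := by
  set r := D.lo x
  have hP := D.pos_shift x
  have h1 : d * (x * delta n ^ (-r)) = (y * delta n ^ (-(r + 1))) *
      (delta n ^ (r + 1) * d * delta n ^ (-(r + 1))) * delta n := by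
    rw [← mul_assoc, h]
    rw [show -r = -(r + 1) + 1 by ring, zpow_add_one]; group
  have h2 : 1 ≤ D.lo (d * (x * delta n ^ (-r))) := by
    rw [h1]
    have := D.lo_mul_delta 1 (y * delta n ^ (-(r + 1)) *
      (delta n ^ (r + 1) * d * delta n ^ (-(r + 1))))
    rw [zpow_one] at this
    rw [this]
    have h3 := (D.pos_iff _).1 (((D.le_lo_iff' (r + 1) y).1 hy).mul (hd.conj_delta (r + 1)))
    linarith
  have h4 := D.hd_mul hd hP
  rw [D.hd_of_one_le h2] at h4
  have h5 := (D.hd_eq_top_iff (hd.mul (D.pos_ev _))).1 h4.symm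
  rw [le_lo_iff', zpow_neg_one] at h5
  exact h5

/-- `δ (cyc x) δ⁻¹` is the conjugate of `x` by the positive braid `δ A⁻¹`, with `A = cycFac x`. -/
theorem conj_twist_cyc (x : Braid n) :
    delta n * D.cyc x * (delta n)⁻¹ = (delta n * (D.ev (D.cycFac x))⁻¹) * x *
      (delta n * (D.ev (D.cycFac x))⁻¹)⁻¹ := by
  rw [cyc]; group

theorem lo_conj_delta_one (x : Braid n) : D.lo (delta n * x * (delta n)⁻¹) = D.lo x := by
  simpa using D.lo_conj_delta 1 x

theorem hi_conj_delta_one (x : Braid n) : D.hi (delta n * x * (delta n)⁻¹) = D.hi x := by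
  simpa using D.hi_conj_delta 1 x

theorem pos_compl (s : D.S) : D.Pos (delta n * (D.ev s)⁻¹) := by
  have h2 := D.comp_lw (D.tau.symm s)
  rw [Equiv.apply_symm_apply] at h2
  have h3 := D.ev_mul (a := D.comp (D.tau.symm s)) (b := s) (by rw [h2])
  rw [h2, D.ev_top] at h3
  rw [← h3, mul_inv_cancel_right]
  exact D.pos_ev _

theorem expo_descent (d : Braid n) (s : D.S) (hs : s ≠ D.top) :
    (expo (d * D.ev s * (delta n)⁻¹)).toAdd < (expo d).toAdd := by
  have h1 := D.len_lt_top s hs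
  simp only [map_mul, map_inv, D.expo_ev, D.expo_delta, toAdd_mul, toAdd_ofAdd, toAdd_inv]
  omega

theorem exists_pos_of_isConj {x y : Braid n} (h : IsConj x y) :
    ∃ d z, D.Pos d ∧ d * x = z * d ∧ D.lo z = D.lo y := by
  obtain ⟨c, rfl⟩ := isConj_iff.1 h
  refine ⟨delta n ^ (-D.lo c) * c, delta n ^ (-D.lo c) * (c * x * c⁻¹) * delta n ^ (- -D.lo c),
    (D.le_lo_iff _ _).1 le_rfl, by group, D.lo_conj_delta _ _⟩

/-- If `lo` is not maximal in the conjugacy class of `x`, iterated cycling raises it, and `hi` does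
not grow. The induction is on the length of a positive conjugator. -/
theorem exists_raise {x y : Braid n} (h : IsConj x y) (hlt : D.lo x < D.lo y) :
    ∃ z, IsConj x z ∧ D.lo x < D.lo z ∧ D.hi z ≤ D.hi x := by
  obtain ⟨d, z, hd, hdx, hz⟩ := D.exists_pos_of_isConj h
  rw [← hz] at hlt
  clear hz h y
  obtain ⟨N, hN⟩ : ∃ N : ℕ, (expo d).toAdd ≤ N := ⟨_, Int.self_le_toNat _⟩
  induction N generalizing d x with
  | zero =>
    have := hd.eq_one (by simpa using hN)
    subst this
    rw [one_mul, mul_one] at hdx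
    rw [hdx] at hlt; omega
  | succ N ih =>
    by_cases hc : D.lo x < D.lo (D.cyc x)
    · exact ⟨_, D.isConj_cyc x, hc, D.hi_cyc_le x⟩
    have h1 : D.lo (D.cyc x) = D.lo x := le_antisymm (not_lt.1 hc) (D.lo_le_cyc x)
    obtain ⟨w, h2, h3, h4⟩ := ih (x := delta n * D.cyc x * (delta n)⁻¹) _
      (by rwa [lo_conj_delta_one, h1]) (D.pos_descent hd hdx hlt) (by
        rw [conj_twist_cyc]
        calc _ = (d * x) * (D.ev (D.cycFac x) * (delta n)⁻¹) := by group
          _ = _ := by rw [hdx]; group)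
      (by have := D.expo_descent d _ (D.cycFac_ne_top x); push_cast at hN; omega)
    rw [lo_conj_delta_one, h1] at h3
    rw [hi_conj_delta_one] at h4
    exact ⟨w, (D.isConj_cyc x).trans ((isConj_iff.2 ⟨delta n, rfl⟩).trans h2), h3,
      h4.trans (D.hi_cyc_le x)⟩

/-- The elements of the super summit set have the largest `lo` in their conjugacy class. -/
theorem lo_le_of_mem_SSS {β γ y : Braid n} (hγ : γ ∈ SSS β) (hy : IsConj β y) :
    D.lo y ≤ D.lo γ := by
  by_contra! h
  obtain ⟨z, h1, h2, h3⟩ := D.exists_raise (hγ.1.symm.trans hy) h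
  have := hγ.2 z (hγ.1.trans h1)
  rw [D.canonicalLength_eq, D.canonicalLength_eq] at this
  simp only [hi] at h3
  omega

theorem SSS_nonempty (D : Germ n) (β : Braid n) : (SSS β).Nonempty := by
  obtain ⟨γ, h1, h2⟩ := WellFounded.has_min (measure fun γ => (D.facs γ).length).wf
    {γ | IsConj β γ} ⟨β, IsConj.refl β⟩
  refine ⟨γ, h1, fun γ' h => ?_⟩
  rw [D.canonicalLength_eq, D.canonicalLength_eq]
  have h3 := h2 γ' h
  exact_mod_cast not_lt.1 h3

/-- The simple prefixes of the shorter conjugator `d A δ⁻¹` are the common prefixes of `d` and of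
`y d δ ^ (-(r + 1))`. In particular its head divides the head of `d`. -/
theorem hd_descent {d x y : Braid n} (hd : D.Pos d) (h : d * x = y * d) (hy : D.lo x < D.lo y)
    (s : D.S) : D.Dvd s (D.hd (d * D.ev (D.cycFac x) * (delta n)⁻¹)) ↔
      D.Dvd s (D.hd d) ∧ D.Dvd s (D.hd (y * d * delta n ^ (-(D.lo x + 1)))) := by
  have hd' := D.pos_descent hd h hy
  set r := D.lo x with hr
  have hK : y * d * delta n ^ (-(r + 1)) = d * (x * delta n ^ (-r)) * (delta n)⁻¹ := by
    rw [← h]; group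
  have hKpos : D.Pos (y * d * delta n ^ (-(r + 1))) := by
    have := ((D.le_lo_iff' (r + 1) y).1 hy).mul (hd.conj_delta (r + 1))
    rw [show y * d * delta n ^ (-(r + 1)) = y * delta n ^ (-(r + 1)) *
      (delta n ^ (r + 1) * d * delta n ^ (-(r + 1))) by group]
    exact this
  have hP := D.pos_shift x
  have hP1 := D.pos_hd_inv_mul hP
  change D.Pos ((D.ev (D.cycFac x))⁻¹ * _) at hP1
  rw [D.dvd_hd_iff s hd', D.dvd_hd_iff s hd, D.dvd_hd_iff s hKpos]
  set A := D.cycFac x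
  constructor
  · intro h1
    constructor
    · have := h1.mul (D.pos_compl A)
      simpa [mul_assoc] using this
    · have := h1.mul (hP1.conj_delta 1)
      rw [hK]
      simpa [mul_assoc] using this
  · rintro ⟨h1, h2⟩
    rw [hK] at h2
    have h3 : 1 ≤ D.lo ((D.ev s)⁻¹ * d * (x * delta n ^ (-r))) := by
      rw [le_lo_iff', zpow_neg_one]; simpa [mul_assoc] using h2
    have h4 := D.hd_mul h1 hP
    rw [D.hd_of_one_le h3] at h4
    have h5 := (D.hd_eq_top_iff (h1.mul (D.pos_ev _))).1 h4.symm
    rw [le_lo_iff', zpow_neg_one, show D.hd (x * delta n ^ (-r)) = A from rfl] at h5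
    simpa [mul_assoc] using h5

/-- The head of `y d δ ^ (-r)` depends on `d` only through its head. -/
theorem hd_translate {y d : Braid n} {r : ℤ} (hd : D.Pos d) (hy : r ≤ D.lo y) :
    D.hd (y * d * delta n ^ (-r)) =
      D.hd (y * delta n ^ (-r) * D.ev ((D.tau ^ (-r)) (D.hd d))) := by
  have h1 := D.hd_mul ((D.le_lo_iff' r y).1 hy) (hd.conj_delta r)
  rw [hd_conj_delta] at h1
  rw [← h1]
  congr 1
  group

/-- If the head `h` of the conjugator does not change in one descent step, then it never changes,
because the condition of `Germ.hd_descent` depends on `d` only through its head. As the descent ends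
in a braid of larger `lo`, the conjugator then has a suffix `t` which already raises `lo`, and what
is split off has head `h`. -/
theorem exists_factor_of_stable {h : D.S} {y : Braid n} {r : ℤ} (hy : r < D.lo y) {d x : Braid n}
    (hd : D.Pos d) (hdx : d * x = y * d) (hr : D.lo x = r) (hh : D.hd d = h)
    (hK : D.Dvd h (D.hd (y * d * delta n ^ (-(r + 1))))) :
    ∃ e t, D.Pos e ∧ D.Pos t ∧ d = e * t ∧ D.hd e = h ∧ r < D.lo (t * x * t⁻¹) := by
  obtain ⟨N, hN⟩ : ∃ N : ℕ, (expo d).toAdd ≤ N := ⟨_, Int.self_le_toNat _⟩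
  induction N generalizing d x with
  | zero =>
    have := hd.eq_one (by simpa using hN)
    subst this
    rw [one_mul, mul_one] at hdx
    rw [← hdx] at hy; omega
  | succ N ih =>
    have hxy : D.lo x < D.lo y := by rwa [hr]
    have hd' := D.pos_descent hd hdx hxy
    have key := D.hd_descent hd hdx hxy
    rw [hr] at key
    have hh' : D.hd (d * D.ev (D.cycFac x) * (delta n)⁻¹) = h :=
      Dvd.antisymm (hh ▸ ((key _).1 (D.dvd_refl _)).1) ((key h).2 ⟨hh ▸ D.dvd_refl _, hK⟩)
    have hT := D.conj_twist_cyc x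
    set T := delta n * (D.ev (D.cycFac x))⁻¹ with hTdef
    have hTpos : D.Pos T := D.pos_compl _
    have hdT : d = d * D.ev (D.cycFac x) * (delta n)⁻¹ * T := by rw [hTdef]; group
    set d' := d * D.ev (D.cycFac x) * (delta n)⁻¹ with hd'def
    by_cases hlt : r < D.lo (T * x * T⁻¹)
    · exact ⟨d', T, hd', hTpos, hdT, hh', hlt⟩
    have hr' : D.lo (T * x * T⁻¹) = r := by
      refine le_antisymm (not_lt.1 hlt) ?_
      rw [← hT, lo_conj_delta_one, ← hr]; exact D.lo_le_cyc x
    obtain ⟨e, t, h1, h2, h3, h4, h5⟩ := ih (x := T * x * T⁻¹) hd' (by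
        calc d' * (T * x * T⁻¹) = (d' * T) * x * T⁻¹ := by group
          _ = d * x * T⁻¹ := by rw [← hdT]
          _ = y * (d' * T) * T⁻¹ := by rw [hdx, ← hdT]
          _ = y * d' := by group) hr' hh' (by
        rw [D.hd_translate hd' (by omega), hh', ← hh, ← D.hd_translate hd (by omega), hh]
        exact hK)
        (by have := D.expo_descent d _ (D.cycFac_ne_top x); push_cast at hN; rw [hd'def]; omega)
    refine ⟨e, t * T, h1, h2.mul hTpos, by rw [hdT, h3, mul_assoc], h4, ?_⟩
    convert h5 using 2
    group

theorem cyc_conj_delta (x : Braid n) (k : ℤ) :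
    D.cyc (delta n ^ k * x * delta n ^ (-k)) = delta n ^ k * D.cyc x * delta n ^ (-k) := by
  have h : D.cycFac (delta n ^ k * x * delta n ^ (-k)) = (D.tau ^ (-k)) (D.cycFac x) := by
    rw [cycFac, lo_conj_delta, cycFac, ← hd_conj_delta]
    congr 1; group
  have h2 := D.ev_mul_delta_zpow ((D.tau ^ (-k)) (D.cycFac x)) k
  rw [← Equiv.Perm.mul_apply, ← zpow_add, add_neg_cancel, zpow_zero, Equiv.Perm.one_apply] at h2
  rw [cyc, h, eq_mul_inv_of_mul_eq h2, cyc]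
  group

/-- For `n ≤ 4`, two cyclings raise `lo` unless it is maximal in the conjugacy class. For a shortest
positive conjugator `d` the head gets strictly shorter in each descent step, by
`Germ.exists_factor_of_stable`; its length is at most `n - 2 ≤ 2` at the start, so after two steps the
conjugator is trivial. -/
theorem lo_lt_cyc_cyc (hn : n ≤ 4) {x y : Braid n} (h : IsConj x y) (hlt : D.lo x < D.lo y) :
    D.lo x < D.lo (D.cyc (D.cyc x)) := by
  by_contra hcc
  have hc1 := D.lo_le_cyc x
  have hc2 := D.lo_le_cyc (D.cyc x)
  have e1 : D.lo (D.cyc x) = D.lo x := by omega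
  have e2 : D.lo (D.cyc (D.cyc x)) = D.lo x := by omega
  -- a shortest positive conjugator to a braid of larger `lo`
  obtain ⟨d0, hmem, hmin⟩ := WellFounded.has_min
    (measure fun d : Braid n => (expo d).toAdd.toNat).wf {d | D.Pos d ∧ D.lo x < D.lo (d * x * d⁻¹)} (by
      obtain ⟨d, z, hd, hdx, hz⟩ := D.exists_pos_of_isConj h
      refine ⟨d, hd, ?_⟩
      rwa [hdx, mul_inv_cancel_right, hz])
  obtain ⟨hd0, hlt0⟩ := hmem
  have hmin' : ∀ e t : Braid n, D.Pos e → D.Pos t → d0 = e * t → D.lo x < D.lo (t * x * t⁻¹) →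
      e = 1 := by
    intro e t he ht hd hl
    have h1 := hmin t ⟨ht, hl⟩
    change ¬ (expo t).toAdd.toNat < (expo d0).toAdd.toNat at h1
    have h2 := he.expo_nonneg
    have h3 := ht.expo_nonneg
    refine he.eq_one ?_
    rw [hd, map_mul, toAdd_mul] at h1
    omega
  set y0 := d0 * x * d0⁻¹ with hy0
  set r := D.lo x with hr
  -- a factor `δ` could be removed from `d0`
  have hnt : D.hd d0 ≠ D.top := by
    intro ht
    have h1 := (D.hd_eq_top_iff hd0).1 ht
    have h2 := hmin' (delta n ^ (1 : ℤ)) (delta n ^ (-1 : ℤ) * d0) (D.pos_delta_zpow zero_le_one)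
      ((D.le_lo_iff _ _).1 h1) (by group) (by
        have := D.lo_conj_delta (-1) y0
        rw [hy0] at this hlt0
        rw [← this] at hlt0
        convert hlt0 using 2; group)
    rw [zpow_one, ← D.ev_top] at h2
    have h3 := D.hd_ev D.top
    rw [h2, hd_one] at h3
    exact D.top_ne_one h3.symm
  have hl0 : D.len (D.hd d0) ≤ 2 := by have := D.len_lt_top _ hnt; omega
  -- one descent step, for conjugators which are prefixes `d` of `d0 = d * t`
  have step : ∀ d x', D.Pos d → d * x' = y0 * d → D.lo x' = r →
      (∃ t, D.Pos t ∧ d0 = d * t ∧ x' = t * x * t⁻¹) →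
      ∃ d', D.Pos d' ∧ d' * (delta n * D.cyc x' * (delta n)⁻¹) = y0 * d' ∧
        (∃ t, D.Pos t ∧ d0 = d' * t ∧ delta n * D.cyc x' * (delta n)⁻¹ = t * x * t⁻¹) ∧
        D.len (D.hd d') + 1 ≤ D.len (D.hd d) := by
    rintro d x' hd hdx hrx ⟨t, ht, hdt, hxt⟩
    have hxy : D.lo x' < D.lo y0 := by rwa [hrx]
    have hd' := D.pos_descent hd hdx hxy
    have key := D.hd_descent hd hdx hxy
    rw [hrx] at key
    refine ⟨_, hd', ?_, ⟨delta n * (D.ev (D.cycFac x'))⁻¹ * t, (D.pos_compl _).mul ht, ?_, ?_⟩, ?_⟩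
    · rw [conj_twist_cyc]
      calc _ = (d * x') * (D.ev (D.cycFac x') * (delta n)⁻¹) := by group
        _ = _ := by rw [hdx]; group
    · rw [hdt]; group
    · rw [conj_twist_cyc, hxt]; group
    · have hle := ((key _).1 (D.dvd_refl _)).1
      by_contra hcon
      have heq := hle.eq_of_len (by omega)
      have hK := ((key _).1 (D.dvd_refl _)).2
      rw [heq] at hK
      obtain ⟨e, u, h1, h2, h3, h4, h5⟩ := D.exists_factor_of_stable hlt0 hd hdx hrx rfl hK
      have h6 := hmin' e (u * t) h1 (h2.mul ht) (by rw [hdt, h3, mul_assoc]) (by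
        rw [hxt] at h5; convert h5 using 2; group)
      rw [h6, hd_one] at h4
      have h7 := D.eq_one_of_hd hd h4.symm
      rw [h7, one_mul, mul_one] at hdx
      rw [hdx] at hrx; omega
  obtain ⟨d1, hd1, h1, ht1, hl1⟩ := step d0 x hd0 (by rw [hy0]; group) rfl
    ⟨1, D.pos_one, by simp, by simp⟩
  obtain ⟨d2, hd2, h2, -, hl2⟩ := step d1 _ hd1 h1 (by rw [lo_conj_delta_one, e1]) ht1
  have h3 := D.eq_one_of_hd hd2 (D.len_eq_zero _ (by omega))
  rw [h3, one_mul, mul_one] at h2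
  have h4 := D.cyc_conj_delta (D.cyc x) 1
  simp only [zpow_one, zpow_neg] at h4
  rw [← h2, lo_conj_delta_one, h4, lo_conj_delta_one, e2] at hlt0
  omega

end Germ

/-! ### Almost strongly quasipositive braids and the super summit set -/

namespace Germ
variable {n : ℕ} (D : Germ n)

/-- Some factor is `δ` up to one band, that is, of length `n - 2`. -/
def HasCoatom (L : List D.S) : Prop := ∃ A ∈ L, D.len A = n - 2

theorem hi_one : D.hi 1 = 0 := by simp [hi, lo_one, facs_one]

theorem hi_eval_le (r : ℤ) (L : List D.S) : D.hi (delta n ^ r * D.prod L) ≤ r + L.length := by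
  have := D.hi_prod_mul_le L 1
  rw [mul_one, hi_one] at this
  rw [hi] at this ⊢
  rw [lo_delta_mul, facs_delta_mul]
  linarith

theorem le_lo_eval (r : ℤ) (L : List D.S) : r ≤ D.lo (delta n ^ r * D.prod L) := by
  rw [lo_delta_mul]
  have := (D.pos_iff (D.prod L)).1 ⟨L, rfl⟩
  linarith

theorem expo_prod (L : List D.S) : (expo (D.prod L)).toAdd = ((L.map D.len).sum : ℕ) := by
  induction L with
  | nil => simp
  | cons a L ih => simp only [D.prod_cons, map_mul, toAdd_mul, D.expo_ev, ih]; simp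

theorem expo_eval (r : ℤ) (L : List D.S) :
    (expo (delta n ^ r * D.prod L)).toAdd = r * ((n : ℤ) - 1) + ((L.map D.len).sum : ℕ) := by
  rw [map_mul, toAdd_mul, expo_prod, map_zpow, toAdd_zpow, D.expo_delta]
  simp

theorem two_le (D : Germ n) : 2 ≤ n := by
  by_contra h
  exact D.top_ne_one (D.len_eq_zero _ (by rw [D.len_top]; omega))

theorem nb_eq_zero_of_pos {β : Braid n} (h : D.Pos β) : nb β = 0 :=
  Nat.le_zero.1 ((D.mem_SQP β).2 h)

/-- If `A` is a factor of length `n - 2`, then `A⁻¹ δ` is a band `b`, and `δ⁻¹ P A Q` equals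
`(δ⁻¹ P δ) b⁻¹ Q`. -/
theorem mem_ASQP_of_hasCoatom {x : Braid n} {L : List D.S} (hx : x = delta n ^ (-1 : ℤ) * D.prod L)
    (h : D.HasCoatom L) : x ∈ ASQP n := by
  obtain ⟨A, hA, hl⟩ := h
  obtain ⟨L1, L2, rfl⟩ := List.append_of_mem hA
  have hc := D.ev_mul (a := A) (b := D.comp A) (by rw [D.lw_comp])
  have hlen := D.len_lw A (D.comp A)
  rw [D.lw_comp] at hc hlen
  simp only [D.ev_top, D.len_one, D.len_top] at hc hlen
  obtain ⟨b, hb⟩ := D.exists_band (D.comp A) (by have := D.two_le; omega)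
  have key : x = (delta n ^ (-1 : ℤ) * D.prod L1 * delta n ^ (- -1 : ℤ)) * (D.ev (D.comp A))⁻¹ *
      D.prod L2 := by
    rw [hx, prod_append, prod_cons]
    have : delta n ^ (- -1 : ℤ) = D.ev A * D.ev (D.comp A) := by rw [hc]; simp
    rw [this]; group
  have hL1 : D.Pos (D.prod L1) := ⟨L1, rfl⟩
  have h1 := D.nb_eq_zero_of_pos (hL1.conj_delta (-1))
  have h2 := D.nb_eq_zero_of_pos (⟨L2, rfl⟩ : D.Pos (D.prod L2))
  have h3 : nb (D.ev (D.comp A))⁻¹ ≤ 1 :=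
    (nb_le_iff _).2 ⟨[(b, false)], by simp [BandWord.toBraid, SignedBand.toBraid, ← D.ev_band, hb],
      by simp [BandWord.nb]⟩
  change nb x ≤ 1
  rw [key]
  refine (nb_mul_le _ _).trans ?_
  have := nb_mul_le (delta n ^ (-1 : ℤ) * D.prod L1 * delta n ^ (- -1 : ℤ)) (D.ev (D.comp A))⁻¹
  omega

theorem pos_of_nb {W : BandWord n} (h : W.nb = 0) : D.Pos W.toBraid :=
  (D.mem_SQP _).1 ((nb_le_iff _).2 ⟨W, rfl, h.le⟩)

/-- A braid represented by a band word with exactly one negative letter `a⁻¹` is conjugate to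
`δ⁻¹ B a₁ ⋯ a_p`, with the simple element `B = δ a⁻¹` and bands `a_i`. The exponent sum is `p - 1`,
so that `hi` is at most the exponent sum plus one. -/
theorem exists_conj_of_mem_ASQP {γ : Braid n} (h : γ ∈ ASQP n) (hs : γ ∉ SQP n) :
    ∃ z, IsConj γ z ∧ -1 ≤ D.lo z ∧ D.hi z ≤ (expo γ).toAdd + 1 ∧ -1 ≤ (expo γ).toAdd := by
  obtain ⟨W, rfl, hW⟩ := (nb_le_iff γ).1 h
  have h1 : W.nb = 1 := by
    by_contra hne
    exact hs ((D.mem_SQP _).2 (D.pos_of_nb (by omega)))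
  have hex : ∃ x ∈ W, (fun x : SignedBand n => !x.2) x := by
    rw [← List.countP_pos_iff]; rw [BandWord.nb] at h1; omega
  obtain ⟨⟨a, b⟩, hx, hb⟩ := hex
  simp only [Bool.not_eq_eq_eq_not, Bool.not_true] at hb
  subst hb
  obtain ⟨V, V', rfl⟩ := List.append_of_mem hx
  have hV : BandWord.nb V = 0 ∧ BandWord.nb V' = 0 := by
    simp only [BandWord.nb, List.countP_append, List.countP_cons] at h1 ⊢
    simp only [Bool.not_false, if_true] at h1
    omega
  have hsqp : ∃ U : List (Band n),
      (U.map Band.toBraid).prod = BandWord.toBraid V' * BandWord.toBraid V :=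
    (mem_SQP_iff _).1 ((D.mem_SQP _).2 ((D.pos_of_nb hV.2).mul (D.pos_of_nb hV.1)))
  obtain ⟨U, hU⟩ := hsqp
  have hc := D.comp_lw (D.tau.symm (D.band a))
  rw [Equiv.apply_symm_apply] at hc
  have hc2 := D.ev_mul (a := D.comp (D.tau.symm (D.band a))) (b := D.band a) (by rw [hc])
  rw [hc, D.ev_top, D.ev_band] at hc2
  have hdec : BandWord.toBraid (V ++ (a, false) :: V') =
      BandWord.toBraid V * (a.toBraid⁻¹ * BandWord.toBraid V') := by
    simp [BandWord.toBraid, SignedBand.toBraid]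
  have hconj : IsConj (BandWord.toBraid (V ++ (a, false) :: V'))
      (delta n ^ (-1 : ℤ) * D.prod (D.comp (D.tau.symm (D.band a)) :: U.map D.band)) := by
    refine isConj_iff.2 ⟨(BandWord.toBraid V)⁻¹, ?_⟩
    have : D.prod (U.map D.band) = BandWord.toBraid V' * BandWord.toBraid V := by
      rw [← hU]; simp [prod, Function.comp_def, D.ev_band]
    rw [prod_cons, this, hdec, zpow_neg_one, ← hc2]
    group
  have hexp := D.expo_eval (-1) (D.comp (D.tau.symm (D.band a)) :: U.map D.band)
  rw [← expo_eq_of_isConj hconj] at hexp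
  have hlen := D.len_lw (D.comp (D.tau.symm (D.band a))) (D.band a)
  rw [hc] at hlen
  simp only [D.len_one, D.len_top, D.len_band] at hlen
  have hn := D.two_le
  have hsum : ((U.map D.band).map D.len).sum = U.length := by
    simp [Function.comp_def, D.len_band]
  rw [List.map_cons, List.sum_cons, hsum] at hexp
  refine ⟨_, hconj, D.le_lo_eval _ _, (D.hi_eval_le _ _).trans ?_, ?_⟩
  · rw [hexp]; simp; omega
  · rw [hexp]; omega

theorem len_pos_of_isNF {L : List D.S} (h : D.IsNF L) {A : D.S} (hA : A ∈ L) : 1 ≤ D.len A := by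
  by_contra h0
  exact h.ne_one A hA (D.len_eq_zero A (by omega))

theorem length_le_sum {L : List D.S} (h : D.IsNF L) : L.length ≤ (L.map D.len).sum := by
  have := List.card_nsmul_le_sum (L.map D.len) 1 (by
    intro x hx
    obtain ⟨A, hA, rfl⟩ := List.mem_map.1 hx
    exact D.len_pos_of_isNF h hA)
  simpa using this

/-- Without a factor of length `n - 2` there are no factors for `n = 3`, and all of them are atoms
for `n = 4`. -/
theorem len_eq_one_of_not_hasCoatom (hn : n ≤ 4) {x : Braid n} (h : ¬ D.HasCoatom (D.facs x))
    {A : D.S} (hA : A ∈ D.facs x) : n = 4 ∧ D.len A = 1 := by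
  have h1 := D.len_lt_top A (D.facs_ne_top x A hA)
  have h2 := D.len_pos_of_isNF (D.isNF_facs x) hA
  have h3 : D.len A ≠ n - 2 := fun h3 => h ⟨A, hA, h3⟩
  omega

theorem expo_eq (x : Braid n) :
    (expo x).toAdd = D.lo x * ((n : ℤ) - 1) + (((D.facs x).map D.len).sum : ℕ) := by
  conv_lhs => rw [D.eq_eval x]
  exact D.expo_eval _ _

theorem sum_len_of_not_hasCoatom (hn : n ≤ 4) {x : Braid n} (h : ¬ D.HasCoatom (D.facs x)) :
    ((D.facs x).map D.len).sum = (D.facs x).length := by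
  rw [List.map_congr_left (g := fun _ => 1)
    (fun A hA => (D.len_eq_one_of_not_hasCoatom hn h hA).2)]
  simp

/-- If `lo x = -1` and no factor of `x` has length `n - 2`, and if `x` is conjugate to a braid with
a single negative band, then `n = 4` and all factors of `x` are atoms. So `hi x` is the exponent sum
plus two, which is not minimal in the conjugacy class by `Germ.exists_conj_of_mem_ASQP`. -/
theorem exists_hi_lt_of_not_hasCoatom (hn3 : 3 ≤ n) (hn : n ≤ 4) {x γ : Braid n} (hlo : D.lo x = -1)
    (h : ¬ D.HasCoatom (D.facs x)) (hγ : γ ∈ ASQP n) (hs : γ ∉ SQP n) (hc : IsConj x γ) :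
    2 ≤ (D.facs x).length ∧ n = 4 ∧ ∃ z, IsConj x z ∧ -1 ≤ D.lo z ∧ D.hi z < D.hi x := by
  obtain ⟨z, h1, h2, h3, h4⟩ := D.exists_conj_of_mem_ASQP hγ hs
  rw [← expo_eq_of_isConj hc, D.expo_eq, D.sum_len_of_not_hasCoatom hn h, hlo] at h3 h4
  have hn4 : n = 4 := by
    cases hL : D.facs x with
    | nil => rw [hL] at h4; simp at h4; omega
    | cons a L => exact (D.len_eq_one_of_not_hasCoatom hn h (A := a) (by rw [hL]; simp)).1
  refine ⟨?_, hn4, z, hc.trans h1, h2, ?_⟩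
  · omega
  · have : D.hi x = -1 + (D.facs x).length := by rw [hi, hlo]
    omega

/-- A braid is conjugate to a strongly quasipositive one if and only if `lo` is nonnegative somewhere
in the conjugacy class. -/
theorem exists_SQP_iff (β : Braid n) :
    (∃ γ ∈ SQP n, IsConj β γ) ↔ ∃ y, IsConj β y ∧ 0 ≤ D.lo y := by
  constructor
  · rintro ⟨y, h1, h2⟩; exact ⟨y, h2, (D.pos_iff y).1 ((D.mem_SQP y).1 h1)⟩
  · rintro ⟨y, h1, h2⟩; exact ⟨y, (D.mem_SQP y).2 ((D.pos_iff y).2 h2), h1⟩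

theorem conjASQPNotSQP_of_max {β x : Braid n} (hx : IsConj β x)
    (hmax : ∀ y, IsConj β y → D.lo y ≤ -1) {L : List D.S}
    (hL : x = delta n ^ (-1 : ℤ) * D.prod L) (h : D.HasCoatom L) : ConjASQPNotSQP β := by
  refine ⟨⟨x, D.mem_ASQP_of_hasCoatom hL h, hx⟩, ?_⟩
  rw [D.exists_SQP_iff]
  rintro ⟨y, h1, h2⟩
  have := hmax y h1; omega

theorem exists_conj_of_conjASQP {β : Braid n} (h : ConjASQPNotSQP β) :
    ∃ y, IsConj β y ∧ D.lo y = -1 := by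
  obtain ⟨⟨γ, h1, h2⟩, h3⟩ := h
  obtain ⟨z, h4, h5, -⟩ := D.exists_conj_of_mem_ASQP h1 (fun hs => h3 ⟨γ, hs, h2⟩)
  rw [D.exists_SQP_iff] at h3
  refine ⟨z, h2.trans h4, ?_⟩
  by_contra hne
  exact h3 ⟨z, h2.trans h4, by omega⟩

/-- On the super summit set `lo` is maximal, hence `-1`, and the canonical length is minimal. By
`Germ.exists_hi_lt_of_not_hasCoatom` there is then a factor of length `n - 2`. -/
theorem conjASQPNotSQP_SSS (hn3 : 3 ≤ n) (hn : n ≤ 4) {β γ : Braid n} (h : ConjASQPNotSQP β)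
    (hγ : γ ∈ SSS β) : D.lo γ = -1 ∧ D.HasCoatom (D.facs γ) := by
  obtain ⟨y, hy1, hy2⟩ := D.exists_conj_of_conjASQP h
  have h1 := D.lo_le_of_mem_SSS hγ hy1
  have h2 : ¬ 0 ≤ D.lo γ := fun h0 => h.2 ((D.exists_SQP_iff β).2 ⟨γ, hγ.1, h0⟩)
  have h3 : D.lo γ = -1 := by omega
  refine ⟨h3, ?_⟩
  by_contra hco
  obtain ⟨⟨α, ha1, ha2⟩, hb⟩ := h
  obtain ⟨-, -, z, hz1, hz2, hz3⟩ := D.exists_hi_lt_of_not_hasCoatom hn3 hn h3 hco ha1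
    (fun hs => hb ⟨α, hs, ha2⟩) (hγ.1.symm.trans ha2)
  have := hγ.2 z (hγ.1.trans hz1)
  rw [D.canonicalLength_eq, D.canonicalLength_eq] at this
  simp only [hi] at hz3
  omega

/-! ### Rigid braids -/

theorem len_zpow_tau (r : ℤ) (c : D.S) : D.len ((D.tau ^ r) c) = D.len c := by
  have e := congrArg (fun g => (expo g).toAdd) (D.ev_mul_delta_zpow c r)
  simp only [map_mul, toAdd_mul, D.expo_ev, toAdd_ofAdd] at e
  omega

/-- The normal form `δ ^ r L` with all factors in `L` of length one is rigid: the last and the first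
factor, the latter moved across `δ ^ r`, are left-weighted as well. -/
structure Rigid (r : ℤ) (L : List D.S) : Prop where
  nf : D.IsNF L
  len : ∀ a ∈ L, D.len a = 1
  closing : ∀ a ∈ L.head?, ∀ c ∈ L.getLast?,
    D.lw c ((D.tau ^ (-r)) a) = (c, (D.tau ^ (-r)) a)

/-- Rigidity is kept when the last factor is moved to the front. -/
theorem Rigid.rotate {D : Germ n} {r : ℤ} {M : List D.S} {c : D.S} (h : D.Rigid r (M ++ [c])) :
    D.Rigid r ((D.tau ^ r) c :: M) := by
  have hM : ∀ y ∈ M.head?, D.lw ((D.tau ^ r) c) y = ((D.tau ^ r) c, y) := by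
    intro y hy
    have h1 := h.closing y (by cases M <;> simp_all) c (by simp)
    have h2 := D.lw_zpow_tau r c ((D.tau ^ (-r)) y)
    rw [h1, ← Equiv.Perm.mul_apply, ← zpow_add, add_neg_cancel] at h2
    simpa using h2
  obtain ⟨h1, -, h2⟩ := List.isChain_append.1 h.nf.chain
  have hlen : D.len ((D.tau ^ r) c) = 1 := by rw [len_zpow_tau, h.len c (by simp)]
  refine ⟨⟨List.isChain_cons.2 ⟨hM, h1⟩, ?_⟩, ?_, ?_⟩
  · intro a ha
    rcases List.mem_cons.1 ha with rfl | ha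
    · intro h0; rw [h0, D.len_one] at hlen; omega
    · exact h.nf.ne_one a (by simp [ha])
  · intro a ha
    rcases List.mem_cons.1 ha with rfl | ha
    · exact hlen
    · exact h.len a (by simp [ha])
  · intro a ha b hb
    simp only [List.head?_cons, Option.mem_def, Option.some.injEq] at ha
    subst ha
    rw [← Equiv.Perm.mul_apply, ← zpow_add, neg_add_cancel, zpow_zero, Equiv.Perm.one_apply]
    rcases List.eq_nil_or_concat M with rfl | ⟨M', d, rfl⟩
    · simp only [List.getLast?_singleton, Option.mem_def, Option.some.injEq] at hb
      subst hb
      have h1 := h.closing c (by simp) c (by simp)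
      have h2 := D.lw_zpow_tau r c ((D.tau ^ (-r)) c)
      rw [h1, ← Equiv.Perm.mul_apply, ← zpow_add, add_neg_cancel] at h2
      simpa using h2
    · rw [List.concat_eq_append] at hb
      have : d = b := by simpa [List.getLast?_cons] using hb
      subst this
      exact h2 d (by simp) c (by simp)

variable {D} in
theorem Rigid.nf_eval {r : ℤ} {L : List D.S} (hn : 3 ≤ n) (h : D.Rigid r L) :
    D.lo (delta n ^ r * D.prod L) = r ∧ D.facs (delta n ^ r * D.prod L) = L :=
  D.nf_unique h.nf (by rintro a ha rfl; have := h.len _ ha; rw [D.len_top] at this; omega)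

/-- Cycling the inverse of a rigid braid is, up to conjugation by `δ`, the inverse of the rotated
braid. -/
theorem Rigid.cyc_inv {D : Germ n} {r : ℤ} {M : List D.S} {c : D.S} (hn : 3 ≤ n)
    (h : D.Rigid r (M ++ [c])) :
    D.cyc (delta n ^ r * D.prod (M ++ [c]))⁻¹ =
      (delta n)⁻¹ * (delta n ^ r * D.prod ((D.tau ^ r) c :: M))⁻¹ * delta n := by
  set x := delta n ^ r * D.prod (M ++ [c]) with hx
  obtain ⟨h1, h2⟩ := h.nf_eval hn
  rw [← hx] at h1 h2
  have hc := D.ev_mul (a := c) (b := D.comp c) (by rw [D.lw_comp])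
  have hlen := D.len_lw c (D.comp c)
  rw [D.lw_comp] at hc hlen
  simp only [D.ev_top, D.len_one, D.len_top] at hc hlen
  have hc1 := h.len c (by simp)
  have hfac : D.cycFac x⁻¹ = D.comp c := by
    have hdvd : D.Dvd (D.comp c) (D.cycFac x⁻¹) := by
      rw [cycFac, D.dvd_hd_iff _ (D.pos_shift _), pos_iff, ← mul_assoc, lo_mul_delta,
        ← mul_inv_rev, lo_inv, lo_inv]
      have : x * D.ev (D.comp c) = delta n ^ (r + 1) * D.prod (M.map (D.tau ^ (1 : ℤ))) := by
        rw [hx, prod_append, prod_cons, prod_nil, mul_one, mul_assoc, mul_assoc, hc, zpow_add,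
          mul_assoc, ← D.prod_mul_delta, zpow_one]
      rw [this]
      have h3 := D.hi_eval_le (r + 1) (M.map (D.tau ^ (1 : ℤ)))
      have h4 : D.hi x = r + (M ++ [c]).length := by rw [hi, h1, h2]
      simp at h3 h4 ⊢
      omega
    have h3 := D.len_lt_top _ (D.cycFac_ne_top x⁻¹)
    exact (hdvd.eq_of_len (by omega)).symm
  have h4 := D.ev_mul_delta_zpow c r
  rw [cyc, hfac, prod_cons, ← mul_assoc, ← h4, hx, prod_append, prod_cons, prod_nil, mul_one,
    eq_inv_mul_of_mul_eq hc]
  group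

/-- A rigid braid has the least `hi` in its conjugacy class: otherwise two cyclings of its inverse
would raise `lo` by `Germ.lo_lt_cyc_cyc`, but cycling only rotates the factors. -/
theorem Rigid.hi_le_of_isConj {D : Germ n} (hn3 : 3 ≤ n) (hn : n ≤ 4) {r : ℤ} {L : List D.S}
    (h : D.Rigid r L) (hL : L ≠ []) {z : Braid n} (hz : IsConj (delta n ^ r * D.prod L) z) :
    D.hi (delta n ^ r * D.prod L) ≤ D.hi z := by
  by_contra! hlt
  set x := delta n ^ r * D.prod L with hx
  obtain ⟨M, c, rfl⟩ : ∃ M c, L = M ++ [c] := by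
    rcases List.eq_nil_or_concat L with h | ⟨M, c, h⟩
    · exact absurd h hL
    · exact ⟨M, c, by rw [h, List.concat_eq_append]⟩
  have hz' : IsConj x⁻¹ z⁻¹ := by
    obtain ⟨g, rfl⟩ := isConj_iff.1 hz
    exact isConj_iff.2 ⟨g, by group⟩
  have key := D.lo_lt_cyc_cyc hn hz' (by rw [D.lo_inv, D.lo_inv]; omega)
  have h1 := h.cyc_inv hn3
  rw [← hx] at h1
  have hr := h.rotate
  obtain ⟨M', c', hM'⟩ : ∃ M' c', (D.tau ^ r) c :: M = M' ++ [c'] := by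
    rcases List.eq_nil_or_concat ((D.tau ^ r) c :: M) with h | ⟨M', c', h⟩
    · simp at h
    · exact ⟨M', c', by rw [h, List.concat_eq_append]⟩
  have hlen : (M' ++ [c']).length = (M ++ [c]).length := by rw [← hM']; simp
  rw [hM'] at hr h1
  have h2 := hr.cyc_inv hn3
  have h3 := hr.rotate
  have h4 := D.cyc_conj_delta (delta n ^ r * D.prod (M' ++ [c']))⁻¹ (-1)
  simp only [zpow_neg, zpow_one, inv_inv] at h4
  obtain ⟨e1, e2⟩ := h.nf_eval hn3
  obtain ⟨e3, e4⟩ := h3.nf_eval hn3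
  rw [← hx] at e1 e2
  have h5 : ∀ w : Braid n, D.lo ((delta n)⁻¹ * w * delta n) = D.lo w := by
    intro w; simpa using D.lo_conj_delta (-1) w
  rw [h1, h4, h2, h5, h5, D.lo_inv, D.lo_inv, hi, hi, e1, e2, e3, e4] at key
  simp at key hlen
  omega

/-- If `lo x = lo (cyc x) = -1` and `cyc x` has no factor of length `n - 2`, then all factors of
`cyc x` are atoms. By the exponent sum all factors of `x` are atoms as well and cycling has not
shortened the word, so that `x` is rigid. Then `hi x` is minimal in the conjugacy class, against
`Germ.exists_hi_lt_of_not_hasCoatom`. -/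
theorem not_conj_ASQP_of_terminal (hn3 : 3 ≤ n) (hn : n ≤ 4) {x : Braid n} (hx : D.lo x = -1)
    (hc : D.lo (D.cyc x) = -1)
    (hco : ¬ D.HasCoatom (D.facs (D.cyc x))) : ¬ ConjASQPNotSQP x := by
  rintro ⟨⟨γ, h1, h2⟩, h3⟩
  have hns : γ ∉ SQP n := fun hs => h3 ⟨γ, hs, h2⟩
  obtain ⟨hk, hn4, -⟩ := D.exists_hi_lt_of_not_hasCoatom hn3 hn hc hco h1 hns
    ((D.isConj_cyc x).symm.trans h2)
  -- by comparison of exponent sums the factors of `x` are atoms too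
  have hsum := D.sum_len_of_not_hasCoatom hn hco
  have he := expo_eq_of_isConj (D.isConj_cyc x)
  have he' := congrArg Multiplicative.toAdd he
  rw [D.expo_eq, D.expo_eq, hx, hc, hsum] at he'
  have hle := D.hi_cyc_le x
  have hle2 := D.length_le_sum (D.isNF_facs x)
  rw [hi, hi, hx, hc] at hle
  have hlen : ((D.facs x).map D.len).sum = (D.facs x).length := by omega
  have hlen' : (D.facs (D.cyc x)).length = (D.facs x).length := by omega
  have hone : ∀ A ∈ D.facs x, D.len A = 1 := by
    intro A hA
    by_contra hne
    have h4 := D.len_pos_of_isNF (D.isNF_facs x) hA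
    obtain ⟨L1, L2, hL⟩ := List.append_of_mem hA
    have h5 := D.isNF_facs x
    rw [hL] at h5 hlen
    have h6 : D.IsNF L1 :=
      ⟨(List.isChain_append.1 h5.chain).1, fun a ha => h5.ne_one a (by simp [ha])⟩
    have h7 : D.IsNF L2 := ⟨(List.isChain_append.1 h5.chain).2.1.tail,
      fun a ha => h5.ne_one a (by simp [ha])⟩
    have := D.length_le_sum h6
    have := D.length_le_sum h7
    simp at hlen
    omega
  have hco' : ¬ D.HasCoatom (D.facs x) := by
    rintro ⟨A, hA, hl⟩
    have := hone A hA; omega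
  have hrig : D.Rigid (-1) (D.facs x) := by
    refine ⟨D.isNF_facs x, hone, ?_⟩
    intro a ha c hcl
    cases hL : D.facs x with
    | nil => rw [hL] at ha; simp at ha
    | cons a' L =>
      rw [hL] at ha hcl hlen' hone
      simp only [List.head?_cons, Option.mem_def, Option.some.injEq] at ha
      subst ha
      have hcyc := D.cyc_of_facs_cons hL
      rw [hx] at hcyc
      obtain ⟨M, d, rfl⟩ : ∃ M d, L = M ++ [d] := by
        rcases List.eq_nil_or_concat L with h | ⟨M, d, h⟩
        · rw [h] at hlen'; simp at hlen'; omega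
        · exact ⟨M, d, by rw [h, List.concat_eq_append]⟩
      have hdc : d = c := by simpa [List.getLast?_cons] using hcl
      subst hdc
      set b := (D.tau ^ (- -1 : ℤ)) a' with hb
      by_contra hne
      have hlw := D.len_lw d b
      have hld := hone d (by simp)
      have hlb : D.len b = 1 := by rw [hb, len_zpow_tau, hone a' (by simp)]
      have hdvd : D.Dvd d (D.lw d b).1 := D.exists_lw_fst _ _
      have hev := D.ev_lw d b
      by_cases hp : D.len (D.lw d b).1 ≤ 1
      · have h4 := hdvd.eq_of_len (by omega)
        rw [← h4] at hev
        have h5 := congrArg D.hd (mul_left_cancel hev)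
        rw [hd_ev, hd_ev] at h5
        exact hne (Prod.ext h4.symm h5)
      · have h4 := D.len_eq_zero (D.lw d b).2 (by omega)
        rw [h4, D.ev_one, mul_one] at hev
        have h5 : D.cyc x = delta n ^ (-1 : ℤ) * D.prod (M ++ [(D.lw d b).1]) := by
          rw [hcyc]; simp [hev]
        have h6 := D.hi_eval_le (-1) (M ++ [(D.lw d b).1])
        rw [← h5, hi, hc] at h6
        simp at h6 hlen'
        omega
  obtain ⟨-, -, z, hz1, -, hz3⟩ := D.exists_hi_lt_of_not_hasCoatom hn3 hn hx hco' h1 hns h2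
  have hxe := D.eq_eval x
  rw [hx] at hxe
  have := hrig.hi_le_of_isConj hn3 hn (z := z) (by
    intro h0; rw [h0] at hlen'; simp at hlen'; simp [hlen'] at hk) (by rwa [← hxe])
  rw [← hxe] at this
  omega

/-! ### Left-canonical forms, and the characterization for three and four strands -/

theorem mem_CnFct_iff (A : Braid n) : A ∈ CnFct n ↔ ∃ s, D.ev s = A := by
  have h1 := D.delta_le_iff 0 A
  have h2 := D.le_delta_iff 1 A
  rw [zpow_zero] at h1
  rw [zpow_one] at h2
  change Le 1 A ∧ Le A (delta n) ↔ _
  rw [h1, h2]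
  constructor
  · rintro ⟨h3, h4⟩
    have h5 := D.eq_eval A
    rw [hi] at h4
    match hL : D.facs A with
    | [] =>
      rw [hL] at h4 h5
      rcases (by simp at h4; omega : D.lo A = 0 ∨ D.lo A = 1) with h0 | h0
      · exact ⟨D.one, by rw [h5, h0, D.ev_one]; simp⟩
      · exact ⟨D.top, by rw [h5, h0, D.ev_top]; simp⟩
    | [a] =>
      rw [hL] at h4 h5
      have h0 : D.lo A = 0 := by simp at h4; omega
      exact ⟨a, by rw [h5, h0]; simp⟩
    | a :: b :: L => rw [hL] at h4; simp at h4; omega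
  · rintro ⟨s, rfl⟩
    refine ⟨(D.pos_iff _).1 (D.pos_ev s), ?_⟩
    have := (D.hi_ev_mul s 1).2
    rwa [mul_one, hi_one, zero_add] at this

theorem ev_injective : Function.Injective D.ev := fun a b h => by
  rw [← D.hd_ev a, h, D.hd_ev]

/-- The normal form is the left-canonical form. -/
theorem isLCF_facs (β : Braid n) : IsLCF β (D.lo β) ((D.facs β).map D.ev) := by
  refine ⟨D.eq_eval β, ?_, ?_⟩
  · intro A hA
    obtain ⟨a, ha, rfl⟩ := List.mem_map.1 hA
    refine ⟨(D.mem_CnFct_iff _).2 ⟨a, rfl⟩, ?_, ?_⟩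
    · rw [← D.ev_one]; exact D.ev_injective.ne ((D.isNF_facs β).ne_one a ha)
    · rw [← D.ev_top]; exact D.ev_injective.ne (D.facs_ne_top β a ha)
  · rw [List.isChain_map]
    refine (D.isNF_facs β).chain.imp fun a b hab => ?_
    intro A' hA' B' hB' h hprec
    obtain ⟨s, rfl⟩ := (D.mem_CnFct_iff _).1 hA'
    obtain ⟨t, rfl⟩ := (D.mem_CnFct_iff _).1 hB'
    obtain ⟨Q, hQ, hq⟩ := hprec
    obtain ⟨q, rfl⟩ := (D.mem_CnFct_iff _).1 hQ
    have h1 : D.Dvd a s := by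
      have := (D.dvd_hd_iff a (D.pos_ev s)).2 (by rw [← hq, inv_mul_cancel_left]; exact D.pos_ev q)
      rwa [hd_ev] at this
    have h2 := congrArg D.hd h
    rw [D.hd_ev_mul a (D.pos_ev b), D.hd_ev_mul s (D.pos_ev t), hd_ev, hd_ev, hab] at h2
    have h3 : D.Dvd s a := by
      rw [show a = (D.lw s t).1 from h2]; exact D.exists_lw_fst _ _
    rw [h1.antisymm h3]

theorem bandLength_ev (s : D.S) : bandLength (D.ev s) = D.len s := by
  obtain ⟨W, h1, h2⟩ := D.exists_bands s
  apply le_antisymm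
  · exact Nat.sInf_le ⟨W.map fun a => (a, true), by
      rw [← h1]; simp only [BandWord.toBraid, List.map_map]; rfl, by simpa using h2⟩
  · obtain ⟨V, h3, h4⟩ := Nat.sInf_mem (s := {m | ∃ V : BandWord n, V.toBraid = D.ev s ∧
      V.length = m}) ⟨_, W.map fun a => (a, true), by
      rw [← h1]; simp only [BandWord.toBraid, List.map_map]; rfl, rfl⟩
    have key : ∀ V : BandWord n, (expo V.toBraid).toAdd ≤ V.length := by
      intro V
      induction V with
      | nil => simp [BandWord.toBraid]
      | cons x V ih =>
        have : BandWord.toBraid (x :: V) = x.toBraid * BandWord.toBraid V := by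
          simp [BandWord.toBraid]
        have hx : (expo x.toBraid).toAdd ≤ 1 := by
          rw [SignedBand.toBraid]
          split_ifs <;> simp [expo_band]
        rw [this, map_mul, toAdd_mul, List.length_cons]
        push_cast
        linarith
    have h5 := key V
    rw [h3, D.expo_ev] at h5
    change D.len s ≤ sInf _
    rw [← h4]
    simpa using h5

theorem conjASQPNotSQP_of_exists {β : Braid n} (h : ∃ γ ∈ SSS β, D.lo γ = -1 ∧
    ∃ L, γ = delta n ^ (-1 : ℤ) * D.prod L ∧ D.HasCoatom L) : ConjASQPNotSQP β := by
  obtain ⟨γ, hγ, h1, L, hL, h2⟩ := h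
  exact D.conjASQPNotSQP_of_max hγ.1 (fun y hy => h1 ▸ D.lo_le_of_mem_SSS hγ hy) hL h2

theorem conjASQPNotSQP_iff_forall (hn3 : 3 ≤ n) (hn : n ≤ 4) (β : Braid n) :
    ConjASQPNotSQP β ↔ ∀ γ ∈ SSS β, D.lo γ = -1 ∧ D.HasCoatom (D.facs γ) := by
  refine ⟨fun h γ hγ => D.conjASQPNotSQP_SSS hn3 hn h hγ, fun h => ?_⟩
  obtain ⟨γ, hγ⟩ := D.SSS_nonempty β
  obtain ⟨h1, h2⟩ := h γ hγ
  exact D.conjASQPNotSQP_of_exists ⟨γ, hγ, h1, D.facs γ, by rw [← h1]; exact D.eq_eval γ, h2⟩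

theorem tfae_four (D : Germ 4) (β : Braid 4) : List.TFAE [
    ConjASQPNotSQP β,
    ∀ γ ∈ SSS β, inf γ = -1 ∧ ∃ L : List (Braid 4), IsLCF γ (-1) L ∧ ∃ A ∈ L, bandLength A = 2,
    ∃ γ ∈ SSS β, inf γ = -1 ∧
      ∃ L : List (Braid 4), IsLCF γ (-1) L ∧ ∃ A ∈ L, bandLength A = 2] := by
  tfae_have 1 → 2 := by
    intro h1 γ hγ
    obtain ⟨h2, A, hA, hl⟩ := D.conjASQPNotSQP_SSS (by norm_num) le_rfl h1 hγ
    refine ⟨by rw [D.inf_eq, h2], (D.facs γ).map D.ev, by rw [← h2]; exact D.isLCF_facs γ,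
      D.ev A, List.mem_map_of_mem hA, by rw [D.bandLength_ev, hl]⟩
  tfae_have 2 → 3 := by
    intro h1
    obtain ⟨γ, hγ⟩ := D.SSS_nonempty β
    exact ⟨γ, hγ, h1 γ hγ⟩
  tfae_have 3 → 1 := by
    rintro ⟨γ, hγ, h1, L, hL, A, hA, hl⟩
    refine D.conjASQPNotSQP_of_exists ⟨γ, hγ, by rw [← D.inf_eq, h1], ?_⟩
    have : ∃ L' : List D.S, L'.map D.ev = L := by
      have hf : ∀ A ∈ L, ∃ s, D.ev s = A := fun A hA =>
        (D.mem_CnFct_iff A).1 (hL.factor A hA).1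
      clear hL hA
      induction L with
      | nil => exact ⟨[], rfl⟩
      | cons B L ih =>
        obtain ⟨s, rfl⟩ := hf B (by simp)
        obtain ⟨L', rfl⟩ := ih (fun A hA => hf A (by simp [hA]))
        exact ⟨s :: L', rfl⟩
    obtain ⟨L', rfl⟩ := this
    obtain ⟨s, hs, rfl⟩ := List.mem_map.1 hA
    exact ⟨L', hL.eq_prod, s, hs, by rw [← D.bandLength_ev, hl]⟩
  tfae_finish

theorem conjASQPNotSQP_three (D : Germ 3) (β : Braid 3) : ConjASQPNotSQP β ↔
    (∀ γ ∈ SSS β, inf γ = -1) ∧ ¬ IsConj β (delta 3)⁻¹ := by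
  rw [D.conjASQPNotSQP_iff_forall le_rfl (by norm_num)]
  constructor
  · intro h
    refine ⟨fun γ hγ => by rw [D.inf_eq, (h γ hγ).1], fun hc => ?_⟩
    have h1 := D.nf_unique (r := -1) D.isNF_nil (by simp)
    rw [prod_nil, mul_one, zpow_neg_one] at h1
    obtain ⟨-, A, hA, -⟩ := h _ (⟨hc, fun γ' _ => by
      rw [D.canonicalLength_eq, D.canonicalLength_eq, h1.2]; simp⟩ : (delta 3)⁻¹ ∈ SSS β)
    rw [h1.2] at hA
    simp at hA
  · rintro ⟨h1, h2⟩ γ hγ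
    have h3 : D.lo γ = -1 := by rw [← D.inf_eq, h1 γ hγ]
    refine ⟨h3, ?_⟩
    have h4 := D.eq_eval γ
    cases hL : D.facs γ with
    | nil =>
      rw [h3, hL, prod_nil, mul_one, zpow_neg_one] at h4
      exact absurd (h4 ▸ hγ.1) h2
    | cons a L =>
      refine ⟨a, by simp, ?_⟩
      have h5 := D.len_lt_top a (D.facs_ne_top γ a (by simp [hL]))
      have h6 := D.len_pos_of_isNF (D.isNF_facs γ) (A := a) (by simp [hL])
      omega

end Germ

/-! ### The tables for three and four strands -/

/-- It suffices to know `ev` on products which are simple: every left-weighting `a b = p q` moves a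
simple element `m` with `p = a m` and `b = m q`. -/
theorem ev_lw_of_mul {n : ℕ} {S : Type} (one : S) (lw : S → S → S × S) (ev : S → Braid n)
    (hmul : ∀ a b, (lw a b).2 = one → ev a * ev b = ev (lw a b).1)
    (h : ∀ a b, ∃ m, lw a m = ((lw a b).1, one) ∧ lw m (lw a b).2 = (b, one)) (a b : S) :
    ev (lw a b).1 * ev (lw a b).2 = ev a * ev b := by
  obtain ⟨m, h1, h2⟩ := h a b
  have h3 := hmul a m (by rw [h1])
  have h4 := hmul m (lw a b).2 (by rw [h2])
  rw [h1] at h3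
  rw [h2] at h4
  simp only at h3 h4
  rw [← h3, ← h4, mul_assoc]

/-- Evaluation of a function on `Fin N` given by the list of its values. -/
def lookup {N : ℕ} [NeZero N] (T : List ℕ) (a : Fin N) : Fin N := Fin.ofNat N (T.getD a.val 0)

/-- Evaluation of a binary operation given by its table, in which the pair `(p, q)` is encoded as
`N * p + q`. -/
def lookup₂ {N : ℕ} [NeZero N] (T : List (List ℕ)) (a b : Fin N) : Fin N × Fin N :=
  (Fin.ofNat N ((T.getD a.val []).getD b.val 0 / N),
    Fin.ofNat N ((T.getD a.val []).getD b.val 0 % N))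

/-- The left-weighting on the simple elements of `B₄`. They are numbered as in `ev4`: `0` is `1`,
then come the six bands, the six elements of length two, and `13` is `δ`. -/
def lw4 : Fin 14 → Fin 14 → Fin 14 × Fin 14 := lookup₂ [
  [0, 14, 28, 42, 56, 70, 84, 98, 112, 126, 140, 154, 168, 182],
  [14, 15, 16, 154, 98, 19, 126, 100, 156, 131, 182, 155, 128, 184],
  [28, 98, 30, 31, 32, 112, 168, 102, 115, 182, 171, 101, 170, 185],
  [42, 154, 112, 45, 140, 47, 48, 182, 117, 160, 146, 157, 118, 188],
  [56, 57, 98, 59, 60, 61, 140, 99, 103, 145, 143, 67, 182, 187],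
  [70, 126, 72, 112, 74, 75, 76, 130, 114, 132, 116, 182, 82, 186],
  [84, 85, 168, 140, 88, 126, 90, 169, 182, 127, 144, 141, 174, 183],
  [98, 99, 100, 101, 102, 103, 182, 105, 106, 187, 185, 109, 184, 190],
  [112, 182, 114, 115, 116, 117, 118, 186, 120, 188, 122, 185, 124, 192],
  [126, 127, 128, 182, 130, 131, 132, 133, 184, 135, 186, 183, 138, 189],
  [140, 141, 182, 143, 144, 145, 146, 183, 187, 149, 150, 151, 188, 191],
  [154, 155, 156, 157, 182, 159, 160, 184, 162, 163, 188, 165, 166, 194],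
  [168, 169, 170, 171, 172, 182, 174, 175, 185, 183, 178, 179, 180, 193],
  [182, 183, 184, 185, 186, 187, 188, 189, 190, 191, 192, 193, 194, 195]]

/-- Conjugation by `δ` on the simple elements of `B₄`. -/
def tau4 : Equiv.Perm (Fin 14) where
  toFun := lookup [0, 2, 3, 6, 5, 4, 1, 8, 10, 7, 9, 12, 11, 13]
  invFun := lookup [0, 6, 1, 2, 5, 4, 3, 9, 7, 10, 8, 12, 11, 13]
  left_inv := by unfold Function.LeftInverse; decide
  right_inv := by unfold Function.RightInverse Function.LeftInverse; decide

/-- The length of the simple elements of `B₄`. -/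
def len4 (a : Fin 14) : ℕ := [0, 1, 1, 1, 1, 1, 1, 2, 2, 2, 2, 2, 2, 3].getD a.val 0

/-- The simple element of a band of `B₄`; the pair `(i, j)` is encoded as `4 * i + j`. -/
def band4 (a : Band 4) : Fin 14 :=
  lookup [0, 1, 4, 6, 0, 0, 2, 5, 0, 0, 0, 3] (Fin.ofNat 14 (4 * a.1.1.val + a.1.2.val))

set_option maxRecDepth 100000 in
theorem lw4_mul : ∀ a b x, (lw4 a b).2 = 0 →
    (lw4 (lw4 a b).1 x).1 = (lw4 a (lw4 b x).1).1 ∧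
    lw4 (lw4 a (lw4 b x).1).2 (lw4 b x).2 = ((lw4 (lw4 a b).1 x).2, 0) := by decide +kernel

set_option maxRecDepth 100000 in
theorem lw4_chain_left : ∀ s a b, lw4 a b = (a, b) →
    lw4 (lw4 s a).1 (lw4 (lw4 s a).2 b).1 = ((lw4 s a).1, (lw4 (lw4 s a).2 b).1) := by decide +kernel

set_option maxRecDepth 100000 in
theorem lw4_chain_right : ∀ a b s, lw4 a b = (a, b) →
    lw4 (lw4 a (lw4 b s).1).2 (lw4 b s).2 = ((lw4 a (lw4 b s).1).2, (lw4 b s).2) := by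
  decide +kernel

theorem artin_comm {n : ℕ} {i j : Fin (n - 1)} (h : i.val + 1 < j.val) :
    (PresentedGroup.of i * PresentedGroup.of j : Braid n) =
      PresentedGroup.of j * PresentedGroup.of i := by
  have := PresentedGroup.one_of_mem (rels := artinRels n) (Or.inl ⟨i, j, h, rfl⟩)
  rwa [map_mul, map_inv, mul_inv_eq_one, map_mul, map_mul] at this

theorem artin_braid {n : ℕ} {i j : Fin (n - 1)} (h : j.val = i.val + 1) :
    (PresentedGroup.of i * PresentedGroup.of j * PresentedGroup.of i : Braid n) =
      PresentedGroup.of j * PresentedGroup.of i * PresentedGroup.of j := by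
  have := PresentedGroup.one_of_mem (rels := artinRels n) (Or.inr ⟨i, j, h, rfl⟩)
  rwa [map_mul, map_inv, mul_inv_eq_one, map_mul, map_mul, map_mul, map_mul] at this

/-! ### The braid relations among the simple elements -/

section relations
variable {G : Type*} [Group G] {x y z : G}

theorem mul_conj_of_braid (h : x * y * x = y * x * y) : x * (y * x * y⁻¹) = y * x := by
  rw [← mul_assoc, ← mul_assoc, h, mul_inv_cancel_right]

theorem conj_eq_of_braid (h : x * y * x = y * x * y) : y * x * y⁻¹ = x⁻¹ * (y * x) := by
  rw [← mul_conj_of_braid h, inv_mul_cancel_left, mul_conj_of_braid h]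

theorem conj_eq_inv_conj (h₁ : x * y * x = y * x * y) (h₂ : y * z * y = z * y * z)
    (h₃ : x * z = z * x) : z * y * x * (z * y)⁻¹ = (y * x)⁻¹ * z * (y * x) := by
  have h₄ : x⁻¹ * z = z * x⁻¹ := ((show Commute x z from h₃).inv_left).eq
  calc z * y * x * (z * y)⁻¹ = z * (y * x * y⁻¹) * z⁻¹ := by group
    _ = (z * x⁻¹) * y * (x * z⁻¹) := by rw [conj_eq_of_braid h₁]; group
    _ = (x⁻¹ * z) * y * (x * z⁻¹) := by rw [h₄]
    _ = x⁻¹ * (z * y * z⁻¹) * (z * (x * z⁻¹)) := by group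
    _ = x⁻¹ * (z * y * z⁻¹) * (x * z * z⁻¹) := by rw [← mul_assoc z, h₃]
    _ = (y * x)⁻¹ * z * (y * x) := by rw [conj_eq_of_braid h₂]; group

theorem commute_conj (h₁ : x * y * x = y * x * y) (h₂ : y * z * y = z * y * z)
    (h₃ : x * z = z * x) :
    y * (z * y * x * (z * y)⁻¹) = z * y * x * (z * y)⁻¹ * y := by
  rw [conj_eq_inv_conj h₁ h₂ h₃]
  calc y * ((y * x)⁻¹ * z * (y * x)) = (y * x)⁻¹ * (y * x * y) * (y * x)⁻¹ * z * (y * x) := by group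
    _ = (y * x)⁻¹ * (x * z) * (y * x) := by rw [← h₁]; group
    _ = (y * x)⁻¹ * z * (x * y * x) := by rw [h₃]; group
    _ = _ := by rw [h₁]; group

theorem conj_mul_conj (h₃ : x * z = z * x) :
    z * y * x * (z * y)⁻¹ * (z * y * z⁻¹) = z * y * z⁻¹ * x := by
  have h₄ : x * z⁻¹ = z⁻¹ * x := ((show Commute x z from h₃).inv_right).eq
  calc z * y * x * (z * y)⁻¹ * (z * y * z⁻¹) = z * y * (x * z⁻¹) := by group
    _ = _ := by rw [h₄]; group

theorem mul_conj_conj (h₁ : x * y * x = y * x * y) (h₃ : x * z = z * x) :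
    x * (z * y * x * (z * y)⁻¹) = z * y * z⁻¹ * x := by
  calc x * (z * y * x * (z * y)⁻¹) = (x * z) * y * x * (z * y)⁻¹ := by group
    _ = z * (x * y * x) * (z * y)⁻¹ := by rw [h₃]; group
    _ = z * y * (x * z⁻¹) := by rw [h₁]; group
    _ = _ := by rw [((show Commute x z from h₃).inv_right).eq]; group

theorem conj_mul_conj_conj (h₁ : x * y * x = y * x * y) (h₂ : y * z * y = z * y * z)
    (h₃ : x * z = z * x) :
    y * x * y⁻¹ * (z * y * x * (z * y)⁻¹) = z * (y * x * y⁻¹) := by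
  rw [conj_eq_inv_conj h₁ h₂ h₃]
  calc y * x * y⁻¹ * ((y * x)⁻¹ * z * (y * x)) = y * x * (y⁻¹ * x⁻¹ * y⁻¹) * z * y * x := by group
    _ = y * x * (y * x * y)⁻¹ * z * y * x := by group
    _ = y * x * (x * y * x)⁻¹ * z * y * x := by rw [h₁]
    _ = y * (y⁻¹ * (x⁻¹ * z) * y) * x := by group
    _ = z * (x⁻¹ * (y * x)) := by rw [((show Commute x z from h₃).inv_left).eq]; group
    _ = _ := by rw [conj_eq_of_braid h₁]

end relations

/-- The simple elements of `B₃`. -/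
def ev3 (a : Fin 5) : Braid 3 :=
  [1, sigma 0, sigma 1, sigma 1 * sigma 0 * (sigma 1)⁻¹, sigma 1 * sigma 0].getD a.val 1

/-- The simple elements of `B₄`, which correspond to the noncrossing partitions of four points. -/
def ev4 (a : Fin 14) : Braid 4 :=
  [1, sigma 0, sigma 1, sigma 2, sigma 1 * sigma 0 * (sigma 1)⁻¹,
    sigma 2 * sigma 1 * (sigma 2)⁻¹, sigma 2 * sigma 1 * sigma 0 * (sigma 2 * sigma 1)⁻¹,
    sigma 1 * sigma 0, sigma 2 * sigma 1, sigma 2 * sigma 1 * (sigma 2)⁻¹ * sigma 0,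
    sigma 2 * (sigma 1 * sigma 0 * (sigma 1)⁻¹), sigma 0 * sigma 2,
    sigma 2 * sigma 1 * sigma 0 * (sigma 2 * sigma 1)⁻¹ * sigma 1,
    sigma 2 * sigma 1 * sigma 0].getD a.val 1

theorem sigma_comm : (sigma 0 * sigma 2 : Braid 4) = sigma 2 * sigma 0 :=
  artin_comm (n := 4) (i := 0) (j := 2) (by decide)
theorem sigma_braid_three : (sigma 0 * sigma 1 * sigma 0 : Braid 3) = sigma 1 * sigma 0 * sigma 1 :=
  artin_braid (n := 3) (i := 0) (j := 1) (by decide)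
theorem sigma_braid_four : (sigma 0 * sigma 1 * sigma 0 : Braid 4) = sigma 1 * sigma 0 * sigma 1 :=
  artin_braid (n := 4) (i := 0) (j := 1) (by decide)
theorem sigma_braid_four' : (sigma 1 * sigma 2 * sigma 1 : Braid 4) = sigma 2 * sigma 1 * sigma 2 :=
  artin_braid (n := 4) (i := 1) (j := 2) (by decide)

theorem ev4_atom_mul : ∀ a b : Fin 14, len4 a = 1 → (lw4 a b).2 = 0 →
    ev4 a * ev4 b = ev4 (lw4 a b).1 := by
  have h₁ := sigma_braid_four
  have h₂ := sigma_braid_four'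
  have h₃ := sigma_comm
  intro a b ha hb
  fin_cases a <;> first | exact absurd ha (by decide) | skip
  all_goals fin_cases b <;> first | exact absurd hb (by decide) | skip
  · exact mul_one (ev4 1)
  · rfl
  · exact mul_conj_of_braid h₁
  · exact mul_conj_conj h₁ h₃
  · change sigma 0 * (sigma 2 * (sigma 1 * sigma 0 * (sigma 1)⁻¹)) = sigma 2 * sigma 1 * sigma 0
    rw [← mul_assoc, h₃, mul_assoc, mul_conj_of_braid h₁, mul_assoc]
  · exact mul_one (ev4 2)
  · rfl
  · exact mul_conj_of_braid h₂
  · exact commute_conj h₁ h₂ h₃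
  · change sigma 1 * (sigma 2 * sigma 1 * (sigma 2)⁻¹ * sigma 0) = sigma 2 * sigma 1 * sigma 0
    rw [← mul_assoc, mul_conj_of_braid h₂]
  · exact mul_one (ev4 3)
  · exact h₃.symm
  · rfl
  · rfl
  · exact (mul_assoc (sigma 2) (sigma 1) (sigma 0)).symm
  · exact mul_one (ev4 4)
  · exact inv_mul_cancel_right (sigma 1 * sigma 0) (sigma 1)
  · exact conj_mul_conj_conj h₁ h₂ h₃
  · change sigma 1 * sigma 0 * (sigma 1)⁻¹ * (sigma 2 * sigma 1 * sigma 0 * (sigma 2 * sigma 1)⁻¹ *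
      sigma 1) = sigma 2 * sigma 1 * sigma 0
    rw [← mul_assoc, conj_mul_conj_conj h₁ h₂ h₃]
    group
  · exact mul_one (ev4 5)
  · rfl
  · exact inv_mul_cancel_right (sigma 2 * sigma 1) (sigma 2)
  · change sigma 2 * sigma 1 * (sigma 2)⁻¹ * (sigma 0 * sigma 2) = sigma 2 * sigma 1 * sigma 0
    rw [h₃]; group
  · exact mul_one (ev4 6)
  · rfl
  · change sigma 2 * sigma 1 * sigma 0 * (sigma 2 * sigma 1)⁻¹ * sigma 2 =
      sigma 2 * (sigma 1 * sigma 0 * (sigma 1)⁻¹)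
    group
  · exact conj_mul_conj h₃
  · exact inv_mul_cancel_right (sigma 2 * sigma 1 * sigma 0) (sigma 2 * sigma 1)

/-- Reduction to `ev4_atom_mul` by splitting off an atom on the left. -/
theorem ev4_mul (a b : Fin 14) (h : (lw4 a b).2 = 0) : ev4 a * ev4 b = ev4 (lw4 a b).1 := by
  have hdec : ∀ a : Fin 14, a = 0 ∨ ∃ c d, len4 c = 1 ∧ len4 d < len4 a ∧ lw4 c d = (a, 0) := by
    decide +kernel
  induction k : len4 a using Nat.strong_induction_on generalizing a b with
  | _ k ih =>
  rcases hdec a with rfl | ⟨c, d, hc, hd, hcd⟩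
  · have : lw4 0 b = (b, 0) := by revert b; decide +kernel
    rw [this]; exact one_mul _
  · have h1 := ev4_atom_mul c d hc (by rw [hcd])
    rw [hcd] at h1
    obtain ⟨h2, h3⟩ := lw4_mul c d b (by rw [hcd])
    rw [hcd] at h2 h3
    simp only [h] at h2 h3
    have h4 : (lw4 d b).2 = 0 ∧ (lw4 c (lw4 d b).1).2 = 0 := by
      have : ∀ p q, lw4 p q = (0, 0) → q = 0 ∧ p = 0 := by decide +kernel
      exact this _ _ h3
    rw [← h1, mul_assoc, ih _ (k ▸ hd) d b h4.1 rfl, ev4_atom_mul c _ hc h4.2, h2]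

theorem ev4_band4 (a : Band 4) : ev4 (band4 a) = a.toBraid := by
  obtain ⟨⟨i, j⟩, h⟩ := a
  fin_cases i <;> fin_cases j <;> first | exact absurd h (by decide) | skip
  all_goals simp [band4, ev4, lookup, Band.toBraid, descProd, List.Ico, List.range', mul_assoc]

/-! ### The germs for four and for three strands -/

/-- The dual Garside structure of the braid group on four strands. -/
def germFour : Germ 4 where
  S := Fin 14
  one := 0
  top := 13
  top_ne_one := by decide
  lw := lw4
  tau := tau4
  comp := lookup [13, 10, 9, 7, 12, 11, 8, 6, 1, 3, 2, 4, 5, 0]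
  len := len4
  atom := lookup [1, 2, 3] ∘ Fin.castLE (by norm_num)
  band := band4
  ev := ev4
  one_lw := by decide +kernel
  lw_one := by decide +kernel
  lw_top := by decide +kernel
  top_lw := by decide +kernel
  lw_comp := by decide +kernel
  comp_lw := by decide +kernel
  lw_tau := by decide +kernel
  lw_idem := by decide +kernel
  lw_mul := lw4_mul
  lw_chain_left := lw4_chain_left
  lw_chain_right := lw4_chain_right
  lw_fst_ne_one := by decide +kernel
  exists_lw_fst := by decide +kernel
  len_lw := by decide +kernel
  len_eq_zero := by decide +kernel
  len_one := by decide +kernel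
  len_top := by decide +kernel
  len_lt_top := by decide +kernel
  atom_comm := by decide +kernel
  atom_braid := by decide +kernel
  generated := by
    intro P h0 ha hm hl hr
    have h1 : P 1 := ha 0
    have h2 : P 2 := ha 1
    have h3 : P 3 := ha 2
    have h7 : P 7 := hm 2 1 (by decide +kernel) h2 h1
    have h8 : P 8 := hm 3 2 (by decide +kernel) h3 h2
    have h11 : P 11 := hm 1 3 (by decide +kernel) h1 h3
    have h13 : P 13 := hm 3 7 (by decide +kernel) h3 h7
    have h4 : P 4 := hl 4 2 (by decide +kernel) h2 h7
    have h5 : P 5 := hl 5 3 (by decide +kernel) h3 h8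
    have h10 : P 10 := hm 3 4 (by decide +kernel) h3 h4
    have h9 : P 9 := hm 5 1 (by decide +kernel) h5 h1
    have h6 : P 6 := hl 6 3 (by decide +kernel) h3 h10
    have h12 : P 12 := hm 6 2 (by decide +kernel) h6 h2
    intro a
    fin_cases a <;> assumption
  len_band := by decide +kernel
  exists_band := by decide +kernel
  exists_len_one := by decide +kernel
  ev_one := rfl
  ev_top := by simp [ev4, delta, descProd, List.Ico, List.range', mul_assoc]
  ev_atom := by intro i; fin_cases i <;> rfl
  ev_band := ev4_band4
  ev_lw := ev_lw_of_mul 0 lw4 ev4 ev4_mul (by decide +kernel)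

/-- The left-weighting on the simple elements of `B₃`: `1`, the three bands and `δ`. -/
def lw3 : Fin 5 → Fin 5 → Fin 5 × Fin 5 := lookup₂ [
  [0, 5, 10, 15, 20], [5, 6, 7, 20, 22], [10, 20, 12, 13, 23], [15, 16, 20, 18, 21],
  [20, 21, 22, 23, 24]]

/-- Conjugation by `δ` on the simple elements of `B₃`. -/
def tau3 : Equiv.Perm (Fin 5) where
  toFun := lookup [0, 2, 3, 1, 4]
  invFun := lookup [0, 3, 1, 2, 4]
  left_inv := by unfold Function.LeftInverse; decide
  right_inv := by unfold Function.RightInverse Function.LeftInverse; decide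

/-- The length of the simple elements of `B₃`. -/
def len3 (a : Fin 5) : ℕ := [0, 1, 1, 1, 2].getD a.val 0

/-- The simple element of a band of `B₃`; the pair `(i, j)` is encoded as `2 * i + j`. -/
def band3 (a : Band 3) : Fin 5 :=
  lookup [0, 1, 3, 0, 2] (Fin.ofNat 5 (2 * a.1.1.val + a.1.2.val))

theorem ev3_mul (a b : Fin 5) (h : (lw3 a b).2 = 0) : ev3 a * ev3 b = ev3 (lw3 a b).1 := by
  fin_cases a
  · have : lw3 0 b = (b, 0) := by revert b; decide +kernel
    change ev3 0 * ev3 b = ev3 (lw3 0 b).1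
    rw [this]; exact one_mul _
  all_goals fin_cases b <;> first | exact absurd h (by decide) | exact mul_one (ev3 _) | skip
  · exact mul_conj_of_braid sigma_braid_three
  · rfl
  · exact inv_mul_cancel_right (sigma 1 * sigma 0) (sigma 1)

theorem ev3_band3 (a : Band 3) : ev3 (band3 a) = a.toBraid := by
  obtain ⟨⟨i, j⟩, h⟩ := a
  fin_cases i <;> fin_cases j <;> first | exact absurd h (by decide) | skip
  all_goals simp [band3, ev3, lookup, Band.toBraid, descProd, List.Ico]

/-- The dual Garside structure of the braid group on three strands. -/
def germThree : Germ 3 where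
  S := Fin 5
  one := 0
  top := 4
  top_ne_one := by decide
  lw := lw3
  tau := tau3
  comp := lookup [4, 3, 1, 2, 0]
  len := len3
  atom := lookup [1, 2] ∘ Fin.castLE (by norm_num)
  band := band3
  ev := ev3
  one_lw := by decide +kernel
  lw_one := by decide +kernel
  lw_top := by decide +kernel
  top_lw := by decide +kernel
  lw_comp := by decide +kernel
  comp_lw := by decide +kernel
  lw_tau := by decide +kernel
  lw_idem := by decide +kernel
  lw_mul := by decide +kernel
  lw_chain_left := by decide +kernel
  lw_chain_right := by decide +kernel
  lw_fst_ne_one := by decide +kernel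
  exists_lw_fst := by decide +kernel
  len_lw := by decide +kernel
  len_eq_zero := by decide +kernel
  len_one := by decide +kernel
  len_top := by decide +kernel
  len_lt_top := by decide +kernel
  atom_comm := by decide +kernel
  atom_braid := by decide +kernel
  generated := by
    intro P h0 ha hm hl _
    have h1 : P 1 := ha 0
    have h2 : P 2 := ha 1
    have h4 : P 4 := hm 2 1 (by decide +kernel) h2 h1
    have h3 : P 3 := hl 3 2 (by decide +kernel) h2 h4
    intro a
    fin_cases a <;> assumption
  len_band := by decide +kernel
  exists_band := by decide +kernel
  exists_len_one := by decide +kernel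
  ev_one := rfl
  ev_top := by simp [ev3, delta, descProd, List.Ico, List.range']
  ev_atom := by intro i; fin_cases i <;> rfl
  ev_band := ev3_band3
  ev_lw := ev_lw_of_mul 0 lw3 ev3 ev3_mul (by decide +kernel)


/-! ### The decision algorithm on lists -/

namespace Germ
variable {n : ℕ} (D : Germ n)

/-- Puts a simple element in front of a word, unless it is `one`. -/
def push (q : D.S) (L : List D.S) : List D.S := if q = D.one then L else q :: L

/-- The second half of right multiplication by `s`: the word is held in reverse order in the second
argument, and its letters are combined with `s` from right to left while the result is built up. -/
def up : D.S → List D.S → List D.S → List D.S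
  | s, [], acc => D.push s acc
  | s, A :: aux, acc => up (D.lw A s).1 aux (D.push (D.lw A s).2 acc)

/-- Right multiplication of a word by a simple element, before the letters `one` are removed. -/
def raw : List D.S → D.S → S D × List D.S
  | [], s => (s, [])
  | A :: L, s => ((D.lw A (raw L s).1).1, (D.lw A (raw L s).1).2 :: (raw L s).2)

theorem push_append (q : D.S) (L L' : List D.S) :
    D.push q (L ++ L') = D.push q L ++ L' := by
  unfold push; split_ifs <;> simp

theorem filter_cons (q : D.S) (L : List D.S) :
    (q :: L).filter (· ≠ D.one) = D.push q (L.filter (· ≠ D.one)) := by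
  by_cases h : q = D.one <;> simp [push, h]

theorem up_reverse_append (L : List D.S) (s : D.S) (aux acc : List D.S) :
    D.up s (L.reverse ++ aux) acc =
      D.up (D.raw L s).1 aux ((D.raw L s).2.filter (· ≠ D.one) ++ acc) := by
  induction L generalizing aux with
  | nil => rfl
  | cons A L ih =>
    rw [List.reverse_cons, List.append_assoc, ih]
    simp only [List.cons_append, List.nil_append, up, raw]
    rw [filter_cons, push_append]

theorem up_reverse (L : List D.S) (s : D.S) :
    D.up s L.reverse [] = ((D.raw L s).1 :: (D.raw L s).2).filter (· ≠ D.one) := by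
  have := D.up_reverse_append L s [] []
  rw [List.append_nil, List.append_nil] at this
  rw [this, filter_cons]; rfl

/-- In a left-weighted word nothing but `one` follows a `one`, so that removing these letters leaves a
word in normal form. -/
theorem isNF_filter {L : List D.S} (h : L.IsChain (fun a b => D.lw a b = (a, b))) :
    D.IsNF (L.filter (· ≠ D.one)) := by
  refine ⟨?_, fun a ha => by simpa using (List.mem_filter.1 ha).2⟩
  induction L with
  | nil => simp
  | cons a L ih =>
    have hL := ih h.tail
    by_cases ha : a = D.one
    · subst ha
      simpa using hL
    · rw [List.filter_cons_of_pos (by simpa using ha)]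
      refine List.isChain_cons.2 ⟨?_, hL⟩
      intro y hy
      cases L with
      | nil => simp at hy
      | cons b L =>
        have hab := (List.isChain_cons_cons.1 h).1
        by_cases hb : b = D.one
        · -- nothing but `1` follows a `1` in a weighted chain
          have hall : ∀ c ∈ b :: L, c = D.one := by
            have h2 := h.tail
            simp only [List.tail_cons] at h2
            clear hL ih h hab hy ha
            induction L generalizing b with
            | nil => simpa using hb
            | cons c L ih =>
              have hbc := (List.isChain_cons_cons.1 h2).1
              rw [hb, D.one_lw] at hbc
              have hc : c = D.one := (Prod.ext_iff.1 hbc).1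
              intro d hd
              rcases List.mem_cons.1 hd with rfl | hd
              · exact hb
              · exact ih c hc h2.tail d hd
          have : (b :: L).filter (· ≠ D.one) = [] := by
            rw [List.filter_eq_nil_iff]; intro c hc; simp [hall c hc]
          rw [this] at hy; simp at hy
        · rw [List.filter_cons_of_pos (by simpa using hb)] at hy
          simp only [List.head?_cons, Option.mem_def, Option.some.injEq] at hy
          rw [← hy]; exact hab

theorem raw_chain {L : List D.S} (h : L.IsChain (fun a b => D.lw a b = (a, b))) (s : D.S) :
    ((D.raw L s).1 :: (D.raw L s).2).IsChain (fun a b => D.lw a b = (a, b)) := by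
  induction L with
  | nil => simp [raw]
  | cons A L ih =>
    have h1 := ih h.tail
    simp only [raw]
    refine List.isChain_cons_cons.2 ⟨by rw [D.lw_idem], ?_⟩
    cases L with
    | nil => simp [raw]
    | cons B L =>
      have hAB := (List.isChain_cons_cons.1 h).1
      refine List.isChain_cons_cons.2 ⟨D.lw_chain_right A B _ hAB, (List.isChain_cons_cons.1 h1).2⟩

theorem prod_filter (L : List D.S) : D.prod (L.filter (· ≠ D.one)) = D.prod L := by
  induction L with
  | nil => rfl
  | cons a L ih =>
    by_cases ha : a = D.one
    · subst ha; simp [D.ev_one] at ih ⊢; exact ih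
    · rw [List.filter_cons_of_pos (by simpa using ha), prod_cons, prod_cons, ih]

theorem prod_raw (L : List D.S) (s : D.S) :
    D.ev (D.raw L s).1 * D.prod (D.raw L s).2 = D.prod L * D.ev s := by
  induction L with
  | nil => simp [raw]
  | cons A L ih => simp only [raw, prod_cons]; rw [← mul_assoc, D.ev_lw, mul_assoc, ih, mul_assoc]

theorem prod_up_reverse (L : List D.S) (s : D.S) :
    D.prod (D.up s L.reverse []) = D.prod L * D.ev s := by
  rw [up_reverse, prod_filter, prod_cons, prod_raw]

theorem isNF_up_reverse {L : List D.S} (h : D.IsNF L) (s : D.S) :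
    D.IsNF (D.up s L.reverse []) := by
  rw [up_reverse]; exact D.isNF_filter (D.raw_chain h.chain s)

theorem length_push (q : D.S) (L : List D.S) : (D.push q L).length ≤ L.length + 1 := by
  unfold push; split_ifs <;> simp

theorem length_up (s : D.S) (aux acc : List D.S) :
    (D.up s aux acc).length ≤ aux.length + acc.length + 1 := by
  induction aux generalizing s acc with
  | nil => simpa [up] using D.length_push s acc
  | cons A aux ih =>
    have h1 := ih (D.lw A s).1 (D.push (D.lw A s).2 acc)
    have h2 := D.length_push (D.lw A s).2 acc
    simp only [up, List.length_cons]; omega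

/-- The braid which the algorithm encodes by a counter `m` and a word `L`, namely `L δ ^ (-m)`. -/
def val (m : ℕ) (L : List D.S) : Braid n := D.prod L * delta n ^ (-(m : ℤ))

/-- Reads a band word by right multiplication. A negative letter `a⁻¹` equals `(comp a) δ⁻¹` and
raises the counter; letters are twisted by `τ ^ m` in order to pass `δ ^ (-m)`. -/
def read : ℕ → List D.S → BandWord n → ℕ × List D.S
  | m, L, [] => (m, L)
  | m, L, (a, true) :: W => read m (D.up ((D.tau ^ m) (D.band a)) L.reverse []) W
  | m, L, (a, false) :: W => read (m + 1) (D.up ((D.tau ^ m) (D.comp (D.band a))) L.reverse []) W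

theorem val_mul_ev (m : ℕ) (L : List D.S) (s : D.S) :
    D.val m L * D.ev s = D.val m (D.up ((D.tau ^ m) s) L.reverse []) := by
  have h := D.ev_mul_delta_zpow ((D.tau ^ m) s) (-(m : ℤ))
  rw [← zpow_natCast D.tau, ← Equiv.Perm.mul_apply, ← zpow_add, neg_add_cancel, zpow_zero,
    Equiv.Perm.one_apply, zpow_natCast] at h
  rw [val, val, prod_up_reverse, mul_assoc, mul_assoc, h]

theorem read_spec (W : BandWord n) : ∀ (m : ℕ) (L : List D.S), D.IsNF L →
    D.IsNF (D.read m L W).2 ∧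
      D.val (D.read m L W).1 (D.read m L W).2 = D.val m L * W.toBraid := by
  induction W with
  | nil => intro m L h; exact ⟨h, by simp [read, BandWord.toBraid]⟩
  | cons x W ih =>
    intro m L h
    have hW : BandWord.toBraid (x :: W) = x.toBraid * BandWord.toBraid W := by
      simp [BandWord.toBraid]
    rw [hW]
    obtain ⟨a, b⟩ := x
    cases b with
    | true =>
      obtain ⟨h1, h2⟩ := ih m _ (D.isNF_up_reverse h ((D.tau ^ m) (D.band a)))
      refine ⟨h1, ?_⟩
      rw [← mul_assoc]
      simp only [read]
      rw [h2, ← val_mul_ev, D.ev_band]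
      rfl
    | false =>
      obtain ⟨h1, h2⟩ := ih (m + 1) _ (D.isNF_up_reverse h ((D.tau ^ m) (D.comp (D.band a))))
      refine ⟨h1, ?_⟩
      rw [← mul_assoc]
      simp only [read]
      rw [h2]
      congr 1
      have h3 : D.val (m + 1) (D.up ((D.tau ^ m) (D.comp (D.band a))) L.reverse []) =
          D.val m (D.up ((D.tau ^ m) (D.comp (D.band a))) L.reverse []) * (delta n)⁻¹ := by
        rw [val, val, mul_assoc, ← zpow_sub_one]; congr 2; push_cast; ring
      have hc := D.ev_mul (a := D.band a) (b := D.comp (D.band a)) (by rw [D.lw_comp])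
      rw [D.lw_comp, D.ev_top, D.ev_band] at hc
      rw [h3, ← val_mul_ev, eq_inv_mul_of_mul_eq hc]
      simp [SignedBand.toBraid, mul_assoc]

/-- Cycling of a word: the letters `δ` at its front are moved to the reversed word in the second
argument, each of them changing the twist; then the first proper factor is removed, twisted, and
multiplied to the right end of what remains. -/
def cycAux : Equiv.Perm D.S → List D.S → List D.S → List D.S
  | _, aux, [] => D.up D.one aux []
  | u, aux, A :: L =>
    if A = D.top then cycAux (u * D.tau⁻¹) (D.top :: aux) L else D.up (u A) (L.reverse ++ aux) []

/-- Cycling of the braid `L δ ^ (-m)`. -/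
def cycStep (m : ℕ) (L : List D.S) : List D.S := D.cycAux (D.tau ^ m) [] L

theorem exists_split {L : List D.S} (h : D.IsNF L) :
    ∃ j L', L = List.replicate j D.top ++ L' ∧ D.IsNF L' ∧ ∀ a ∈ L', a ≠ D.top := by
  induction L with
  | nil => exact ⟨0, [], rfl, h, by simp⟩
  | cons a L ih =>
    by_cases ha : a = D.top
    · obtain ⟨j, L', rfl, h1, h2⟩ := ih h.tail
      exact ⟨j + 1, L', by rw [ha]; rfl, h1, h2⟩
    · exact ⟨0, a :: L, rfl, h, D.ne_top_of_head h ha⟩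

theorem cycAux_replicate (u : Equiv.Perm D.S) (aux : List D.S) (j : ℕ) (L : List D.S) :
    D.cycAux u aux (List.replicate j D.top ++ L) =
      D.cycAux (u * D.tau⁻¹ ^ j) (List.replicate j D.top ++ aux) L := by
  induction j generalizing u aux with
  | zero => simp
  | succ j ih =>
    rw [List.replicate_succ, List.cons_append, cycAux, if_pos rfl, ih, mul_assoc, ← pow_succ']
    congr 1
    rw [← List.replicate_succ, List.replicate_succ', List.append_assoc, List.singleton_append]

theorem isNF_replicate_append (j : ℕ) {L : List D.S} (h : D.IsNF L) :
    D.IsNF (List.replicate j D.top ++ L) := by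
  induction j with
  | zero => simpa using h
  | succ j ih =>
    rw [List.replicate_succ, List.cons_append]
    refine ⟨List.isChain_cons.2 ⟨fun y _ => D.top_lw y, ih.chain⟩, ?_⟩
    intro a ha
    rcases List.mem_cons.1 ha with rfl | ha
    · exact D.top_ne_one
    · exact ih.ne_one a ha

theorem prod_replicate (j : ℕ) : D.prod (List.replicate j D.top) = delta n ^ (j : ℤ) := by
  simp [prod, D.ev_top]

theorem val_nf (m j : ℕ) {L : List D.S} (h : D.IsNF L) (h2 : ∀ a ∈ L, a ≠ D.top) :
    D.lo (D.val m (List.replicate j D.top ++ L)) = j - m ∧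
      D.facs (D.val m (List.replicate j D.top ++ L)) = L.map (D.tau ^ (-(m : ℤ))) := by
  have h3 := D.nf_unique (r := j) h h2
  have h4 := D.nf_mul_delta (-(m : ℤ)) (delta n ^ (j : ℤ) * D.prod L)
  rw [h3.1, h3.2] at h4
  rw [val, prod_append, prod_replicate]
  exact h4

theorem cycStep_spec (m : ℕ) {L : List D.S} (h : D.IsNF L) :
    D.IsNF (D.cycStep m L) ∧ D.val m (D.cycStep m L) = D.cyc (D.val m L) := by
  obtain ⟨j, L, rfl, h1, h2⟩ := D.exists_split h
  obtain ⟨h3, h4⟩ := D.val_nf m j h1 h2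
  rw [cycStep, cycAux_replicate, List.append_nil]
  have hrev : ∀ M : List D.S, M.reverse ++ List.replicate j D.top =
      (List.replicate j D.top ++ M).reverse := by intro M; simp
  cases L with
  | nil =>
    simp only [List.append_nil] at h h4 ⊢
    have h5 : D.cycAux (D.tau ^ m * D.tau⁻¹ ^ j) (List.replicate j D.top) [] =
        D.up D.one (List.replicate j D.top).reverse [] := by
      rw [List.reverse_replicate]; rfl
    rw [h5]
    refine ⟨D.isNF_up_reverse h _, ?_⟩
    rw [D.cyc_of_facs_nil h4, val, prod_up_reverse, D.ev_one, mul_one, val]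
  | cons A L =>
    rw [cycAux, if_neg (h2 A (by simp)), hrev]
    refine ⟨D.isNF_up_reverse (D.isNF_replicate_append j h1.tail) _, ?_⟩
    rw [List.map_cons] at h4
    have h5 : (D.tau ^ (-(m : ℤ))) ((D.tau ^ m * D.tau⁻¹ ^ j) A) =
        (D.tau ^ (-((j : ℤ) - m))) ((D.tau ^ (-(m : ℤ))) A) := by
      rw [← Equiv.Perm.mul_apply, ← Equiv.Perm.mul_apply, ← zpow_natCast D.tau m,
        ← zpow_natCast D.tau⁻¹ j, inv_zpow', ← zpow_add, ← zpow_add, ← zpow_add]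
      congr 2; ring
    rw [D.cyc_of_facs_cons h4, h3, val, prod_up_reverse, prod_append, prod_append, prod_cons,
      prod_nil, mul_one, prod_replicate, mul_assoc, mul_assoc, D.ev_mul_delta_zpow,
      ← mul_assoc (D.prod L), D.prod_mul_delta, sub_eq_add_neg, zpow_add]
    rw [h5, sub_eq_add_neg]
    simp only [mul_assoc]

/-- Whether the word has exactly `k - 1` letters `δ` at its front, and a factor of length `n - 2`
after these. -/
def verdict : ℕ → List D.S → Bool
  | _, [] => false
  | 0, _ :: _ => false
  | k + 1, A :: L =>
    if A = D.top then verdict k L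
    else decide (k = 0) && (A :: L).any fun B => D.len B = n - 2

theorem verdict_iff (m : ℕ) {L : List D.S} (h : D.IsNF L) :
    D.verdict m L = true ↔ D.lo (D.val m L) = -1 ∧ D.HasCoatom (D.facs (D.val m L)) := by
  obtain ⟨j, L, rfl, h1, h2⟩ := D.exists_split h
  obtain ⟨h3, h4⟩ := D.val_nf m j h1 h2
  have hco : D.HasCoatom (L.map (D.tau ^ (-(m : ℤ)))) ↔ D.HasCoatom L := by
    simp only [HasCoatom, List.mem_map]
    constructor
    · rintro ⟨_, ⟨A, hA, rfl⟩, hl⟩; exact ⟨A, hA, by rwa [len_zpow_tau] at hl⟩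
    · rintro ⟨A, hA, hl⟩; exact ⟨_, ⟨A, hA, rfl⟩, by rwa [len_zpow_tau]⟩
  rw [h3, h4, hco]
  clear h3 h4 hco h
  induction j generalizing m with
  | zero =>
    cases L with
    | nil => simp [verdict, HasCoatom]
    | cons A L =>
      have hA := h2 A (by simp)
      cases m with
      | zero => simp [verdict]
      | succ m =>
        simp only [List.replicate_zero, List.nil_append, verdict, hA, if_false, Bool.and_eq_true,
          decide_eq_true_eq, List.any_eq_true, HasCoatom]
        refine and_congr ?_ Iff.rfl
        push_cast; omega
  | succ j ih =>
    rw [List.replicate_succ, List.cons_append]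
    cases m with
    | zero => simp [verdict]; omega
    | succ m =>
      simp only [verdict, if_true]
      refine (ih m).trans (and_congr ?_ Iff.rfl)
      push_cast; omega

/-- The algorithm: bring the band word to the form `L δ ^ (-m)`, cycle `2 m` times, and read off the
verdict. -/
def accepts (W : BandWord n) : Bool :=
  D.verdict (D.read 0 [] W).1
    ((D.cycStep (D.read 0 [] W).1)^[2 * (D.read 0 [] W).1] (D.read 0 [] W).2)

theorem iterate_cycStep (m k : ℕ) {L : List D.S} (h : D.IsNF L) :
    D.IsNF ((D.cycStep m)^[k] L) ∧ D.val m ((D.cycStep m)^[k] L) = D.cyc^[k] (D.val m L) := by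
  induction k with
  | zero => exact ⟨h, rfl⟩
  | succ k ih =>
    rw [Function.iterate_succ_apply', Function.iterate_succ_apply', ← ih.2]
    exact D.cycStep_spec m ih.1

theorem isConj_iterate_cyc (k : ℕ) (x : Braid n) : IsConj x (D.cyc^[k] x) := by
  induction k with
  | zero => exact IsConj.refl x
  | succ k ih => rw [Function.iterate_succ_apply']; exact ih.trans (D.isConj_cyc _)

theorem lo_iterate_cyc_mono (x : Braid n) : Monotone fun k => D.lo (D.cyc^[k] x) :=
  monotone_nat_of_le_succ fun k => by
    rw [Function.iterate_succ_apply']; exact D.lo_le_cyc _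

/-- Every second cycling raises `lo` until it reaches a bound `c` which does not exceed the value of
`lo` at some conjugate. -/
theorem le_lo_iterate_cyc (hn : n ≤ 4) {x y : Braid n} (h : IsConj x y) {c : ℤ} (hc : c ≤ D.lo y)
    (k : ℕ) : min c (D.lo x + k) ≤ D.lo (D.cyc^[2 * k] x) := by
  induction k with
  | zero => simp
  | succ k ih =>
    rw [show 2 * (k + 1) = 2 * k + 1 + 1 by ring, Function.iterate_succ_apply',
      Function.iterate_succ_apply']
    have h1 := (D.lo_le_cyc (D.cyc^[2 * k] x)).trans (D.lo_le_cyc _)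
    by_cases hlt : D.lo (D.cyc^[2 * k] x) < D.lo y
    · have := D.lo_lt_cyc_cyc hn ((D.isConj_iterate_cyc (2 * k) x).symm.trans h) hlt
      push_cast
      rcases min_le_iff.1 ih with h2 | h2
      · exact (min_le_left _ _).trans (by omega)
      · exact (min_le_right _ _).trans (by omega)
    · exact (min_le_left _ _).trans (by omega)

theorem conjASQPNotSQP_congr {x y : Braid n} (h : IsConj x y) (hx : ConjASQPNotSQP x) :
    ConjASQPNotSQP y := by
  obtain ⟨⟨γ, h1, h2⟩, h3⟩ := hx
  exact ⟨⟨γ, h1, h.symm.trans h2⟩, fun ⟨γ', h4, h5⟩ => h3 ⟨γ', h4, h.trans h5⟩⟩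

/-- Since `lo ≥ -m` at the start, `2 m` cyclings raise `lo` to at least `0` if this is possible in the
conjugacy class, and `2 m - 2` of them suffice to raise it to `-1`. If no factor of length `n - 2`
shows up at the end, then `Germ.not_conj_ASQP_of_terminal` applies to the last cycling. -/
theorem accepts_iff (hn3 : 3 ≤ n) (hn : n ≤ 4) (W : BandWord n) :
    D.accepts W = true ↔ ConjASQPNotSQP W.toBraid := by
  obtain ⟨h1, h2⟩ := D.read_spec W 0 [] D.isNF_nil
  rw [show D.val 0 [] = 1 by simp [val], one_mul] at h2
  rw [accepts]
  set m := (D.read 0 [] W).1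
  set L := (D.read 0 [] W).2
  obtain ⟨h3, h4⟩ := D.iterate_cycStep m (2 * m) h1
  rw [D.verdict_iff m h3, h4, h2]
  have hlo : -(m : ℤ) ≤ D.lo W.toBraid := by
    rw [← h2, val, lo_mul_delta]
    have := (D.pos_iff (D.prod L)).1 ⟨L, rfl⟩
    omega
  set x := W.toBraid
  constructor
  · rintro ⟨h5, h6⟩
    refine D.conjASQPNotSQP_of_max (D.isConj_iterate_cyc (2 * m) x) ?_ ?_ h6
    · intro y hy
      by_contra! hlt
      have := D.le_lo_iterate_cyc hn hy (c := 0) (by omega) m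
      rw [h5] at this
      omega
    · rw [← h5]; exact D.eq_eval _
  · intro h5
    obtain ⟨y, hy1, hy2⟩ := D.exists_conj_of_conjASQP h5
    have hmax : ∀ z, IsConj x z → D.lo z ≤ -1 := by
      intro z hz
      by_contra! hlt
      exact h5.2 ((D.exists_SQP_iff x).2 ⟨z, hz, by omega⟩)
    have hx := hmax x (IsConj.refl x)
    obtain ⟨k, hk⟩ : ∃ k, m = k + 1 := ⟨m - 1, by omega⟩
    have h6 := D.le_lo_iterate_cyc hn hy1 hy2.ge k
    have key : ∀ i, 2 * k ≤ i → D.lo (D.cyc^[i] x) = -1 := by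
      intro i hi
      have h7 := D.lo_iterate_cyc_mono x hi
      have h8 := hmax _ (D.isConj_iterate_cyc i x)
      simp only at h7
      omega
    refine ⟨key _ (by omega), ?_⟩
    by_contra hco
    rw [show 2 * m = 2 * k + 1 + 1 by omega, Function.iterate_succ_apply'] at hco
    refine D.not_conj_ASQP_of_terminal hn3 hn (key (2 * k + 1) (by omega)) ?_ hco
      (conjASQPNotSQP_congr (D.isConj_iterate_cyc _ x) h5)
    rw [← Function.iterate_succ_apply' D.cyc]
    exact key _ (by omega)

end Germ

/-! ### The Turing machine -/

namespace Germ
variable {n : ℕ} (D : Germ n)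

/-- The stacks of the machine: the input word, the list of simples, a second stack onto which it
is unloaded, two unary counters and the output. -/
inductive Stack
  | inp | main | aux | cycles | shift | out
  deriving DecidableEq

instance : Fintype Stack :=
  ⟨{.inp, .main, .aux, .cycles, .shift, .out}, fun k => by cases k <;> decide⟩

/-- The stack alphabets. -/
def Sym : Stack → Type
  | .inp => SignedBand n
  | .main => D.S
  | .aux => D.S
  | .cycles => Unit
  | .shift => Unit
  | .out => Bool

set_option synthInstance.maxSize 1000 in
set_option synthInstance.maxHeartbeats 200000 in
/-- The control states. The permutation `t` is the twist `τ ^ m`, where `m` is the number of negative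
letters read; `r` tells whether a right multiplication belongs to a cycling or to reading.
* `read`: read a letter; `neg`: raise the counters for a negative letter.
* `down`, `toAux`: unload the word onto the second stack before right multiplication by `s`.
* `up`, `toMain`, `fini`: combine its letters with `s` on the way back.
* `cyc`: count a cycling; `hd`, `hdAux`: unload the letters `δ` at the front, with twist `u`, and
  take the first factor.
* `fin`, `fin2`, `last`, `last2`: compare the number of letters `δ` with the counter.
* `scan`: look for a factor of length `n - 2`.
* `clean`, `clean2`, `write`, `halt`: empty the stacks and write the answer. -/
inductive State
  | read (t : Equiv.Perm D.S)
  | neg (i : Fin 3) (s : D.S) (t : Equiv.Perm D.S)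
  | down (s : D.S) (t : Equiv.Perm D.S) (r : Bool)
  | toAux (A s : D.S) (t : Equiv.Perm D.S) (r : Bool)
  | up (s : D.S) (t : Equiv.Perm D.S) (r : Bool)
  | toMain (q s : D.S) (t : Equiv.Perm D.S) (r : Bool)
  | fini (s : D.S) (t : Equiv.Perm D.S) (r : Bool)
  | cyc (t : Equiv.Perm D.S)
  | hd (u t : Equiv.Perm D.S)
  | hdAux (u t : Equiv.Perm D.S)
  | fin
  | fin2
  | last (b : Bool)
  | last2 (b : Bool)
  | scan (b : Bool)
  | clean (b : Bool)
  | clean2 (b : Bool)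
  | write (b : Bool)
  | halt
  deriving Fintype

instance finite_sym (k : Stack) : Finite (D.Sym k) := by
  cases k <;> dsimp only [Sym] <;> infer_instance

instance : Fintype (D.Sym .inp) := inferInstanceAs (Fintype (SignedBand n))

/-- The initial state. -/
def start : D.State := .read 1

/-- The statements of the machine. The local variable of the machine holds the next control state, so
that the labels are control states as well. -/
abbrev Stmt : Type := Turing.TM2.Stmt D.Sym D.State D.State

variable {D} in
/-- Pop a symbol and change the state accordingly. -/
def popThen (k : Stack) (f : Option (D.Sym k) → D.State) : D.Stmt :=
  .pop k (fun _ x => f x) (.goto id)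

variable {D} in
/-- Push a symbol and change the state. -/
def pushThen (k : Stack) (x : D.Sym k) (q : D.State) : D.Stmt :=
  .push k (fun _ => x) (.load (fun _ => q) (.goto id))

/-- The state after a right multiplication. -/
def next (t : Equiv.Perm D.S) (r : Bool) : D.State := if r then .cyc t else .read t

/-- The program of the machine; it carries out `Germ.accepts`. The local variable is reset before
halting, as the convention for the final configuration demands. -/
def program : D.State → D.Stmt
  | .read t => popThen .inp fun x : Option (SignedBand n) => match x with
    | none => .cyc t
    | some (a, true) => .down (t (D.band a)) t false
    | some (a, false) => .neg 0 (t (D.comp (D.band a))) t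
  | .neg 0 s t => pushThen .cycles () (.neg 1 s t)
  | .neg 1 s t => pushThen .cycles () (.neg 2 s t)
  | .neg 2 s t => pushThen .shift () (.down s (t * D.tau) false)
  | .down s t r => popThen .main fun x : Option D.S => match x with
    | none => .up s t r
    | some A => .toAux A s t r
  | .toAux A s t r => pushThen .aux A (.down s t r)
  | .up s t r => popThen .aux fun x : Option D.S => match x with
    | none => if s = D.one then D.next t r else .fini s t r
    | some A => if (D.lw A s).2 = D.one then .up (D.lw A s).1 t r
      else .toMain (D.lw A s).2 (D.lw A s).1 t r
  | .toMain q s t r => pushThen .main q (.up s t r)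
  | .fini s t r => pushThen .main s (D.next t r)
  | .cyc t => popThen .cycles fun x : Option Unit => match x with
    | none => .fin
    | some _ => .hd t t
  | .hd u t => popThen .main fun x : Option D.S => match x with
    | none => .up D.one t true
    | some A => if A = D.top then .hdAux u t else .down (u A) t true
  | .hdAux u t => pushThen .aux D.top (.hd (u * D.tau⁻¹) t)
  | .fin => popThen .main fun x : Option D.S => match x with
    | none => .clean false
    | some A => if A = D.top then .fin2 else .last (decide (D.len A = n - 2))
  | .fin2 => popThen .shift fun x : Option Unit => match x with
    | none => .clean false
    | some _ => .fin
  | .last b => popThen .shift fun x : Option Unit => match x with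
    | none => .clean false
    | some _ => .last2 b
  | .last2 b => popThen .shift fun x : Option Unit => match x with
    | none => .scan b
    | some _ => .clean false
  | .scan b => popThen .main fun x : Option D.S => match x with
    | none => .clean b
    | some A => .scan (b || decide (D.len A = n - 2))
  | .clean b => popThen .main fun x : Option D.S => match x with
    | none => .clean2 b
    | some _ => .clean b
  | .clean2 b => popThen .shift fun x : Option Unit => match x with
    | none => .write b
    | some _ => .clean2 b
  | .write b => pushThen .out b .halt
  | .halt => .load (fun _ => D.start) .halt

/-- The contents of the stacks. -/
def stk (i : List (SignedBand n)) (m a : List D.S) (c d : ℕ) (o : List Bool) :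
    ∀ k, List (D.Sym k)
  | .inp => i
  | .main => m
  | .aux => a
  | .cycles => List.replicate c ()
  | .shift => List.replicate d ()
  | .out => o

variable {D} in
/-- The configurations of the running machine, in which the label and the local variable agree and the
output stack is empty. -/
def cfg (q : D.State) (i : List (SignedBand n)) (m a : List D.S) (c d : ℕ) :
    Turing.TM2.Cfg D.Sym D.State D.State := ⟨some q, q, D.stk i m a c d []⟩

/-- The machine gets from `x` to `y` in at most `N` steps. -/
def Reach (N : ℕ) (x y : Turing.TM2.Cfg D.Sym D.State D.State) : Prop :=
  ∃ k ≤ N, (flip bind (Turing.TM2.step D.program))^[k] (some x) = some y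

variable {D}

theorem Reach.trans {M N : ℕ} {x y z : Turing.TM2.Cfg D.Sym D.State D.State}
    (h : D.Reach M x y) (h' : D.Reach N y z) : D.Reach (M + N) x z := by
  obtain ⟨k, hk, h1⟩ := h
  obtain ⟨l, hl, h2⟩ := h'
  exact ⟨l + k, by omega, by rw [Function.iterate_add_apply, h1, h2]⟩

theorem Reach.mono {M N : ℕ} {x y : Turing.TM2.Cfg D.Sym D.State D.State}
    (h : D.Reach M x y) (hN : M ≤ N) : D.Reach N x y := by
  obtain ⟨k, hk, h1⟩ := h
  exact ⟨k, by omega, h1⟩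

theorem Reach.of_step {x y : Turing.TM2.Cfg D.Sym D.State D.State}
    (h : Turing.TM2.step D.program x = some y) : D.Reach 1 x y := ⟨1, le_rfl, h⟩

variable {q q' : D.State} {i : List (SignedBand n)} {m a : List D.S} {c d : ℕ}

theorem reach_pop_inp {f : Option (SignedBand n) → D.State}
    (h : D.program q = popThen .inp f) (hq : f i.head? = q') :
    D.Reach 1 (cfg q i m a c d) (cfg q' i.tail m a c d) := by
  apply Reach.of_step
  have : Function.update (D.stk i m a c d []) .inp i.tail = D.stk i.tail m a c d [] := by
    funext k; cases k <;> rfl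
  rw [cfg, cfg, ← this, Turing.TM2.step, h, ← hq]; rfl

theorem reach_pop_main {f : Option D.S → D.State} (h : D.program q = popThen .main f)
    (hq : f m.head? = q') :
    D.Reach 1 (cfg q i m a c d) (cfg q' i m.tail a c d) := by
  apply Reach.of_step
  have : Function.update (D.stk i m a c d []) .main m.tail = D.stk i m.tail a c d [] := by
    funext k; cases k <;> rfl
  rw [cfg, cfg, ← this, Turing.TM2.step, h, ← hq]; rfl

theorem reach_pop_aux {f : Option D.S → D.State} (h : D.program q = popThen .aux f)
    (hq : f a.head? = q') :
    D.Reach 1 (cfg q i m a c d) (cfg q' i m a.tail c d) := by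
  apply Reach.of_step
  have : Function.update (D.stk i m a c d []) .aux a.tail = D.stk i m a.tail c d [] := by
    funext k; cases k <;> rfl
  rw [cfg, cfg, ← this, Turing.TM2.step, h, ← hq]; rfl

theorem reach_pop_cycles_zero {f : Option Unit → D.State} (h : D.program q = popThen .cycles f)
    (hq : f none = q') :
    D.Reach 1 (cfg q i m a 0 d) (cfg q' i m a 0 d) := by
  apply Reach.of_step
  have : Function.update (D.stk i m a 0 d []) .cycles [] = D.stk i m a 0 d [] := by
    funext k; cases k <;> rfl
  rw [cfg, cfg, Turing.TM2.step, h, ← hq]; nth_rw 2 [← this]; rfl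

theorem reach_pop_cycles_succ {f : Option Unit → D.State} (h : D.program q = popThen .cycles f)
    (hq : f (some ()) = q') :
    D.Reach 1 (cfg q i m a (c + 1) d) (cfg q' i m a c d) := by
  apply Reach.of_step
  have : Function.update (D.stk i m a (c + 1) d []) .cycles (List.replicate c ()) =
      D.stk i m a c d [] := by
    funext k; cases k <;> rfl
  rw [cfg, cfg, ← this, Turing.TM2.step, h, ← hq]; rfl

theorem reach_pop_shift_zero {f : Option Unit → D.State} (h : D.program q = popThen .shift f)
    (hq : f none = q') :
    D.Reach 1 (cfg q i m a c 0) (cfg q' i m a c 0) := by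
  apply Reach.of_step
  have : Function.update (D.stk i m a c 0 []) .shift [] = D.stk i m a c 0 [] := by
    funext k; cases k <;> rfl
  rw [cfg, cfg, Turing.TM2.step, h, ← hq]; nth_rw 2 [← this]; rfl

theorem reach_pop_shift_succ {f : Option Unit → D.State} (h : D.program q = popThen .shift f)
    (hq : f (some ()) = q') :
    D.Reach 1 (cfg q i m a c (d + 1)) (cfg q' i m a c d) := by
  apply Reach.of_step
  have : Function.update (D.stk i m a c (d + 1) []) .shift (List.replicate d ()) =
      D.stk i m a c d [] := by
    funext k; cases k <;> rfl
  rw [cfg, cfg, ← this, Turing.TM2.step, h, ← hq]; rfl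

theorem reach_push_main {x : D.S} (h : D.program q = pushThen .main x q') :
    D.Reach 1 (cfg q i m a c d) (cfg q' i (x :: m) a c d) := by
  apply Reach.of_step
  have : Function.update (D.stk i m a c d []) .main (x :: m) = D.stk i (x :: m) a c d [] := by
    funext k; cases k <;> rfl
  rw [cfg, cfg, ← this, Turing.TM2.step, h]; rfl

theorem reach_push_aux {x : D.S} (h : D.program q = pushThen .aux x q') :
    D.Reach 1 (cfg q i m a c d) (cfg q' i m (x :: a) c d) := by
  apply Reach.of_step
  have : Function.update (D.stk i m a c d []) .aux (x :: a) = D.stk i m (x :: a) c d [] := by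
    funext k; cases k <;> rfl
  rw [cfg, cfg, ← this, Turing.TM2.step, h]; rfl

theorem reach_push_cycles (h : D.program q = pushThen .cycles () q') :
    D.Reach 1 (cfg q i m a c d) (cfg q' i m a (c + 1) d) := by
  apply Reach.of_step
  have : Function.update (D.stk i m a c d []) .cycles (List.replicate (c + 1) ()) =
      D.stk i m a (c + 1) d [] := by
    funext k; cases k <;> rfl
  rw [cfg, cfg, ← this, Turing.TM2.step, h]; rfl

theorem reach_push_shift (h : D.program q = pushThen .shift () q') :
    D.Reach 1 (cfg q i m a c d) (cfg q' i m a c (d + 1)) := by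
  apply Reach.of_step
  have : Function.update (D.stk i m a c d []) .shift (List.replicate (d + 1) ()) =
      D.stk i m a c (d + 1) [] := by
    funext k; cases k <;> rfl
  rw [cfg, cfg, ← this, Turing.TM2.step, h]; rfl

/-! ### Running time and correctness of the machine -/

theorem reach_down (s : D.S) (t : Equiv.Perm D.S) (r : Bool) :
    D.Reach (2 * m.length + 1) (cfg (.down s t r) i m a c d)
      (cfg (.up s t r) i [] (m.reverse ++ a) c d) := by
  induction m generalizing a with
  | nil => exact reach_pop_main rfl rfl
  | cons A m ih =>
    have h1 : D.Reach 1 (cfg (.down s t r) i (A :: m) a c d) (cfg (.toAux A s t r) i m a c d) :=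
      reach_pop_main rfl rfl
    have h2 : D.Reach 1 (cfg (.toAux A s t r) i m a c d) (cfg (.down s t r) i m (A :: a) c d) :=
      reach_push_aux rfl
    have h3 := (h1.trans h2).trans ih
    rw [List.reverse_cons, List.append_assoc, List.singleton_append]
    exact h3.mono (by rw [List.length_cons]; omega)

theorem reach_up (s : D.S) (t : Equiv.Perm D.S) (r : Bool) :
    D.Reach (2 * a.length + 2) (cfg (.up s t r) i m a c d)
      (cfg (D.next t r) i (D.up s a m) [] c d) := by
  induction a generalizing s m with
  | nil =>
    have h1 : D.Reach 1 (cfg (.up s t r) i m [] c d)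
        (cfg (if s = D.one then D.next t r else .fini s t r) i m [] c d) := reach_pop_aux rfl rfl
    rw [up, push]
    split_ifs at h1 ⊢ with hs
    · exact h1.mono (by simp)
    · exact (h1.trans (reach_push_main rfl)).mono (by simp)
  | cons A a ih =>
    have h1 : D.Reach 1 (cfg (.up s t r) i m (A :: a) c d)
        (cfg (if (D.lw A s).2 = D.one then .up (D.lw A s).1 t r
          else .toMain (D.lw A s).2 (D.lw A s).1 t r) i m a c d) := reach_pop_aux rfl rfl
    rw [up, push]
    split_ifs at h1 ⊢ with hs
    · exact (h1.trans (ih _)).mono (by rw [List.length_cons]; omega)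
    · exact ((h1.trans (reach_push_main rfl)).trans (ih _)).mono
        (by rw [List.length_cons]; omega)

theorem reach_down_up (s : D.S) (t : Equiv.Perm D.S) (r : Bool) :
    D.Reach (4 * m.length + 2 * a.length + 3) (cfg (.down s t r) i m a c d)
      (cfg (D.next t r) i (D.up s (m.reverse ++ a) []) [] c d) :=
  ((reach_down s t r).trans (reach_up s t r)).mono (by simp; omega)

theorem length_read_le (W : BandWord n) : ∀ (k : ℕ) (L : List D.S),
    (D.read k L W).1 ≤ k + W.length ∧ (D.read k L W).2.length ≤ L.length + W.length := by
  induction W with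
  | nil => intro k L; simp [read]
  | cons x W ih =>
    intro k L
    obtain ⟨b, _ | _⟩ := x
    · have h1 := ih (k + 1) (D.up ((D.tau ^ k) (D.comp (D.band b))) L.reverse [])
      have h2 := D.length_up ((D.tau ^ k) (D.comp (D.band b))) L.reverse []
      simp only [read, List.length_cons, List.length_reverse, List.length_nil] at h1 h2 ⊢
      omega
    · have h1 := ih k (D.up ((D.tau ^ k) (D.band b)) L.reverse [])
      have h2 := D.length_up ((D.tau ^ k) (D.band b)) L.reverse []
      simp only [read, List.length_cons, List.length_reverse, List.length_nil] at h1 h2 ⊢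
      omega

theorem reach_read (W : BandWord n) {N : ℕ} : ∀ (k : ℕ) (L : List D.S), L.length + W.length ≤ N →
    D.Reach (W.length * (4 * N + 7) + 1) (cfg (.read (D.tau ^ k)) W L [] (2 * k) k)
      (cfg (.cyc (D.tau ^ (D.read k L W).1)) [] (D.read k L W).2 [] (2 * (D.read k L W).1)
        (D.read k L W).1) := by
  induction W with
  | nil => intro k L _; exact Reach.mono (M := 1) (reach_pop_inp rfl rfl) (by omega)
  | cons x W ih =>
    intro k L hN
    rw [List.length_cons] at hN
    obtain ⟨b, _ | _⟩ := x
    · set s := (D.tau ^ k) (D.comp (D.band b)) with hs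
      have h1 : D.Reach 1 (cfg (.read (D.tau ^ k)) ((b, false) :: W) L [] (2 * k) k)
        (cfg (.neg 0 s (D.tau ^ k)) W L [] (2 * k) k) := reach_pop_inp rfl rfl
      have h2 : D.Reach 1 (cfg (.neg 0 s (D.tau ^ k)) W L [] (2 * k) k)
        (cfg (.neg 1 s (D.tau ^ k)) W L [] (2 * k + 1) k) := reach_push_cycles rfl
      have h3 : D.Reach 1 (cfg (.neg 1 s (D.tau ^ k)) W L [] (2 * k + 1) k)
        (cfg (.neg 2 s (D.tau ^ k)) W L [] (2 * (k + 1)) k) := reach_push_cycles rfl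
      have h4 : D.Reach 1 (cfg (.neg 2 s (D.tau ^ k)) W L [] (2 * (k + 1)) k)
        (cfg (.down s (D.tau ^ (k + 1)) false) W L [] (2 * (k + 1)) (k + 1)) := by
        rw [pow_succ]; exact reach_push_shift rfl
      have h5 := reach_down_up (i := W) (m := L) (a := []) (c := 2 * (k + 1)) (d := k + 1)
        s (D.tau ^ (k + 1)) false
      have h6 := D.length_up s L.reverse []
      rw [List.append_nil] at h5
      have h7 := ih (k + 1) (D.up s L.reverse []) (by simp at h6; omega)
      refine (((((h1.trans h2).trans h3).trans h4).trans h5).trans h7).mono ?_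
      simp only [List.length_cons, List.length_nil]
      nlinarith
    · set s := (D.tau ^ k) (D.band b) with hs
      have h1 : D.Reach 1 (cfg (.read (D.tau ^ k)) ((b, true) :: W) L [] (2 * k) k)
        (cfg (.down s (D.tau ^ k) false) W L [] (2 * k) k) := reach_pop_inp rfl rfl
      have h5 := reach_down_up (i := W) (m := L) (a := []) (c := 2 * k) (d := k)
        s (D.tau ^ k) false
      have h6 := D.length_up s L.reverse []
      rw [List.append_nil] at h5
      have h7 := ih k (D.up s L.reverse []) (by simp at h6; omega)
      refine ((h1.trans h5).trans h7).mono ?_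
      simp only [List.length_cons, List.length_nil]
      nlinarith

theorem reach_hd (u t : Equiv.Perm D.S) :
    D.Reach (4 * m.length + 2 * a.length + 3) (cfg (.hd u t) i m a c d)
      (cfg (.cyc t) i (D.cycAux u a m) [] c d) := by
  induction m generalizing u a with
  | nil =>
    have h1 : D.Reach 1 (cfg (.hd u t) i [] a c d) (cfg (.up D.one t true) i [] a c d) :=
      reach_pop_main rfl rfl
    exact (h1.trans (reach_up D.one t true)).mono (by simp; omega)
  | cons A m ih =>
    have h1 : D.Reach 1 (cfg (.hd u t) i (A :: m) a c d)
        (cfg (if A = D.top then .hdAux u t else .down (u A) t true) i m a c d) :=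
      reach_pop_main rfl rfl
    rw [cycAux]
    split_ifs at h1 ⊢ with hA
    · exact ((h1.trans (reach_push_aux rfl)).trans (ih _)).mono (by simp; omega)
    · exact (h1.trans (reach_down_up _ t true)).mono (by simp; omega)

theorem length_cycAux (u : Equiv.Perm D.S) (a m : List D.S) :
    (D.cycAux u a m).length ≤ m.length + a.length + 1 := by
  induction m generalizing u a with
  | nil => simpa [cycAux] using D.length_up D.one a []
  | cons A m ih =>
    rw [cycAux]
    split_ifs
    · have := ih (u * D.tau⁻¹) (D.top :: a)
      simp only [List.length_cons] at this ⊢; omega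
    · have := D.length_up (u A) (m.reverse ++ a) []
      simp at this ⊢; omega

theorem reach_cyc {N : ℕ} (k : ℕ) : ∀ (c : ℕ) (L : List D.S), L.length + c ≤ N →
    D.Reach (c * (4 * N + 4) + 1) (cfg (.cyc (D.tau ^ k)) i L [] c d)
      (cfg .fin i ((D.cycStep k)^[c] L) [] 0 d) := by
  intro c
  induction c with
  | zero => intro L _; exact Reach.mono (M := 1) (reach_pop_cycles_zero rfl rfl) (by omega)
  | succ c ih =>
    intro L hN
    have h1 : D.Reach 1 (cfg (.cyc (D.tau ^ k)) i L [] (c + 1) d)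
      (cfg (.hd (D.tau ^ k) (D.tau ^ k)) i L [] c d) := reach_pop_cycles_succ rfl rfl
    have h2 : D.Reach _ _ (cfg (.cyc (D.tau ^ k)) i (D.cycStep k L) [] c d) :=
      reach_hd (i := i) (m := L) (a := []) (c := c) (d := d) (D.tau ^ k) (D.tau ^ k)
    have h3 : (D.cycStep k L).length ≤ L.length + 1 := by
      simpa [cycStep] using length_cycAux (D.tau ^ k) [] L
    have h4 := ih (D.cycStep k L) (by omega)
    rw [Function.iterate_succ_apply]
    refine ((h1.trans h2).trans h4).mono ?_
    simp only [List.length_nil]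
    nlinarith

theorem length_iterate_cycStep (k c : ℕ) (L : List D.S) :
    ((D.cycStep k)^[c] L).length ≤ L.length + c := by
  induction c with
  | zero => simp
  | succ c ih =>
    rw [Function.iterate_succ_apply']
    have := length_cycAux (D.tau ^ k) [] ((D.cycStep k)^[c] L)
    simp only [List.length_nil] at this
    rw [cycStep]; omega

/-- The configuration in which the machine has halted with the answer `b`. -/
def haltCfg (D : Germ n) (b : Bool) : Turing.TM2.Cfg D.Sym D.State D.State :=
  ⟨none, D.start, D.stk [] [] [] 0 0 [b]⟩

theorem reach_clean (b : Bool) :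
    D.Reach (m.length + d + 4) (cfg (.clean b) [] m [] 0 d) (haltCfg D b) := by
  induction m with
  | nil =>
    refine Reach.mono (M := 1 + (d + 3)) ?_ (by simp; omega)
    refine Reach.trans (y := cfg (.clean2 b) [] [] [] 0 d) (reach_pop_main rfl rfl) ?_
    induction d with
    | zero =>
      refine Reach.mono (M := 1 + (1 + 1)) ?_ (by omega)
      refine Reach.trans (y := cfg (.write b) [] [] [] 0 0) (reach_pop_shift_zero rfl rfl) ?_
      refine Reach.trans (y := ⟨some .halt, .halt, D.stk [] [] [] 0 0 [b]⟩) (Reach.of_step ?_)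
        (Reach.of_step rfl)
      have : Function.update (D.stk [] [] [] 0 0 []) .out [b] = D.stk [] [] [] 0 0 [b] := by
        funext k; cases k <;> rfl
      rw [← this]; rfl
    | succ d ih =>
      exact (Reach.trans (reach_pop_shift_succ rfl rfl) ih).mono (by omega)
  | cons A m ih =>
    exact (Reach.trans (reach_pop_main rfl rfl) ih).mono (by simp; omega)

theorem reach_scan (b : Bool) :
    D.Reach (m.length + 5) (cfg (.scan b) [] m [] 0 0)
      (haltCfg D (b || m.any fun B => D.len B = n - 2)) := by
  induction m generalizing b with
  | nil =>
    have := (Reach.trans (reach_pop_main rfl rfl) (reach_clean b) :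
      D.Reach _ (cfg (.scan b) [] [] [] 0 0) _)
    simpa using this
  | cons A m ih =>
    rw [List.any_cons, ← Bool.or_assoc]
    exact (Reach.trans (reach_pop_main rfl rfl) (ih _)).mono (by simp; omega)

theorem reach_fin :
    D.Reach (2 * m.length + d + 7) (cfg .fin [] m [] 0 d) (haltCfg D (D.verdict d m)) := by
  induction m generalizing d with
  | nil =>
    have := (Reach.trans (reach_pop_main rfl rfl) (reach_clean false) :
      D.Reach _ (cfg .fin [] [] [] 0 d) _)
    rw [verdict]
    exact this.mono (by simp; omega)
  | cons A m ih =>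
    have h1 : D.Reach 1 (cfg .fin [] (A :: m) [] 0 d)
        (cfg (if A = D.top then .fin2 else .last (decide (D.len A = n - 2))) [] m [] 0 d) :=
      reach_pop_main rfl rfl
    cases d with
    | zero =>
      rw [verdict]
      split_ifs at h1
      all_goals
        exact ((h1.trans (reach_pop_shift_zero rfl rfl)).trans (reach_clean false)).mono
          (by simp; omega)
    | succ d =>
      rw [verdict]
      split_ifs at h1 ⊢
      · exact ((h1.trans (reach_pop_shift_succ rfl rfl)).trans ih).mono (by simp; omega)
      · have h2 := h1.trans (reach_pop_shift_succ rfl rfl)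
        cases d with
        | zero =>
          have h3 := (h2.trans (reach_pop_shift_zero rfl rfl)).trans (reach_scan _)
          rw [List.any_cons, decide_eq_true rfl, Bool.true_and]
          exact h3.mono (by simp; omega)
        | succ d =>
          have h3 := (h2.trans (reach_pop_shift_succ rfl rfl)).trans (reach_clean _)
          rw [decide_eq_false (by omega), Bool.false_and]
          exact h3.mono (by simp; omega)

/-- The machine computes `Germ.accepts` in quadratic time: the word and the counters stay of linear
length, and each of the linearly many letters and cyclings takes one pass over the word. -/
theorem reach_accepts (W : BandWord n) :
    D.Reach (100 * (W.length + 1) ^ 2) (cfg D.start W [] [] 0 0) (haltCfg D (D.accepts W)) := by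
  have h1 := reach_read (D := D) W (N := W.length) 0 [] (by simp)
  obtain ⟨h2, h3⟩ := length_read_le (D := D) W 0 []
  have h4 := reach_cyc (i := []) (d := (D.read 0 [] W).1) (N := 3 * W.length) (D.read 0 [] W).1
    (2 * (D.read 0 [] W).1) (D.read 0 [] W).2 (by simp at h3; omega)
  have h5 := length_iterate_cycStep (D.read 0 [] W).1 (2 * (D.read 0 [] W).1) (D.read 0 [] W).2
  refine ((h1.trans h4).trans reach_fin).mono ?_
  simp only [List.length_nil, zero_add] at h2 h3
  have h6 : 2 * (D.read 0 [] W).1 * (4 * (3 * W.length) + 4) ≤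
      2 * W.length * (4 * (3 * W.length) + 4) := by gcongr
  nlinarith

/-- The Turing machine for the decision problem. -/
def machine (D : Germ n) : Turing.FinTM2 where
  K := Stack
  k₀ := .inp
  k₁ := .out
  Γ := D.Sym
  Λ := D.State
  main := D.start
  σ := D.State
  initialState := D.start
  m := D.program

theorem initList_machine (W : BandWord n) :
    Turing.initList D.machine W = cfg D.start W [] [] 0 0 := by
  simp only [Turing.initList, cfg]
  congr 1
  funext k; cases k <;> rfl

theorem haltList_machine (b : Bool) : Turing.haltList D.machine [b] = haltCfg D b := by
  simp only [Turing.haltList, haltCfg]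
  congr 1
  funext k; cases k <;> rfl

theorem decidableInPolyTime (D : Germ n) (hn3 : 3 ≤ n) (hn : n ≤ 4) :
    DecidableInPolyTime {W : BandWord n | ConjASQPNotSQP W.toBraid} := by
  have key (W : BandWord n) : ∃ k ≤ 100 * (W.length + 1) ^ 2,
      (flip bind D.machine.step)^[k] (some (Turing.initList D.machine W)) =
        some (Turing.haltList D.machine [D.accepts W]) := by
    rw [initList_machine, haltList_machine]; exact reach_accepts W
  refine ⟨D.accepts, fun W => D.accepts_iff hn3 hn W, ⟨⟨D.machine, Equiv.refl _, Equiv.refl _⟩,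
    100 * (Polynomial.X + 1) ^ 2, fun W => ⟨⟨(key W).choose, ?_⟩, ?_⟩⟩, D.finite_sym⟩
  · have hW : List.map (Equiv.refl (D.Sym .inp)).invFun W = W := List.map_id W
    exact (congrArg _ (congrArg (fun V => some (Turing.initList D.machine V)) hW)).trans
      (key W).choose_spec.2
  · simpa using (key W).choose_spec.1

end Germ

end BKL

theorem theorem3p7 :
    (∀ β : BKL.Braid 4, List.TFAE [
      BKL.ConjASQPNotSQP β,
      ∀ γ ∈ BKL.SSS β, BKL.inf γ = -1 ∧
        ∃ L : List (BKL.Braid 4), BKL.IsLCF γ (-1) L ∧ ∃ A ∈ L, BKL.bandLength A = 2,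
      ∃ γ ∈ BKL.SSS β, BKL.inf γ = -1 ∧
        ∃ L : List (BKL.Braid 4), BKL.IsLCF γ (-1) L ∧ ∃ A ∈ L, BKL.bandLength A = 2]) ∧
    (∀ β : BKL.Braid 3, BKL.ConjASQPNotSQP β ↔
      (∀ γ ∈ BKL.SSS β, BKL.inf γ = -1) ∧ ¬ IsConj β (BKL.delta 3)⁻¹) ∧
    BKL.DecidableInPolyTime {W : BKL.BandWord 3 | BKL.ConjASQPNotSQP W.toBraid} ∧
    BKL.DecidableInPolyTime {W : BKL.BandWord 4 | BKL.ConjASQPNotSQP W.toBraid} :=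
  ⟨fun β => BKL.germFour.tfae_four β, fun β => BKL.germThree.conjASQPNotSQP_three β,
    BKL.germThree.decidableInPolyTime le_rfl (by norm_num),
    BKL.germFour.decidableInPolyTime (by norm_num) le_rfl⟩
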